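/- **Flux.** Let $0<u^*<u_{\max}$, let $f_1\in C^2([0,u^*])$ with $f_1(0)=0$, $f_1'>0$, $f_1''\le 0$ on $(0,u^*)$, and let $f_2\in C^2((u^*,u_{\max}])$ with $f_2(u_{\max})=0$, $f_2'<0$, $f_2''\le 0$ on $(u^*,u_{\max})$. Put $f(u^*-)=f_1(u^*)$, $f(u^*+)=\lim_{u\downarrow u^*}f_2(u)=:f_2(u^*)$ and assume $f(u^*-)>f(u^*+)$. Let $f=f_1$ on $[0,u^*)$ and $f=f_2$ on $(u^*,u_{\max}]$; the multivalued flux is $\tilde f(u)=\{f(u)\}$ for $u\ne u^*$, $\tilde f(u^*)=[f(u^*+),f(u^*-)]$. Its graph $\Gamma=\{(u,v):u\in[0,u_{\max}],\,v\in\tilde f(u)\}$ is ordered along the curve from left to right (the vertical part over $u^*$ downwards). Let $u_c\in(0,u^*)$ be the density with $f_1(u_c)=f(u^*+)$. Define $\eta(u)\in[u^*,u_{\max}]$ by $f_2(\eta(u))=f_1(u)$ if $u\in[0,u_c]$; $\eta(u)=u^*$ if $u\in(u_c,u^*)$; and $\eta(u)\in[0,u_c]$ by $f_1(\eta(u))=f_2(u)$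 if $u\in[u^*,u_{\max}]$. **Junction.** Let $1\le n\le m$. There are $n$ incoming roads $x<0$ and $m$ outgoing roads $x>0$ meeting at $x=0$. Let $\beta\in[0,1]^{n\times m}$ with $\sum_j\beta_{i,j}=1$ for all $i$, such that for every choice of at least one and at most $n-1$ of the hyperplanes $e_1^\perp,\dots,e_n^\perp,a_1^\perp,\dots,a_m^\perp$ of $\mathbb R^n$, where $a_j=(\beta_{1,j},\dots,\beta_{n,j})$, with intersection $H$, one has $(1,\dots,1)\notin H^\perp$. **Data.** Let $u^{in}_{i,0},u^{out}_{j,0}\in[0,u_{\max}]$ be constant initial densities; for every outgoing road it is also given whether the traffic ahead is free flowing or congested (this matters only if $u^{out}_{j,0}=u^*$). Let $F_j=f(u^{out}_{j,0})$ if $u^{out}_{j,0}\neq u^*$, and if $u^{out}_{j,0}=u^*$ let $F_j=f(u^*-)$ in the free flowing and $F_j=f(u^*+)$ in the congested case. **Solutions.** A *distributed weak solution* consists of measurable pairs $(u,v)=(u(x,t),v(x,t))$ on every road, $t>0$, constant along rays from the origin, with $u(\cdot,t)$ of bounded variation and $(u,v)\in\Gamma$ a.e., such that: 1. (entropy condition)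 on every open road, for all $(k,\kappa)\in\Gamma$, $\partial_t|u-k|+\partial_x\big(\operatorname{sgn}_\Gamma((u,v)-(k,\kappa))\,(v-\kappa)\big)\le 0$ in the sense of distributions, where $\operatorname{sgn}_\Gamma$ is the sign for the order on $\Gamma$; 2. (weak solution at the junction) for all compactly supported $C^1$ test functions $\phi_i$ on $(-\infty,0]\times[0,\infty)$ and $\psi_j$ on $[0,\infty)\times[0,\infty)$ with $\phi_i(0,\cdot)=\psi_j(0,\cdot)$ and $\partial_x\phi_i(0,\cdot)=\partial_x\psi_j(0,\cdot)$ for all $i,j$, $$\sum_i\Big(\int_0^\infty\!\!\int_{-\infty}^0 (u^{in}_i\partial_t\phi_i+v^{in}_i\partial_x\phi_i)\,dx\,dt+\int_{-\infty}^0u^{in}_{i,0}\phi_i(x,0)\,dx\Big)+\sum_j\Big(\int_0^\infty\!\!\int_0^\infty (u^{out}_j\partial_t\psi_j+v^{out}_j\partial_x\psi_j)\,dx\,dt+\int_0^\infty u^{out}_{j,0}\psi_j(x,0)\,dx\Big)=0;$$ 3. if $u^{out}_{j,0}=u^*$, then $v^{out}_j(x,t)\to F_j$ as $x\to+\infty$,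 for all $t>0$; 4. the flux traces $\gamma^{in}_i=v^{in}_i(0-,t)$, $\gamma^{out}_j=v^{out}_j(0+,t)$ exist for all $t>0$ and $\gamma^{out}_j=\sum_i\beta_{i,j}\gamma^{in}_i$ for all $j$. It is *admissible* if $\sum_i\gamma^{in}_i$ is maximal among all distributed weak solutions with the same data. **Waves.** For $p_L,p_R\in\Gamma$, the wave $(p_L,p_R)$ takes at speed $\xi=x/t$ the states $p=(u,v)$ of the arc of $\Gamma$ between $p_L$ and $p_R$ at which $v-\xi u$ is minimal over the arc if $p_L$ precedes $p_R$ (lower convex hull), and maximal if $p_R$ precedes $p_L$ (upper concave hull). **Theorem.** For all such data there exists an admissible weak solution, and it is unique (any two agree, in $u$ and $v$, almost everywhere on every road). Moreover its density traces $u^{in}_i=u^{in}_i(0-,t)$ and $u^{out}_j=u^{out}_j(0+,t)$ exist and do not depend on $t>0$, $\gamma^{in}_i\in\tilde f(u^{in}_i)$, $\gamma^{out}_j\in\tilde f(u^{out}_j)$, and $$u_i^{in}\in\begin{cases}\{u^{in}_{i,0}\}\cup(\eta(u^{in}_{i,0}),u_{\max}],&u^{in}_{i,0}\in[0,u_c],\\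 \{u^{in}_{i,0}\}\cup[u^*,u_{\max}],&u^{in}_{i,0}\in(u_c,u^*),\\ [u^*,u_{\max}],&u^{in}_{i,0}\in[u^*,u_{\max}],\end{cases}$$ $$u_j^{out}\in\begin{cases}[0,u^*],&u^{out}_{j,0}\in[0,u^*),\\ [0,u^*],&u^{out}_{j,0}=u^*\text{ and free flowing},\\ \{u^*\}\cup[0,u_c),&u^{out}_{j,0}=u^*\text{ and congested},\\ \{u^{out}_{j,0}\}\cup[0,\eta(u^{out}_{j,0})),&u^{out}_{j,0}\in(u^*,u_{\max}].\end{cases}$$ On the incoming road $i$ the solution is, for every $v_0\in\tilde f(u^{in}_{i,0})$, a.e. given by the wave from $(u^{in}_{i,0},v_0)$ to $(u^{in}_i,\gamma^{in}_i)$, and this wave takes only the state $(u^{in}_i,\gamma^{in}_i)$ at every speed $\xi>0$, so that all its waves have nonpositive speed. On the outgoing road $j$ the solution is a.e. given by the wave from $(u^{out}_j,\gamma^{out}_j)$ to $(u^{out}_{j,0},F_j)$, and this wave takes only the state $(u^{out}_j,\gamma^{out}_j)$ at every speed $\xi<0$, so that all its waves have nonnegative speed. -/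

import Mathlib

open Set Filter Topology MeasureTheory

noncomputable section

/-! ### The flux function -/

/-- A flux `f : [0, umax] → ℝ` with a single downward jump at `ustar`.  It is `f₁` on `[0, ustar]`
and `f₂` on `(ustar, umax]`; the number `f₁ ustar` is `f(u*-)` and `f₂ ustar` is `f(u*+)`. -/
structure JumpFlux where
  umax : ℝ
  ustar : ℝ
  f₁ : ℝ → ℝ
  f₂ : ℝ → ℝ
  ustar_pos : 0 < ustar
  ustar_lt : ustar < umax
  contDiff₁ : ContDiffOn ℝ 2 f₁ (Icc 0 ustar)
  contDiff₂ : ContDiffOn ℝ 2 f₂ (Ioc ustar umax)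
  /-- `f₂ ustar` is the limit of the flux from the right. -/
  right_limit : Tendsto f₂ (𝓝[>] ustar) (𝓝 (f₂ ustar))
  zero_left : f₁ 0 = 0
  zero_right : f₂ umax = 0
  deriv₁_pos : ∀ u ∈ Ioo 0 ustar, 0 < deriv f₁ u
  deriv₂_neg : ∀ u ∈ Ioo ustar umax, deriv f₂ u < 0
  /-- Concavity; the strict inequality and the piecewise linear case are both included. -/
  concave₁ : ∀ u ∈ Ioo 0 ustar, deriv (deriv f₁) u ≤ 0
  concave₂ : ∀ u ∈ Ioo ustar umax, deriv (deriv f₂) u ≤ 0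
  jump : f₂ ustar < f₁ ustar

namespace JumpFlux

variable (F : JumpFlux)

/-- The multivalued flux: the whole jump interval is attached to `ustar`. -/
def multi (u : ℝ) : Set ℝ :=
  if u < F.ustar then {F.f₁ u}
  else if u = F.ustar then Icc (F.f₂ F.ustar) (F.f₁ F.ustar)
  else {F.f₂ u}

/-- The graph of the multivalued flux: pairs (density, flux). -/
def graph : Set (ℝ × ℝ) := {p | p.1 ∈ Icc 0 F.umax ∧ p.2 ∈ F.multi p.1}

/-- The density `< ustar` whose flux is `f(u*+)` (written `f⁻¹(u*+)`). -/
def ucrit : ℝ := Function.invFunOn F.f₁ (Icc 0 F.ustar) (F.f₂ F.ustar)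

/-- The function `η`, pairing each density with the density of equal flux on the other branch,
and with `ustar` if there is none. -/
def eta (u : ℝ) : ℝ :=
  if u ≤ F.ucrit then Function.invFunOn F.f₂ (Icc F.ustar F.umax) (F.f₁ u)
  else if u < F.ustar then F.ustar
  else Function.invFunOn F.f₁ (Icc 0 F.ustar) (F.f₂ u)

/-- The set of densities at the junction on an incoming road with initial density `u₀`. -/
def inSet (u₀ : ℝ) : Set ℝ :=
  if u₀ ≤ F.ucrit then {u₀} ∪ Ioc (F.eta u₀) F.umax
  else if u₀ < F.ustar then {u₀} ∪ Icc F.ustar F.umax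
  else Icc F.ustar F.umax

/-- The set of densities at the junction on an outgoing road with initial density `u₀`; `congested`
is the state of the traffic ahead, used only if `u₀ = ustar`. -/
def outSet (u₀ : ℝ) (congested : Bool) : Set ℝ :=
  if u₀ < F.ustar then Icc 0 F.ustar
  else if u₀ = F.ustar then
    (if congested = true then {F.ustar} ∪ Ico 0 F.ucrit else Icc 0 F.ustar)
  else {u₀} ∪ Ico 0 (F.eta u₀)

/-- The flux value of the initial density `u₀` on an outgoing road; at `u₀ = ustar` it is decided
by the state of the traffic ahead. -/
def aheadFlux (u₀ : ℝ) (congested : Bool) : ℝ :=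
  if u₀ < F.ustar then F.f₁ u₀
  else if u₀ = F.ustar then (if congested = true then F.f₂ F.ustar else F.f₁ F.ustar)
  else F.f₂ u₀

end JumpFlux

/-- The order in which the points (density, flux) are met along the graph of the multivalued flux
from left to right; the vertical part over `ustar` is run through downwards. -/
def Precedes (p q : ℝ × ℝ) : Prop := p.1 < q.1 ∨ (p.1 = q.1 ∧ q.2 ≤ p.2)

/-- The sign of `p - q` for the order `Precedes`. -/
def orderSign (p q : ℝ × ℝ) : ℝ :=
  if p.1 < q.1 then -1 else if q.1 < p.1 then 1 else Real.sign (q.2 - p.2)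

namespace JumpFlux

variable (F : JumpFlux)

/-- The wave `(pL, pR)` of the convex hull construction: `p` is a state taken at the speed
`ξ = x / t` by the Riemann solution with left state `pL` and right state `pR`.  If `pL` precedes
`pR`, then `p` is a point of the arc of the graph between them at which the line of slope `ξ`
supports the lower convex hull of the arc; if `pR` precedes `pL`, it supports the upper concave
hull. -/
def IsHullState (pL pR : ℝ × ℝ) (ξ : ℝ) (p : ℝ × ℝ) : Prop :=
  p ∈ F.graph ∧
  (Precedes pL pR → Precedes pL p ∧ Precedes p pR ∧
    ∀ k ∈ F.graph, Precedes pL k → Precedes k pR → p.2 - ξ * p.1 ≤ k.2 - ξ * k.1) ∧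
  (Precedes pR pL → Precedes pR p ∧ Precedes p pL ∧
    ∀ k ∈ F.graph, Precedes pR k → Precedes k pL → k.2 - ξ * k.1 ≤ p.2 - ξ * p.1)

end JumpFlux

/-! ### Solutions on the roads and at the junction -/

/-- Test functions: continuously differentiable with compact support in the `(x, t)`-plane. -/
def IsTest (φ : ℝ → ℝ → ℝ) : Prop :=
  ContDiff ℝ 1 (fun p : ℝ × ℝ => φ p.1 p.2) ∧ HasCompactSupport (fun p : ℝ × ℝ => φ p.1 p.2)

/-- `∂φ/∂x`. -/
def dx (φ : ℝ → ℝ → ℝ) (x t : ℝ) : ℝ := deriv (fun y => φ y t) x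

/-- `∂φ/∂t`. -/
def dt (φ : ℝ → ℝ → ℝ) (x t : ℝ) : ℝ := deriv (fun s => φ x s) t

/-- A density `u` and a flux `v` on the road `R` (the half-line `x < 0` or `x > 0`, at times
`t > 0`), with `v` in the multivalued flux of `u`, `u` of bounded variation in space, both constant
along rays from the origin, and satisfying the entropy inequalities for every constant state on the
graph of the multivalued flux. -/
structure IsRoadState (F : JumpFlux) (R : Set ℝ) (u v : ℝ → ℝ → ℝ) : Prop where
  meas_u : AEStronglyMeasurable (fun p : ℝ × ℝ => u p.1 p.2) (volume.restrict (R ×ˢ Ioi 0))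
  meas_v : AEStronglyMeasurable (fun p : ℝ × ℝ => v p.1 p.2) (volume.restrict (R ×ˢ Ioi 0))
  mem_graph : ∀ᵐ p : ℝ × ℝ ∂(volume.restrict (R ×ˢ Ioi 0)), (u p.1 p.2, v p.1 p.2) ∈ F.graph
  bv : ∀ t, 0 < t → BoundedVariationOn (fun x => u x t) R
  centered : ∀ c, 0 < c → ∀ x ∈ R, ∀ t, 0 < t →
    u (c * x) (c * t) = u x t ∧ v (c * x) (c * t) = v x t
  entropy : ∀ k ∈ F.graph, ∀ φ : ℝ → ℝ → ℝ, IsTest φ → (∀ x t, 0 ≤ φ x t) →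
    tsupport (fun p : ℝ × ℝ => φ p.1 p.2) ⊆ R ×ˢ Ioi 0 →
    0 ≤ ∫ p in R ×ˢ Ioi (0 : ℝ),
      (|u p.1 p.2 - k.1| * dt φ p.1 p.2 +
        orderSign (u p.1 p.2, v p.1 p.2) k * (v p.1 p.2 - k.2) * dx φ p.1 p.2)

/-- Densities and fluxes, as functions of `(x, t)`, on `n` incoming roads `x < 0` and `m` outgoing
roads `x > 0`; the junction is at `x = 0`. -/
structure JunctionState (n m : ℕ) where
  uin : Fin n → ℝ → ℝ → ℝ
  vin : Fin n → ℝ → ℝ → ℝ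
  uout : Fin m → ℝ → ℝ → ℝ
  vout : Fin m → ℝ → ℝ → ℝ

/-- The weak formulation at the junction, with constant initial densities. -/
def IsWeakAtJunction {n m : ℕ} (uin₀ : Fin n → ℝ) (uout₀ : Fin m → ℝ)
    (s : JunctionState n m) : Prop :=
  ∀ (φ : Fin n → ℝ → ℝ → ℝ) (ψ : Fin m → ℝ → ℝ → ℝ),
    (∀ i, IsTest (φ i)) → (∀ j, IsTest (ψ j)) →
    (∀ i j t, 0 ≤ t → φ i 0 t = ψ j 0 t ∧ dx (φ i) 0 t = dx (ψ j) 0 t) →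
    (∑ i, ((∫ p in Iio (0 : ℝ) ×ˢ Ioi (0 : ℝ),
          (s.uin i p.1 p.2 * dt (φ i) p.1 p.2 + s.vin i p.1 p.2 * dx (φ i) p.1 p.2))
        + ∫ x in Iio (0 : ℝ), uin₀ i * φ i x 0))
    + (∑ j, ((∫ p in Ioi (0 : ℝ) ×ˢ Ioi (0 : ℝ),
          (s.uout j p.1 p.2 * dt (ψ j) p.1 p.2 + s.vout j p.1 p.2 * dx (ψ j) p.1 p.2))
        + ∫ x in Ioi (0 : ℝ), uout₀ j * ψ j x 0)) = 0

/-- The traces of the fluxes at the junction (independent of time, the state being constant along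
rays). -/
def HasFluxTraces {n m : ℕ} (s : JunctionState n m) (γin : Fin n → ℝ) (γout : Fin m → ℝ) : Prop :=
  (∀ i t, 0 < t → Tendsto (fun x => s.vin i x t) (𝓝[<] 0) (𝓝 (γin i))) ∧
  (∀ j t, 0 < t → Tendsto (fun x => s.vout j x t) (𝓝[>] 0) (𝓝 (γout j)))

/-- Weak solutions of the Riemann problem at the junction which distribute the incoming fluxes
according to the matrix `β`. -/
structure IsDistributedSolution (F : JumpFlux) {n m : ℕ} (β : Matrix (Fin n) (Fin m) ℝ)
    (uin₀ : Fin n → ℝ) (uout₀ : Fin m → ℝ) (congested : Fin m → Bool)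
    (s : JunctionState n m) : Prop where
  road_in : ∀ i, IsRoadState F (Iio 0) (s.uin i) (s.vin i)
  road_out : ∀ j, IsRoadState F (Ioi 0) (s.uout j) (s.vout j)
  weak : IsWeakAtJunction uin₀ uout₀ s
  /-- On a road with initial density `ustar` the traffic ahead prescribes the flux at its end. -/
  ahead : ∀ j, uout₀ j = F.ustar → ∀ t, 0 < t →
    Tendsto (fun x => s.vout j x t) atTop (𝓝 (F.aheadFlux (uout₀ j) (congested j)))
  distribution : ∃ γin γout, HasFluxTraces s γin γout ∧ ∀ j, γout j = ∑ i, β i j * γin i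

/-- Admissible weak solutions: the total incoming flux is maximal. -/
def IsAdmissible (F : JumpFlux) {n m : ℕ} (β : Matrix (Fin n) (Fin m) ℝ)
    (uin₀ : Fin n → ℝ) (uout₀ : Fin m → ℝ) (congested : Fin m → Bool)
    (s : JunctionState n m) : Prop :=
  IsDistributedSolution F β uin₀ uout₀ congested s ∧
  ∀ s', IsDistributedSolution F β uin₀ uout₀ congested s' →
    ∀ γin γout γin' γout', HasFluxTraces s γin γout → HasFluxTraces s' γin' γout' →
      ∑ i, γin' i ≤ ∑ i, γin i

/-! ### The distribution matrix -/

/-- The vectors `e₁, …, eₙ` and `a₁, …, aₘ` of `ℝⁿ`, where `a_j = (β 1 j, …, β n j)`. -/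
def normalVec {n m : ℕ} (β : Matrix (Fin n) (Fin m) ℝ) :
    Fin n ⊕ Fin m → EuclideanSpace ℝ (Fin n)
  | Sum.inl i => EuclideanSpace.single i 1
  | Sum.inr j => WithLp.toLp 2 (fun i => β i j)

/-- A distribution matrix: entries in `[0, 1]`, rows summing to one, and, for every choice of at
least one and at most `n - 1` of the hyperplanes orthogonal to the vectors `normalVec`, the vector
`(1, …, 1)` is not orthogonal to their intersection. -/
structure IsDistributionMatrix {n m : ℕ} (β : Matrix (Fin n) (Fin m) ℝ) : Prop where
  mem_Icc : ∀ i j, β i j ∈ Icc (0 : ℝ) 1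
  sum_eq_one : ∀ i, ∑ j, β i j = 1
  generic : ∀ I : Finset (Fin n ⊕ Fin m), I.Nonempty → I.card < n →
    (WithLp.toLp 2 (fun _ => 1) : EuclideanSpace ℝ (Fin n)) ∉
      (⨅ k ∈ I, (Submodule.span ℝ {normalVec β k})ᗮ)ᗮ

end

/-! The jump disappears once the graph of the multivalued flux is run through as a curve.
`JumpFlux.curve` parametrizes it continuously: the density is nondecreasing, the flux increases up
to the peak at `(u*, f(u*-))` and then decreases, first along the vertical part and then along `f₂`.
The order on the graph becomes the order of the parameter. A solution that is constant along rays
becomes a parameter function `σ` of the speed `ξ = x / t`, and integrating test functions along rays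
(`IsTest.integral_cone`) reduces entropy inequalities and weak formulation to statements in one
variable.

In one variable, the two extreme states of the curve give the conservation law, so `v - ξ u` agrees
almost everywhere with a Lipschitz profile `A` with `A' = -u`
(`FluxCurve.IsEntropic.exists_profile`). For every state `τ` the entropy inequality compares `A`
with the affine function `v τ - ξ u τ`. Suitable test functions built from `A` itself show: if `σ`
is below `τ` far away and above `τ` near the junction, then `A` lies below that affine function
(`IsEntropyTriple.nonpos`), with a mirror image; if `σ` is above `τ` at both ends, it never falls
below `τ` (`IsEntropyTriple.eq_one`). Hence `A` is the minimum or maximum of the affine functions of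
the states of the arc joining the two ends. This is the hull construction
(`FluxCurve.IsEntropic.isHull`). It also gives uniqueness: `A` determines `u` by differentiation,
and then `v`. At speed zero `A` is the flux trace, which is therefore extremal on the arc; this is
the condition `FluxCurve.InCond`. Conversely, selecting minimizers or maximizers builds a wave to
every such trace (`FluxCurve.InCond.exists_wave`). Outgoing roads follow by reflecting space and the
curve.

At the junction, test functions concentrated on one road identify the far density with the initial
one. The traces allowed by `InCond` realize each flux in an interval `[0, cap]` exactly once. Since
the rows of `β` sum to one, any incoming fluxes respecting the capacities satisfy the weak
formulation, so the attainable flux vectors form exactly the polytope `feasible`. Maximizing the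
total flux is a linear program on it: a maximizer exists by compactness and is unique by the
genericity of `β` (`IsDistributionMatrix.max_feasible_unique`). Unique fluxes give unique junction
states, and these give unique waves. -/

noncomputable section

/-! ### Test functions on a half-line and absolutely continuous calculus -/

/-- Boundedness on compact intervals. -/
def LocBdd (H : ℝ → ℝ) : Prop := ∀ a b, ∃ C, ∀ x ∈ Icc a b, |H x| ≤ C

/-- Nonnegative `C¹` functions with compact support in `R`. -/
structure IsSmoothBump (R : Set ℝ) (Φ : ℝ → ℝ) : Prop where
  contDiff : ContDiff ℝ 1 Φ
  compact : HasCompactSupport Φ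
  subset : tsupport Φ ⊆ R
  nonneg : ∀ x, 0 ≤ Φ x

/-- Nonnegative Lipschitz functions with compact support in the negative half-line. -/
structure IsLipBump (Φ : ℝ → ℝ) : Prop where
  lip : ∃ K, LipschitzWith K Φ
  nonneg : ∀ x, 0 ≤ Φ x
  supp : ∃ a b, a ≤ b ∧ b < 0 ∧ ∀ x, x ∉ Icc a b → Φ x = 0

theorem deriv_eq_zero_off {Φ : ℝ → ℝ} {a b : ℝ} (h : ∀ x, x ∉ Icc a b → Φ x = 0) :
    ∀ x, x ∉ Icc a b → deriv Φ x = 0 := by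
  intro x hx
  have : Φ =ᶠ[𝓝 x] fun _ => 0 := by
    filter_upwards [isClosed_Icc.isOpen_compl.mem_nhds hx] with y hy using h y hy
  rw [this.deriv_eq]; simp

theorem integrable_of_bdd_off {f : ℝ → ℝ} {a b C : ℝ} (hf : AEStronglyMeasurable f volume)
    (h0 : ∀ x, x ∉ Icc a b → f x = 0) (hC : ∀ x ∈ Icc a b, |f x| ≤ C) : Integrable f := by
  rw [← integrableOn_iff_integrable_of_support_subset (s := Icc a b)]
  · refine Measure.integrableOn_of_bounded (M := C) (by simp) hf ?_
    filter_upwards [ae_restrict_mem measurableSet_Icc] with x hx using hC x hx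
  · intro x hx
    by_contra h
    exact hx (h0 x h)

theorem IsLipBump.continuous {Φ : ℝ → ℝ} (h : IsLipBump Φ) : Continuous Φ := by
  obtain ⟨K, hK⟩ := h.lip; exact hK.continuous

theorem IsLipBump.bdd {Φ : ℝ → ℝ} (h : IsLipBump Φ) : ∃ B, ∀ x, |Φ x| ≤ B := by
  obtain ⟨a, b, hab, hb, h0⟩ := h.supp
  obtain ⟨B, hB⟩ := isCompact_Icc.exists_bound_of_continuousOn (s := Icc a b)
    h.continuous.continuousOn
  refine ⟨max B 0, fun x => ?_⟩
  by_cases hx : x ∈ Icc a b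
  · exact (hB x hx).trans (le_max_left _ _)
  · simp [h0 x hx]

theorem IsLipBump.integrable_deriv {Φ M : ℝ → ℝ} (h : IsLipBump Φ)
    (hM : AEStronglyMeasurable M volume) (hb : LocBdd M) :
    Integrable fun x => M x * deriv Φ x := by
  obtain ⟨a, b, hab, hb', h0⟩ := h.supp
  obtain ⟨K, hK⟩ := h.lip
  obtain ⟨C, hC⟩ := hb a b
  refine integrable_of_bdd_off (a := a) (b := b) (C := C * K)
    (hM.mul (measurable_deriv Φ).aestronglyMeasurable) ?_ ?_
  · intro x hx; simp [deriv_eq_zero_off h0 x hx]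
  · intro x hx
    rw [abs_mul]
    have := norm_deriv_le_of_lipschitz (x₀ := x) hK
    rw [Real.norm_eq_abs] at this
    have h1 := hC x hx
    gcongr
    exact (abs_nonneg _).trans h1

theorem IsLipBump.integrable_mul {Φ N : ℝ → ℝ} (h : IsLipBump Φ)
    (hN : AEStronglyMeasurable N volume) (hb : LocBdd N) :
    Integrable fun x => N x * Φ x := by
  obtain ⟨a, b, hab, hb', h0⟩ := h.supp
  obtain ⟨B, hB⟩ := h.bdd
  obtain ⟨C, hC⟩ := hb a b
  refine integrable_of_bdd_off (a := a) (b := b) (C := C * B)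
    (hN.mul h.continuous.aestronglyMeasurable) ?_ ?_
  · intro x hx; simp [h0 x hx]
  · intro x hx
    rw [abs_mul]
    have h1 := hC x hx
    have h2 := hB x
    gcongr
    exact (abs_nonneg _).trans h1

/-- Steklov averages: an inequality tested with smooth bumps holds for Lipschitz bumps. -/
theorem lip_of_smooth {M N : ℝ → ℝ} (hM : AEStronglyMeasurable M volume)
    (hN : AEStronglyMeasurable N volume) (bM : LocBdd M) (bN : LocBdd N)
    (h : ∀ Φ, IsSmoothBump (Iio 0) Φ → 0 ≤ ∫ x, (M x * deriv Φ x - N x * Φ x))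
    {Φ : ℝ → ℝ} (hΦ : IsLipBump Φ) : 0 ≤ ∫ x, (M x * deriv Φ x - N x * Φ x) := by
  obtain ⟨a, b, hab, hb, h0⟩ := hΦ.supp
  obtain ⟨K, hK⟩ := hΦ.lip
  obtain ⟨B, hB⟩ := hΦ.bdd
  obtain ⟨CM, hCM⟩ := bM (a - 1) b
  obtain ⟨CN, hCN⟩ := bN (a - 1) b
  have hcont := hΦ.continuous
  have hint : ∀ x y, IntervalIntegrable Φ volume x y := fun x y => hcont.intervalIntegrable x y
  set P : ℝ → ℝ := fun x => ∫ y in (0:ℝ)..x, Φ y with hP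
  have hPd : ∀ x, HasDerivAt P (Φ x) x := fun x =>
    intervalIntegral.integral_hasDerivAt_right (hint 0 x)
      (hcont.stronglyMeasurableAtFilter _ _) hcont.continuousAt
  set ε : ℕ → ℝ := fun n => 1 / ((n:ℝ) + 1) with hε
  have hεpos : ∀ n, 0 < ε n := fun n => by positivity
  have hε1 : ∀ n, ε n ≤ 1 := fun n => by
    rw [hε]; simp only
    rw [div_le_one (by positivity)]; linarith [(Nat.cast_nonneg n : (0:ℝ) ≤ n)]
  have hεt : Tendsto ε atTop (𝓝[≠] 0) := by
    rw [tendsto_nhdsWithin_iff]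
    exact ⟨tendsto_one_div_add_atTop_nhds_zero_nat, Eventually.of_forall fun n => (hεpos n).ne'⟩
  -- Forward averages over `[x, x + ε n]` extend the support only to the left, so it stays in the
  -- negative half-line; since `ε n ≤ 1`, the interval `[a - 1, b]` serves for all `n`.
  set Ψ : ℕ → ℝ → ℝ := fun n x => (ε n)⁻¹ * (P (x + ε n) - P x) with hΨ
  have hΨd : ∀ n x, HasDerivAt (Ψ n) ((ε n)⁻¹ * (Φ (x + ε n) - Φ x)) x := by
    intro n x
    exact (((hPd (x + ε n)).comp_add_const x (ε n)).sub (hPd x)).const_mul _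
  have hΨint : ∀ n x, Ψ n x = (ε n)⁻¹ * ∫ y in x..(x + ε n), Φ y := by
    intro n x
    simp only [hΨ, hP]
    rw [intervalIntegral.integral_interval_sub_left (hint _ _) (hint _ _)]
  have hΨ0 : ∀ n x, x ∉ Icc (a - 1) b → Ψ n x = 0 := by
    intro n x hx
    rw [hΨint, intervalIntegral.integral_zero_ae]
    · simp
    · refine Eventually.of_forall fun y hy => h0 y ?_
      rw [uIoc_of_le (by linarith [hεpos n])] at hy
      intro hy'
      apply hx
      exact ⟨by linarith [hy.2, hy'.1, hε1 n], by linarith [hy.1, hy'.2]⟩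
  have hΨb : ∀ n, IsSmoothBump (Iio 0) (Ψ n) := by
    intro n
    refine ⟨?_, ?_, ?_, ?_⟩
    · rw [contDiff_one_iff_deriv]
      refine ⟨fun x => (hΨd n x).differentiableAt, ?_⟩
      have : deriv (Ψ n) = fun x => (ε n)⁻¹ * (Φ (x + ε n) - Φ x) :=
        funext fun x => (hΨd n x).deriv
      rw [this]; fun_prop
    · exact HasCompactSupport.intro isCompact_Icc (hΨ0 n)
    · have : tsupport (Ψ n) ⊆ Icc (a - 1) b := by
        refine closure_minimal ?_ isClosed_Icc
        intro x hx; by_contra hx'; exact hx (hΨ0 n x hx')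
      exact this.trans fun x hx => lt_of_le_of_lt hx.2 hb
    · intro x
      rw [hΨint]
      refine mul_nonneg (inv_nonneg.2 (hεpos n).le) ?_
      exact intervalIntegral.integral_nonneg (by linarith [hεpos n]) fun y _ => hΦ.nonneg y
  have hΨB : ∀ n x, |Ψ n x| ≤ B := by
    intro n x
    rw [hΨint, abs_mul, abs_of_pos (inv_pos.2 (hεpos n))]
    have := intervalIntegral.norm_integral_le_of_norm_le_const (f := Φ) (a := x) (b := x + ε n)
      (C := B) (fun y _ => hB y)
    rw [Real.norm_eq_abs, add_sub_cancel_left, abs_of_pos (hεpos n)] at this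
    rw [inv_mul_le_iff₀ (hεpos n)]; linarith
  have hΨK : ∀ n x, |deriv (Ψ n) x| ≤ K := by
    intro n x
    rw [(hΨd n x).deriv, abs_mul, abs_of_pos (inv_pos.2 (hεpos n)), inv_mul_le_iff₀ (hεpos n)]
    have := hK.dist_le_mul (x + ε n) x
    rw [Real.dist_eq, Real.dist_eq, add_sub_cancel_left, abs_of_pos (hεpos n)] at this
    linarith
  have hlim : Tendsto (fun n => ∫ x, (M x * deriv (Ψ n) x - N x * Ψ n x)) atTop
      (𝓝 (∫ x, (M x * deriv Φ x - N x * Φ x))) := by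
    refine tendsto_integral_of_dominated_convergence
      (fun x => (Icc (a - 1) b).indicator (fun _ => |CM| * K + |CN| * B) x) ?_ ?_ ?_ ?_
    · intro n
      exact (hM.mul (measurable_deriv _).aestronglyMeasurable).sub
        (hN.mul (hΨb n).contDiff.continuous.aestronglyMeasurable)
    · rw [integrable_indicator_iff measurableSet_Icc]
      exact integrableOn_const (by simp)
    · intro n
      refine Eventually.of_forall fun x => ?_
      by_cases hx : x ∈ Icc (a - 1) b
      · rw [indicator_of_mem hx]
        refine (norm_sub_le _ _).trans ?_
        rw [norm_mul, norm_mul]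
        simp only [Real.norm_eq_abs]
        have h1 := (hCM x hx).trans (le_abs_self CM)
        have h2 := (hCN x hx).trans (le_abs_self CN)
        have h3 := hΨK n x
        have h4 := hΨB n x
        gcongr
      · rw [indicator_of_notMem hx, hΨ0 n x hx, deriv_eq_zero_off (hΨ0 n) x hx]; simp
    -- The derivative of the average is a difference quotient of `Φ`, which converges almost
    -- everywhere by Rademacher's theorem.
    · filter_upwards [hK.ae_differentiableAt_real] with x hx
      refine Tendsto.sub (Tendsto.const_mul _ ?_) (Tendsto.const_mul _ ?_)
      · have := (hx.hasDerivAt.tendsto_slope_zero).comp hεt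
        refine this.congr fun n => ?_
        rw [(hΨd n x).deriv]; rfl
      · exact ((hPd x).tendsto_slope_zero).comp hεt
  exact ge_of_tendsto' hlim fun n => h _ (hΨb n)

theorem LipschitzWith.acOn {f : ℝ → ℝ} {K} (h : LipschitzWith K f) (a b : ℝ) :
    AbsolutelyContinuousOnInterval f a b :=
  (h.lipschitzOnWith (s := uIcc a b)).absolutelyContinuousOnInterval

/-- The derivative of a compactly supported Lipschitz function has integral zero. -/
theorem integral_deriv_eq_zero {f : ℝ → ℝ} {a b : ℝ}
    (hf : AbsolutelyContinuousOnInterval f (a - 1) (b + 1))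
    (h0 : ∀ x, x ∉ Icc a b → f x = 0) : ∫ x, deriv f x = 0 := by
  rw [← intervalIntegral.integral_eq_integral_of_support_subset (a := a - 1) (b := b + 1),
    hf.integral_deriv_eq_sub, h0 (b + 1), h0 (a - 1)]
  · simp
  · intro h; linarith [h.1]
  · intro h; linarith [h.2]
  · intro x hx
    have : x ∈ Icc a b := by
      by_contra h; exact hx (deriv_eq_zero_off h0 x h)
    exact ⟨by linarith [this.1], by linarith [this.2]⟩

theorem lipschitz_primitive {w : ℝ → ℝ} {C : ℝ} (hw : AEStronglyMeasurable w volume)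
    (hC : ∀ x, |w x| ≤ C) (c : ℝ) :
    LipschitzWith (Real.toNNReal C) (fun x => ∫ y in c..x, w y) := by
  have hC0 : 0 ≤ C := (abs_nonneg _).trans (hC 0)
  have hint : ∀ x y, IntervalIntegrable w volume x y := fun x y => by
    rw [intervalIntegrable_iff]
    exact Measure.integrableOn_of_bounded (M := C) (by simp) hw
      (Eventually.of_forall fun x => hC x)
  refine LipschitzWith.of_dist_le_mul fun x y => ?_
  rw [Real.dist_eq, intervalIntegral.integral_interval_sub_left (hint _ _) (hint _ _),
    Real.coe_toNNReal _ hC0, Real.dist_eq]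
  exact intervalIntegral.norm_integral_le_of_norm_le_const (f := w) (C := C) fun z _ => hC z

theorem ae_hasDerivAt_primitive {w : ℝ → ℝ} {C : ℝ} (hw : AEStronglyMeasurable w volume)
    (hC : ∀ x, |w x| ≤ C) (c : ℝ) :
    ∀ᵐ x, HasDerivAt (fun x => ∫ y in c..x, w y) (w x) x := by
  have hl : LocallyIntegrable w volume := by
    refine (locallyIntegrable_iff).2 fun k hk => ?_
    exact Measure.integrableOn_of_bounded (M := C) hk.measure_lt_top.ne hw
      (Eventually.of_forall fun x => hC x)
  filter_upwards [LocallyIntegrable.ae_hasDerivAt_integral hl] with x hx using hx c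

/-- The product of two Lipschitz functions, one of them compactly supported, is Lipschitz. -/
theorem lipschitz_mul_of_supp {f g : ℝ → ℝ} {K K' : NNReal} {a b : ℝ}
    (hf : LipschitzWith K f) (hg : LipschitzWith K' g) (h0 : ∀ x, x ∉ Icc a b → f x = 0) :
    ∃ K'', LipschitzWith K'' (fun x => f x * g x) := by
  obtain ⟨B, hB⟩ := isCompact_Icc.exists_bound_of_continuousOn (s := Icc a b)
    hg.continuous.continuousOn
  obtain ⟨D, hD⟩ := isCompact_Icc.exists_bound_of_continuousOn (s := Icc a b)
    hf.continuous.continuousOn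
  have hD' : ∀ x, |f x| ≤ |D| := fun x => by
    by_cases hx : x ∈ Icc a b
    · exact (hD x hx).trans (le_abs_self _)
    · simp [h0 x hx]
  have key : ∀ x y, x ∈ Icc a b → |f x * g x - f y * g y| ≤ (|D| * K' + |B| * K) * |x - y| := by
    intro x y hx
    have e : f x * g x - f y * g y = f y * (g x - g y) + g x * (f x - f y) := by ring
    have h1 := hg.dist_le_mul x y
    have h2 := hf.dist_le_mul x y
    rw [Real.dist_eq, Real.dist_eq] at h1 h2
    have h3 : |g x| ≤ |B| := (hB x hx).trans (le_abs_self _)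
    have h4 := hD' y
    rw [e]
    refine (abs_add_le _ _).trans ?_
    rw [abs_mul, abs_mul, add_mul, mul_assoc, mul_assoc]
    gcongr
  refine ⟨Real.toNNReal (|D| * K' + |B| * K), LipschitzWith.of_dist_le_mul fun x y => ?_⟩
  rw [Real.coe_toNNReal _ (by positivity), Real.dist_eq, Real.dist_eq]
  by_cases hx : x ∈ Icc a b
  · exact key x y hx
  · by_cases hy : y ∈ Icc a b
    · rw [abs_sub_comm, abs_sub_comm x]; exact key y x hy
    · simp only [h0 x hx, h0 y hy]; simp; positivity

theorem LocBdd.of_continuous {f : ℝ → ℝ} (h : Continuous f) : LocBdd f := fun a b => by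
  obtain ⟨B, hB⟩ := isCompact_Icc.exists_bound_of_continuousOn (s := Icc a b) h.continuousOn
  exact ⟨B, hB⟩

theorem LocBdd.of_bdd {f : ℝ → ℝ} {C : ℝ} (h : ∀ x, |f x| ≤ C) : LocBdd f :=
  fun _ _ => ⟨C, fun x _ => h x⟩

theorem LocBdd.mul {f g : ℝ → ℝ} (hf : LocBdd f) (hg : LocBdd g) :
    LocBdd (fun x => f x * g x) := fun a b => by
  obtain ⟨C, hC⟩ := hf a b
  obtain ⟨D, hD⟩ := hg a b
  refine ⟨C * D, fun x hx => ?_⟩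
  rw [abs_mul]
  exact mul_le_mul (hC x hx) (hD x hx) (abs_nonneg _) ((abs_nonneg _).trans (hC x hx))

theorem LocBdd.sub {f g : ℝ → ℝ} (hf : LocBdd f) (hg : LocBdd g) :
    LocBdd (fun x => f x - g x) := fun a b => by
  obtain ⟨C, hC⟩ := hf a b
  obtain ⟨D, hD⟩ := hg a b
  exact ⟨C + D, fun x hx => (abs_sub _ _).trans (add_le_add (hC x hx) (hD x hx))⟩

end

noncomputable section

/-! ### Trapezoidal cut-off functions -/

/-- The trapezoid of height `δ` with slopes `±1` supported in `[p, t]`. -/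
def trap (p t δ x : ℝ) : ℝ := max (min (min (x - p) (t - x)) δ) 0

theorem trap_lipschitz (p t δ : ℝ) : LipschitzWith 1 (trap p t δ) := by
  have h1 : LipschitzWith 1 fun x : ℝ => x - p := by
    simpa using LipschitzWith.id.sub (LipschitzWith.const p)
  have h2 : LipschitzWith 1 fun x : ℝ => t - x := by
    simpa using (LipschitzWith.const t).sub LipschitzWith.id
  have : LipschitzWith (max 1 1) (trap p t δ) := (((h1.min h2).min_const δ).max_const 0)
  simpa only [max_self] using this

theorem trap_nonneg (p t δ x : ℝ) : 0 ≤ trap p t δ x := le_max_right _ _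

theorem trap_off {p t δ x : ℝ} (hx : x ∉ Icc p t) : trap p t δ x = 0 := by
  unfold trap
  apply max_eq_right
  refine (min_le_left _ _).trans ?_
  by_contra! h
  rw [lt_min_iff] at h
  exact hx ⟨by linarith [h.1], by linarith [h.2]⟩

theorem trap_pos {p t δ x : ℝ} (hδ : 0 < δ) (hx : x ∈ Ioo p t) : 0 < trap p t δ x := by
  unfold trap
  exact lt_max_of_lt_left (lt_min (lt_min (by linarith [hx.1]) (by linarith [hx.2])) hδ)

theorem trap_plateau {p t δ x : ℝ} (hδ : 0 ≤ δ) (hx : x ∈ Icc (p + δ) (t - δ)) :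
    trap p t δ x = δ := by
  unfold trap
  rw [min_eq_right (le_min (by linarith [hx.1]) (by linarith [hx.2])), max_eq_left hδ]

theorem trap_deriv_plateau {p t δ x : ℝ} (hδ : 0 ≤ δ) (hx : x ∈ Ioo (p + δ) (t - δ)) :
    HasDerivAt (trap p t δ) 0 x := by
  refine (hasDerivAt_const x δ).congr_of_eventuallyEq ?_
  filter_upwards [Ioo_mem_nhds hx.1 hx.2] with y hy
  exact trap_plateau hδ ⟨hy.1.le, hy.2.le⟩

theorem trap_deriv_up {p t δ x : ℝ} (hδ : p + δ < t - δ) (hx : x ∈ Ioo p (p + δ)) :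
    HasDerivAt (trap p t δ) 1 x := by
  refine ((hasDerivAt_id x).sub_const p).congr_of_eventuallyEq ?_
  filter_upwards [Ioo_mem_nhds hx.1 hx.2] with y hy
  simp only [trap, id]
  rw [min_eq_left (a := y - p) (by linarith [hy.1, hy.2]), min_eq_left (by linarith [hy.2]),
    max_eq_left (by linarith [hy.1])]

theorem trap_deriv_down {p t δ x : ℝ} (hδ : p + δ < t - δ) (hx : x ∈ Ioo (t - δ) t) :
    HasDerivAt (trap p t δ) (-1) x := by
  refine ((hasDerivAt_id x).const_sub t).congr_of_eventuallyEq ?_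
  filter_upwards [Ioo_mem_nhds hx.1 hx.2] with y hy
  simp only [trap, id]
  rw [min_eq_right (a := y - p) (by linarith [hy.1, hy.2]), min_eq_left (by linarith [hy.1]),
    max_eq_left (by linarith [hy.2])]

/-! ### Scalar entropy inequalities -/

/-- A conservation law tested with Lipschitz bumps: the flux is a.e. a Lipschitz primitive. -/
theorem exists_lipschitz_primitive {H U : ℝ → ℝ} {C : ℝ} (hH : Measurable H) (hU : Measurable U)
    (bH : LocBdd H) (bU : ∀ x, |U x| ≤ C)
    (h : ∀ Φ, IsLipBump Φ → ∫ x, (H x * deriv Φ x - U x * Φ x) = 0) :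
    ∃ A : ℝ → ℝ, (∃ K, LipschitzWith K A) ∧ (∀ᵐ x, HasDerivAt A (-U x) x) ∧
      ∀ᵐ x, x < 0 → H x = A x := by
  set P : ℝ → ℝ := fun x => ∫ y in (0:ℝ)..x, U y with hP
  have hPL := lipschitz_primitive hU.aestronglyMeasurable bU 0
  have hPd := ae_hasDerivAt_primitive hU.aestronglyMeasurable bU 0
  set D : ℝ → ℝ := fun x => H x + P x with hD
  have hDm : Measurable D := hH.add hPL.continuous.measurable
  have bD : LocBdd D := by
    have := bH.sub (LocBdd.of_continuous hPL.continuous.neg)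
    simpa [hD, sub_neg_eq_add] using this
  -- the primitive absorbs the zeroth order term
  have h1 : ∀ Φ, IsLipBump Φ → ∫ x, D x * deriv Φ x = 0 := by
    intro Φ hΦ
    obtain ⟨a, b, hab, hb, h0⟩ := hΦ.supp
    obtain ⟨K, hK⟩ := hΦ.lip
    have hz : ∫ x, deriv (fun x => Φ x * P x) x = 0 :=
      integral_deriv_eq_zero (a := a) (b := b) ((hK.acOn _ _).fun_mul (hPL.acOn _ _))
        (fun x hx => by simp [h0 x hx])
    have e : (fun x => deriv (fun x => Φ x * P x) x) =ᵐ[volume]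
        fun x => P x * deriv Φ x + U x * Φ x := by
      filter_upwards [hPd, hK.ae_differentiableAt_real] with x hx hx'
      rw [(hx'.hasDerivAt.fun_mul hx).deriv]; ring
    rw [integral_congr_ae e] at hz
    have hz2 := h Φ hΦ
    have i1 := hΦ.integrable_deriv hH.aestronglyMeasurable bH
    have i2 := hΦ.integrable_mul hU.aestronglyMeasurable (LocBdd.of_bdd bU)
    have i3 := hΦ.integrable_deriv hPL.continuous.aestronglyMeasurable
      (LocBdd.of_continuous hPL.continuous)
    rw [integral_add i3 i2] at hz
    rw [integral_sub i1 i2] at hz2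
    simp only [hD, add_mul]
    rw [integral_add i1 i3]; linarith
  -- `D` is constant on each compact interval
  have h2 : ∀ c d, c < d → d < 0 → ∃ k, ∀ᵐ x, x ∈ Ioc c d → D x = k := by
    intro c d hcd hd
    obtain ⟨B, hB⟩ := bD c d
    have hDi : IntervalIntegrable D volume c d := by
      rw [intervalIntegrable_iff, uIoc_of_le hcd.le]
      refine Measure.integrableOn_of_bounded (M := B) (by simp) hDm.aestronglyMeasurable ?_
      filter_upwards [ae_restrict_mem measurableSet_Ioc] with x hx
      exact hB x ⟨hx.1.le, hx.2⟩
    -- The lemma of du Bois-Reymond: removing the mean makes the primitive `Q` of `w` vanish outside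
    -- `[c, d]`. Testing with derivative `w` then gives `∫ D w = 0`, hence `∫ w² = 0`.
    set k := (∫ x in c..d, D x) / (d - c) with hk
    set w : ℝ → ℝ := (Ioc c d).indicator fun x => D x - k with hw
    have hwm : Measurable w := (hDm.sub_const k).indicator measurableSet_Ioc
    have hwb : ∀ x, |w x| ≤ |B| + |k| := by
      intro x
      by_cases hx : x ∈ Ioc c d
      · rw [hw, indicator_of_mem hx]
        exact (abs_sub _ _).trans
          (add_le_add ((hB x ⟨hx.1.le, hx.2⟩).trans (le_abs_self _)) le_rfl)
      · rw [hw, indicator_of_notMem hx]; simp; positivity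
    set Q : ℝ → ℝ := fun x => ∫ y in c..x, w y with hQ
    have hQL := lipschitz_primitive hwm.aestronglyMeasurable hwb c
    have hQd := ae_hasDerivAt_primitive hwm.aestronglyMeasurable hwb c
    have hwint : ∀ x y, IntervalIntegrable w volume x y := fun x y => by
      rw [intervalIntegrable_iff]
      exact Measure.integrableOn_of_bounded (M := |B| + |k|) (by simp) hwm.aestronglyMeasurable
        (Eventually.of_forall fun x => hwb x)
    have hQcd : Q d = 0 := by
      have : ∫ y in c..d, w y = ∫ y in c..d, (D y - k) := by
        refine intervalIntegral.integral_congr_ae (Eventually.of_forall fun y hy => ?_)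
        rw [uIoc_of_le hcd.le] at hy
        rw [hw, indicator_of_mem hy]
      simp only [hQ]
      rw [this, intervalIntegral.integral_sub hDi (by simp), intervalIntegral.integral_const, hk,
        smul_eq_mul, mul_div_cancel₀ _ (by linarith : d - c ≠ 0)]
      ring
    have hQ0 : ∀ x, x ∉ Icc c d → Q x = 0 := by
      intro x hx
      simp only [mem_Icc, not_and_or, not_le] at hx
      rcases hx with hx | hx
      · simp only [hQ]
        refine intervalIntegral.integral_zero_ae (Eventually.of_forall fun y hy => ?_)
        rw [uIoc_of_ge hx.le] at hy
        rw [hw, indicator_of_notMem]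
        exact fun h => absurd h.1 (not_lt.2 hy.2)
      · have : Q x = Q d + ∫ y in d..x, w y := by
          simp only [hQ]
          rw [intervalIntegral.integral_add_adjacent_intervals (hwint _ _) (hwint _ _)]
        rw [this, hQcd, zero_add]
        refine intervalIntegral.integral_zero_ae (Eventually.of_forall fun y hy => ?_)
        rw [uIoc_of_le hx.le] at hy
        rw [hw, indicator_of_notMem]
        exact fun h => absurd h.2 (not_le.2 hy.1)
    obtain ⟨E, hE⟩ := isCompact_Icc.exists_bound_of_continuousOn (s := Icc c d)
      hQL.continuous.continuousOn
    have hEQ : ∀ x, |Q x| ≤ |E| := fun x => by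
      by_cases hx : x ∈ Icc c d
      · exact (hE x hx).trans (le_abs_self _)
      · simp [hQ0 x hx]
    -- `Q + cutoff` and the cutoff are nonnegative bumps
    set δ := -d / 4 with hδ
    have hδ0 : 0 < δ := by rw [hδ]; linarith
    set T : ℝ → ℝ := fun x => (|E| / δ) * trap (c - δ) (d + δ) δ x with hT
    have hTL : LipschitzWith (Real.toNNReal (|E| / δ)) T := by
      refine LipschitzWith.of_dist_le_mul fun x y => ?_
      have := (trap_lipschitz (c - δ) (d + δ) δ).dist_le_mul x y
      rw [Real.dist_eq, Real.dist_eq] at *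
      rw [Real.coe_toNNReal _ (by positivity)]
      simp only [hT]
      rw [← mul_sub, abs_mul, abs_of_nonneg (by positivity : 0 ≤ |E| / δ)]
      simp only [NNReal.coe_one, one_mul] at this
      gcongr
    have hTb : IsLipBump T := by
      refine ⟨⟨_, hTL⟩, fun x => mul_nonneg (by positivity) (trap_nonneg _ _ _ _), c - δ, d + δ,
        by linarith, by rw [hδ]; linarith, fun x hx => ?_⟩
      simp [hT, trap_off hx]
    have hSb : IsLipBump fun x => T x + Q x := by
      refine ⟨⟨_, hTL.add hQL⟩, fun x => ?_, c - δ, d + δ,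
        by linarith, by rw [hδ]; linarith, fun x hx => ?_⟩
      · by_cases hx : x ∈ Icc c d
        · have : T x = |E| := by
            simp only [hT]
            rw [trap_plateau hδ0.le ⟨by linarith [hx.1], by linarith [hx.2]⟩]
            field_simp
          rw [this]; linarith [neg_abs_le (Q x), hEQ x]
        · rw [hQ0 x hx, add_zero]; exact hTb.nonneg x
      · rw [hQ0, add_zero]
        · simp [hT, trap_off hx]
        · intro h; exact hx ⟨by linarith [h.1], by linarith [h.2]⟩
    have hzero : ∫ x, D x * w x = 0 := by
      have e1 := h1 _ hTb
      have e2 := h1 _ hSb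
      have e3 : (fun x => D x * deriv (fun x => T x + Q x) x) =ᵐ[volume]
          fun x => D x * deriv T x + D x * w x := by
        filter_upwards [hQd, hTL.ae_differentiableAt_real] with x hx hx'
        rw [(hx'.hasDerivAt.fun_add hx).deriv]; ring
      have i1 := hTb.integrable_deriv hDm.aestronglyMeasurable bD
      have i2 : Integrable fun x => D x * w x := by
        refine integrable_of_bdd_off (a := c) (b := d) (C := |B| * (|B| + |k|))
          (hDm.mul hwm).aestronglyMeasurable (fun x hx => ?_) fun x hx => ?_
        · rw [hw, indicator_of_notMem, mul_zero]
          exact fun h => hx ⟨h.1.le, h.2⟩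
        · rw [abs_mul]
          exact mul_le_mul ((hB x hx).trans (le_abs_self _)) (hwb x) (abs_nonneg _) (abs_nonneg _)
      rw [integral_congr_ae e3, integral_add i1 i2, e1, zero_add] at e2
      exact e2
    have hwi : Integrable w := by
      refine integrable_of_bdd_off (a := c) (b := d) (C := |B| + |k|)
          hwm.aestronglyMeasurable (fun x hx => ?_) fun x _ => hwb x
      rw [hw, indicator_of_notMem]
      exact fun h => hx ⟨h.1.le, h.2⟩
    have hw0 : ∫ x, w x = 0 := by
      rw [hw, integral_indicator measurableSet_Ioc, ← intervalIntegral.integral_of_le hcd.le]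
      have : ∫ y in c..d, w y = ∫ y in c..d, (D y - k) := by
        refine intervalIntegral.integral_congr_ae (Eventually.of_forall fun y hy => ?_)
        rw [uIoc_of_le hcd.le] at hy
        rw [hw, indicator_of_mem hy]
      rw [← this]; exact hQcd
    have hDw : Integrable fun x => D x * w x := by
        refine integrable_of_bdd_off (a := c) (b := d) (C := |B| * (|B| + |k|))
          (hDm.mul hwm).aestronglyMeasurable (fun x hx => ?_) fun x hx => ?_
        · rw [hw, indicator_of_notMem, mul_zero]
          exact fun h => hx ⟨h.1.le, h.2⟩
        · rw [abs_mul]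
          exact mul_le_mul ((hB x hx).trans (le_abs_self _)) (hwb x) (abs_nonneg _) (abs_nonneg _)
    have hsq : ∀ x, D x * w x - k * w x = w x ^ 2 := by
      intro x
      by_cases hx : x ∈ Ioc c d
      · rw [hw, indicator_of_mem hx]; ring
      · rw [hw, indicator_of_notMem hx]; ring
    have hsqi : ∫ x, w x ^ 2 = 0 := by
      simp_rw [← hsq]
      rw [integral_sub hDw (hwi.const_mul k), hzero, integral_const_mul, hw0]; simp
    have hsqint : Integrable fun x => w x ^ 2 := by
      simp_rw [← hsq]; exact hDw.sub (hwi.const_mul k)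
    rw [integral_eq_zero_iff_of_nonneg (fun x => sq_nonneg _) hsqint] at hsqi
    refine ⟨k, ?_⟩
    filter_upwards [hsqi] with x hx hx'
    simp only [Pi.zero_apply, hw, indicator_of_mem hx'] at hx
    nlinarith [pow_eq_zero_iff (two_ne_zero) |>.1 hx]
  -- the constants agree
  obtain ⟨k, hk⟩ := h2 (-2) (-1) (by norm_num) (by norm_num)
  -- These intervals exhaust the negative half-line and all contain `(-2, -1]`, where the constant
  -- is `k`.
  have h3 : ∀ n : ℕ, ∀ᵐ x, x ∈ Ioc (-2 - (n:ℝ)) (-1 / (n + 1)) → D x = k := by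
    intro n
    have hn : (0:ℝ) ≤ n := Nat.cast_nonneg n
    have h11 : -1 / ((n:ℝ) + 1) < 0 := div_neg_of_neg_of_pos (by norm_num) (by positivity)
    have h12 : -1 ≤ -1 / ((n:ℝ) + 1) := by
      rw [le_div_iff₀ (by positivity)]; linarith
    obtain ⟨k', hk'⟩ := h2 (-2 - (n:ℝ)) (-1 / (n + 1)) (by linarith) h11
    have : k' = k := by
      by_contra hne
      have hae : ∀ᵐ x, x ∉ Ioc (-2:ℝ) (-1) := by
        filter_upwards [hk, hk'] with x hx hx' hmem
        exact hne ((hx' ⟨by linarith [hmem.1], by linarith [hmem.2]⟩).symm.trans (hx hmem))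
      have := measure_eq_zero_iff_ae_notMem.2 hae
      norm_num [Real.volume_Ioc] at this
    rw [this] at hk'; exact hk'
  refine ⟨fun x => k - P x, ⟨_, (LipschitzWith.const k).sub hPL⟩, ?_, ?_⟩
  · filter_upwards [hPd] with x hx
    exact hx.const_sub k
  · filter_upwards [ae_all_iff.2 h3] with x hx hx0
    obtain ⟨n, hn⟩ := exists_nat_gt (max (-x) (-1 / x))
    have h1 := (le_max_left _ _).trans_lt hn
    have h2 := (le_max_right _ _).trans_lt hn
    have := hx n ⟨by linarith, ?_⟩
    · simp only [hD] at this; linarith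
    · rw [le_div_iff₀ (by positivity)]
      rw [div_lt_iff_of_neg hx0] at h2
      nlinarith

/-- The scalar entropy inequality for the pair `(A, g)` with sign `s`, where `A' = -g`. -/
structure IsEntropyTriple (s A g : ℝ → ℝ) : Prop where
  meas_s : Measurable s
  meas_g : Measurable g
  abs_s : ∀ x, |s x| ≤ 1
  bdd_g : ∃ C, ∀ x, |g x| ≤ C
  lip : ∃ K, LipschitzWith K A
  hasDeriv : ∀ᵐ x, HasDerivAt A (-g x) x
  sign : ∀ x, s x * g x = |g x|
  ineq : ∀ Φ, IsLipBump Φ → 0 ≤ ∫ x, (s x * A x * deriv Φ x - s x * g x * Φ x)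

/-! ### Comparison principles from test functions built with the profile -/

namespace IsEntropyTriple

variable {s A g : ℝ → ℝ}

theorem neg (h : IsEntropyTriple s A g) :
    IsEntropyTriple (fun x => -s x) (fun x => -A x) (fun x => -g x) where
  meas_s := h.meas_s.neg
  meas_g := h.meas_g.neg
  abs_s x := by rw [abs_neg]; exact h.abs_s x
  bdd_g := by simpa using h.bdd_g
  lip := by obtain ⟨K, hK⟩ := h.lip; exact ⟨K, hK.neg⟩
  hasDeriv := by filter_upwards [h.hasDeriv] with x hx using hx.neg
  sign x := by rw [abs_neg, neg_mul_neg]; exact h.sign x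
  ineq Φ hΦ := by simpa using h.ineq Φ hΦ

theorem integrable (h : IsEntropyTriple s A g) {Φ : ℝ → ℝ} (hΦ : IsLipBump Φ) :
    Integrable fun x => (s x * A x * deriv Φ x - s x * g x * Φ x) := by
  obtain ⟨K, hK⟩ := h.lip
  obtain ⟨C, hC⟩ := h.bdd_g
  have bs : LocBdd s := LocBdd.of_bdd h.abs_s
  exact (hΦ.integrable_deriv (h.meas_s.mul hK.continuous.measurable).aestronglyMeasurable
    (bs.mul (LocBdd.of_continuous hK.continuous))).sub
    (hΦ.integrable_mul (h.meas_s.mul h.meas_g).aestronglyMeasurable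
      (bs.mul (LocBdd.of_bdd hC)))

/-- Test with `Φ = χ A⁺` for a trapezoid `χ`. Where `A > 0` the integrand is `s χ' A² - 2 χ A |g|`.
The cut-off rises only where `s = -1` and falls only where `s = 1`, so the integrand is nonpositive
and must vanish almost everywhere. Then `A' = -g = 0` wherever `A > 0` inside the cut-off, while `A`
cannot be positive on the whole rising ramp; so `A` can never become positive. -/
theorem nonpos (h : IsEntropyTriple s A g) {c d : ℝ} (hd : d < 0)
    (hL : ∀ᵐ x, x < c → s x = -1) (hR : ∀ᵐ x, d < x → x < 0 → s x = 1) :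
    ∀ x ≤ 0, A x ≤ 0 := by
  obtain ⟨K, hK⟩ := h.lip
  have hAc := hK.continuous
  have main : ∀ x < 0, A x ≤ 0 := by
    intro x₀ hx₀
    by_contra! hpos
    -- The rising ramp `[c' - δ, c']` lies to the left of both `c` and `x₀`; the falling ramp lies
    -- between `max d x₀` and `0`.
    set c' := min c x₀ - 1 with hc'
    set d' := max d x₀ with hd'
    have hd'0 : d' < 0 := max_lt hd hx₀
    set δ := -d' / 4 with hδ
    have hδ0 : 0 < δ := by rw [hδ]; linarith
    set p := c' - δ with hp
    set t := d' + 2 * δ with ht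
    have hc'c : c' < c := by rw [hc']; linarith [min_le_left c x₀]
    have hc'x : c' < x₀ := by rw [hc']; linarith [min_le_right c x₀]
    have hdd : d ≤ d' := le_max_left _ _
    have hxd : x₀ ≤ d' := le_max_right _ _
    have ht0 : t < 0 := by rw [ht, hδ]; linarith
    have hpt : p + δ < t - δ := by rw [hp, ht]; linarith
    set Φ : ℝ → ℝ := fun x => trap p t δ x * max (A x) 0 with hΦ
    have hoff : ∀ x, x ∉ Icc p t → Φ x = 0 := fun x hx => by simp [hΦ, trap_off hx]
    have hΦb : IsLipBump Φ := by
      refine ⟨lipschitz_mul_of_supp (trap_lipschitz p t δ) (hK.max_const 0)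
        (fun x hx => trap_off hx), fun x => mul_nonneg (trap_nonneg _ _ _ _) (le_max_right _ _),
        p, t, by linarith, ht0, hoff⟩
    set I : ℝ → ℝ := fun x => s x * A x * deriv Φ x - s x * g x * Φ x with hI
    -- the integrand is nonpositive, and strictly so on the left ramp where `A > 0`
    have hne : ∀ᵐ x : ℝ, x ∉ ({p, p + δ, t - δ, t} : Set ℝ) :=
      measure_eq_zero_iff_ae_notMem.1 (Set.Finite.measure_zero (by simp) _)
    have key : ∀ᵐ x, I x ≤ 0 ∧ (x ∈ Ioo p t → 0 < A x → I x = 0 → g x = 0) ∧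
        (x ∈ Ioo p (p + δ) → 0 < A x → I x < 0) := by
      filter_upwards [h.hasDeriv, hL, hR, hne] with x hAx hLx hRx hnx
      simp only [mem_insert_iff, mem_singleton_iff, not_or] at hnx
      obtain ⟨n1, n2, n3, n4⟩ := hnx
      by_cases hA : 0 < A x
      swap
      · have : I x = 0 := by
          have h0 : Φ x = 0 := by simp [hΦ, max_eq_right (not_lt.1 hA)]
          -- Where `A x = 0` the test function need not be differentiable, but its derivative is
          -- multiplied by `A x`.
          rcases (not_lt.1 hA).lt_or_eq with h1 | h1
          · have : Φ =ᶠ[𝓝 x] fun _ => 0 := by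
              filter_upwards [hAc.continuousAt.eventually (gt_mem_nhds h1)] with y hy
              simp [hΦ, max_eq_right (le_of_lt hy)]
            have : deriv Φ x = 0 := by rw [this.deriv_eq]; simp
            simp [hI, h0, this]
          · simp [hI, h0, h1]
        exact ⟨this.le, fun _ h1 => absurd h1 hA, fun _ h1 => absurd h1 hA⟩
      have hΦx : Φ x = trap p t δ x * A x := by simp [hΦ, max_eq_left hA.le]
      have hform : ∀ q, HasDerivAt (trap p t δ) q x →
          I x = s x * q * A x ^ 2 - 2 * (trap p t δ x * A x * |g x|) := by
        intro q hq
        have hd : HasDerivAt Φ (q * A x + trap p t δ x * (-g x)) x := by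
          refine (hq.fun_mul hAx).congr_of_eventuallyEq ?_
          filter_upwards [hAc.continuousAt.eventually (lt_mem_nhds hA)] with y hy
          simp [hΦ, max_eq_left (le_of_lt hy)]
        simp only [hI]
        rw [hd.deriv, hΦx, ← h.sign x]; ring
      by_cases hxm : x ∈ Ioo p t
      swap
      · have hx' : x ∉ Icc p t := fun hh => hxm ⟨lt_of_le_of_ne hh.1 (Ne.symm n1),
          lt_of_le_of_ne hh.2 n4⟩
        have : I x = 0 := by
          simp [hI, hoff x hx', deriv_eq_zero_off hoff x hx']
        refine ⟨this.le, fun h1 => absurd h1 hxm, fun h1 => absurd ⟨h1.1, by linarith [h1.2]⟩ hxm⟩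
      have hχ := trap_pos hδ0 hxm
      have hz : 0 ≤ trap p t δ x * A x * |g x| := by positivity
      have fin : ∀ r ≤ 0, I x = r * A x ^ 2 - 2 * (trap p t δ x * A x * |g x|) →
          I x ≤ 0 ∧ (x ∈ Ioo p t → 0 < A x → I x = 0 → g x = 0) := by
        intro r hr e
        have h1 : r * A x ^ 2 ≤ 0 := mul_nonpos_of_nonpos_of_nonneg hr (sq_nonneg _)
        refine ⟨by linarith, fun _ _ h0 => ?_⟩
        have h2 : trap p t δ x * A x * |g x| = 0 := by linarith
        have h3 := (mul_eq_zero.1 h2).resolve_left (by positivity)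
        exact abs_eq_zero.1 h3
      rcases lt_or_gt_of_ne n2 with h1 | h1
      · have hs := hLx (by linarith)
        have e := hform 1 (trap_deriv_up hpt ⟨hxm.1, h1⟩)
        rw [hs] at e
        obtain ⟨f1, f2⟩ := fin (-1) (by norm_num) (by rw [e]; ring)
        exact ⟨f1, f2, fun _ _ => by rw [e]; nlinarith⟩
      · rcases lt_or_gt_of_ne n3 with h2 | h2
        · have e := hform 0 (trap_deriv_plateau hδ0.le ⟨h1, h2⟩)
          obtain ⟨f1, f2⟩ := fin 0 le_rfl (by rw [e]; ring)
          exact ⟨f1, f2, fun h3 => by linarith [h3.2]⟩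
        · have hs := hRx (by linarith) (by linarith [hxm.2])
          have e := hform (-1) (trap_deriv_down hpt ⟨h2, hxm.2⟩)
          rw [hs] at e
          obtain ⟨f1, f2⟩ := fin (-1) (by norm_num) (by rw [e]; ring)
          exact ⟨f1, f2, fun h3 => by linarith [h3.2]⟩
    have hIi := h.integrable hΦb
    have hI0 : ∀ᵐ x, I x = 0 := by
      have h1 : 0 ≤ᵐ[volume] fun x => -I x := by
        filter_upwards [key] with x hx
        simpa using hx.1
      have h2 : ∫ x, -I x = 0 := by
        have a1 := h.ineq Φ hΦb
        have a2 := integral_nonneg_of_ae h1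
        rw [integral_neg] at a2 ⊢
        linarith
      have h3 := (integral_eq_zero_iff_of_nonneg_ae h1 hIi.neg).1 h2
      filter_upwards [h3] with x hx
      simpa using hx
    -- a point of the ramp with `A ≤ 0`
    obtain ⟨x₁, hx₁, hAx₁⟩ : ∃ x₁ ∈ Ioo p (p + δ), A x₁ ≤ 0 := by
      by_contra! hall
      have hae : ∀ᵐ x, x ∉ Ioo p (p + δ) := by
        filter_upwards [key, hI0] with x hx hx0 hmem
        exact (hx.2.2 hmem (hall x hmem)).ne hx0
      have := measure_eq_zero_iff_ae_notMem.2 hae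
      rw [Real.volume_Ioo] at this
      simp at this; linarith
    have hx₁₀ : x₁ < x₀ := by linarith [hx₁.2]
    -- After the last point `x₂` with `A ≤ 0` the derivative of `A` vanishes, so `A` would keep the
    -- value `A x₂ ≤ 0` up to `x₀`.
    obtain ⟨x₂, ⟨⟨hx₂, hAx₂⟩, hgr⟩⟩ : ∃ x₂, IsGreatest (Icc x₁ x₀ ∩ {x | A x ≤ 0}) x₂ :=
      (isCompact_Icc.inter_right (isClosed_le hAc continuous_const)).exists_isGreatest
        ⟨x₁, ⟨le_rfl, hx₁₀.le⟩, hAx₁⟩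
    obtain ⟨k, hk⟩ := (hK.acOn x₂ x₀).const_of_ae_hasDerivAt_zero (by
      filter_upwards [key, hI0, h.hasDeriv, measure_eq_zero_iff_ae_notMem.1
        (Real.volume_singleton (a := x₂))] with x hx hx0 hdx hxx hm
      rw [uIcc_of_le hx₂.2] at hm
      have hxne : x₂ < x := lt_of_le_of_ne hm.1 (fun e => hxx (by simp [e]))
      have hApos : 0 < A x := by
        by_contra! hh
        exact absurd (hgr ⟨⟨hx₂.1.trans hm.1, hm.2⟩, hh⟩) (not_le.2 hxne)
      have := hx.2.1 ⟨by linarith [hx₁.1, hx₂.1], by linarith [hm.2]⟩ hApos hx0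
      rwa [this, neg_zero] at hdx)
    have e1 := hk x₂ left_mem_uIcc
    have e2 := hk x₀ right_mem_uIcc
    have : A x₂ ≤ 0 := hAx₂
    linarith
  intro x hx
  rcases hx.lt_or_eq with h1 | rfl
  · exact main x h1
  · have hcw : Tendsto A (𝓝[<] 0) (𝓝 (A 0)) := hAc.continuousAt.continuousWithinAt
    refine le_of_tendsto hcw ?_
    filter_upwards [self_mem_nhdsWithin] with y hy using main y hy

theorem nonneg (h : IsEntropyTriple s A g) {c d : ℝ} (hd : d < 0)
    (hL : ∀ᵐ x, x < c → s x = 1) (hR : ∀ᵐ x, d < x → x < 0 → s x = -1) :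
    ∀ x ≤ 0, 0 ≤ A x := by
  intro x hx
  have := h.neg.nonpos (c := c) hd (by filter_upwards [hL] with y hy h1; rw [hy h1])
    (by filter_upwards [hR] with y hy h1 h2; rw [hy h1 h2]; norm_num) x hx
  linarith

/-- Choose `Φ` with `Φ' = δ A` on the plateau. The total derivative `(A Φ)'` has integral zero and
exceeds the entropy integrand by `(1 - s) δ A² + (|g| - g) Φ ≥ 0` there, and by nothing where `s =
1`. Since the entropy integral is nonnegative, the excess vanishes almost everywhere. The
exceptional alternative `A = 0`, `0 ≤ g` is later excluded by the injectivity of the curve. -/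
theorem eq_one (h : IsEntropyTriple s A g) {c d : ℝ} (hd : d < 0)
    (hL : ∀ᵐ x, x < c → s x = 1) (hR : ∀ᵐ x, d < x → x < 0 → s x = 1) :
    ∀ᵐ x, x < 0 → s x = 1 ∨ (A x = 0 ∧ 0 ≤ g x) := by
  obtain ⟨K, hK⟩ := h.lip
  obtain ⟨C, hC⟩ := h.bdd_g
  have hAc := hK.continuous
  set c' := min c d with hc'
  have hc'c : c' ≤ c := min_le_left _ _
  have hc'd : c' ≤ d := min_le_right _ _
  set δ := -d / 4 with hδ
  have hδ0 : 0 < δ := by rw [hδ]; linarith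
  set p := c' - 2 * δ with hp
  set t := d + 2 * δ with ht
  have ht0 : t < 0 := by rw [ht, hδ]; linarith
  have hpt : p + δ < t - δ := by rw [hp, ht]; linarith
  -- a clamped version of `A`, so that its primitive is globally Lipschitz
  obtain ⟨B, hB⟩ := isCompact_Icc.exists_bound_of_continuousOn (s := Icc p t)
    hAc.continuousOn
  set A' : ℝ → ℝ := (Icc p t).indicator A with hA'
  have hA'm : Measurable A' := hAc.measurable.indicator measurableSet_Icc
  have hA'b : ∀ x, |A' x| ≤ |B| := fun x => by
    by_cases hx : x ∈ Icc p t
    · rw [hA', indicator_of_mem hx]; exact (hB x hx).trans (le_abs_self _)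
    · rw [hA', indicator_of_notMem hx]; simp
  set Q : ℝ → ℝ := fun x => ∫ y in (0:ℝ)..x, A' y with hQ
  have hQL := lipschitz_primitive hA'm.aestronglyMeasurable hA'b 0
  have hQd := ae_hasDerivAt_primitive hA'm.aestronglyMeasurable hA'b 0
  obtain ⟨E, hE⟩ := isCompact_Icc.exists_bound_of_continuousOn (s := Icc p t)
    hQL.continuous.continuousOn
  -- The constant `|E| + 1` keeps `W ≥ 1` on `[p, t]`, so the maximum is inactive there and `W' = A`
  -- almost everywhere.
  set W : ℝ → ℝ := fun x => max (|E| + 1 + Q x) 0 with hW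
  have hWL : LipschitzWith (0 + Real.toNNReal |B|) W :=
    ((LipschitzWith.const (|E| + 1)).add hQL).max_const 0
  set Φ : ℝ → ℝ := fun x => trap p t δ x * W x with hΦ
  have hoff : ∀ x, x ∉ Icc p t → Φ x = 0 := fun x hx => by simp [hΦ, trap_off hx]
  have hΦb : IsLipBump Φ := by
    refine ⟨lipschitz_mul_of_supp (trap_lipschitz p t δ) hWL
      (fun x hx => trap_off hx), fun x => mul_nonneg (trap_nonneg _ _ _ _) (le_max_right _ _),
      p, t, by linarith, ht0, hoff⟩
  obtain ⟨KΦ, hKΦ⟩ := hΦb.lip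
  set I : ℝ → ℝ := fun x => s x * A x * deriv Φ x - s x * g x * Φ x with hI
  set J : ℝ → ℝ := fun x => A x * deriv Φ x - g x * Φ x with hJ
  have hIi := h.integrable hΦb
  have hJi : Integrable J := (hΦb.integrable_deriv hAc.aestronglyMeasurable
    (LocBdd.of_continuous hAc)).sub (hΦb.integrable_mul h.meas_g.aestronglyMeasurable
    (LocBdd.of_bdd hC))
  have hJ0 : ∫ x, J x = 0 := by
    have e : J =ᵐ[volume] deriv fun x => A x * Φ x := by
      filter_upwards [h.hasDeriv, hKΦ.ae_differentiableAt_real] with x h1 h2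
      rw [(h1.fun_mul h2.hasDerivAt).deriv]; simp only [hJ]; ring
    rw [integral_congr_ae e]
    exact integral_deriv_eq_zero (a := p) (b := t) ((hK.acOn _ _).fun_mul (hKΦ.acOn _ _))
      fun x hx => by simp [hoff x hx]
  have key : ∀ᵐ x, x < 0 → 0 ≤ J x - I x ∧ (J x - I x = 0 → s x = 1 ∨ (A x = 0 ∧ 0 ≤ g x)) := by
    filter_upwards [hQd, hL, hR, measure_eq_zero_iff_ae_notMem.1
        (Real.volume_singleton (a := d))] with x h1 h2 h3 h4 h5
    have hJI : J x - I x = (1 - s x) * A x * deriv Φ x + (|g x| - g x) * Φ x := by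
      simp only [hJ, hI]; rw [← h.sign x]; ring
    by_cases hx : x < c'
    · have e := h2 (lt_of_lt_of_le hx hc'c)
      have e2 := h.sign x
      rw [e, one_mul] at e2
      rw [hJI, e, ← e2]; simp
    · push Not at hx
      by_cases hx' : d < x
      · have e := h3 hx' h5
        have e2 := h.sign x
        rw [e, one_mul] at e2
        rw [hJI, e, ← e2]; simp
      · push Not at hx'
        have hm : x ∈ Icc p t := ⟨by linarith, by linarith⟩
        have hWpos : ∀ y ∈ Icc p t, 1 ≤ |E| + 1 + Q y := fun y hy => by
          have := hE y hy
          rw [Real.norm_eq_abs] at this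
          linarith [neg_abs_le (Q y), le_abs_self E]
        have hΦd : HasDerivAt Φ (δ * A x) x := by
          have : HasDerivAt (fun y => δ * (|E| + 1 + Q y)) (δ * A' x) x :=
            ((h1.const_add _).const_mul δ)
          rw [hA', indicator_of_mem hm] at this
          refine this.congr_of_eventuallyEq ?_
          filter_upwards [Ioo_mem_nhds (by linarith : p + δ < x) (by linarith : x < t - δ)]
            with y hy
          simp only [hΦ, hW]
          rw [trap_plateau hδ0.le ⟨hy.1.le, hy.2.le⟩, max_eq_left]
          linarith [hWpos y ⟨by linarith [hy.1], by linarith [hy.2]⟩]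
        have hΦx : Φ x = δ * (|E| + 1 + Q x) := by
          simp only [hΦ, hW]
          rw [trap_plateau hδ0.le ⟨by linarith, by linarith⟩, max_eq_left]
          linarith [hWpos x hm]
        have hΦpos : 0 < Φ x := by
          rw [hΦx]; have := hWpos x hm; positivity
        rw [hJI, hΦd.deriv]
        have s1 : 0 ≤ 1 - s x := by linarith [le_abs_self (s x), h.abs_s x]
        have p1 : (1 - s x) * A x * (δ * A x) = (1 - s x) * (δ * A x ^ 2) := by ring
        have p2 : 0 ≤ (1 - s x) * (δ * A x ^ 2) := by positivity
        have p3 : 0 ≤ |g x| - g x := by linarith [le_abs_self (g x)]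
        have p4 : 0 ≤ (|g x| - g x) * Φ x := by positivity
        rw [p1]
        refine ⟨by linarith, fun h0 => ?_⟩
        have q1 : (1 - s x) * (δ * A x ^ 2) = 0 := by linarith
        have q2 : (|g x| - g x) * Φ x = 0 := by linarith
        have q3 := (mul_eq_zero.1 q2).resolve_right hΦpos.ne'
        rcases mul_eq_zero.1 q1 with q | q
        · left; linarith
        · right
          refine ⟨?_, by linarith [abs_nonneg (g x)]⟩
          have := (mul_eq_zero.1 q).resolve_left hδ0.ne'
          exact pow_eq_zero_iff two_ne_zero |>.1 this
  have hout : ∀ x, 0 ≤ x → J x - I x = 0 := by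
    intro x hx
    have : x ∉ Icc p t := fun hh => by linarith [hh.2]
    simp [hJ, hI, hoff x this, deriv_eq_zero_off hoff x this]
  have hnn : 0 ≤ᵐ[volume] fun x => J x - I x := by
    filter_upwards [key] with x hx
    rcases lt_or_ge x 0 with h0 | h0
    · exact (hx h0).1
    · exact (hout x h0).ge
  have hz : ∫ x, (J x - I x) = 0 := by
    have a1 := h.ineq Φ hΦb
    have a2 := integral_nonneg_of_ae hnn
    rw [integral_sub hJi hIi, hJ0] at a2 ⊢
    linarith
  have := (integral_eq_zero_iff_of_nonneg_ae hnn (hJi.sub hIi)).1 hz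
  filter_upwards [this, key] with x h1 h2 h3
  exact (h2 h3).2 h1

theorem eq_neg_one (h : IsEntropyTriple s A g) {c d : ℝ} (hd : d < 0)
    (hL : ∀ᵐ x, x < c → s x = -1) (hR : ∀ᵐ x, d < x → x < 0 → s x = -1) :
    ∀ᵐ x, x < 0 → s x = -1 ∨ (A x = 0 ∧ g x ≤ 0) := by
  have := h.neg.eq_one (c := c) hd (by filter_upwards [hL] with y hy h1; rw [hy h1]; norm_num)
    (by filter_upwards [hR] with y hy h1 h2; rw [hy h1 h2]; norm_num)
  filter_upwards [this] with x hx h0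
  rcases hx h0 with h1 | ⟨h1, h2⟩
  · left; linarith
  · right; exact ⟨by linarith, by linarith⟩

end IsEntropyTriple

end

noncomputable section

/-! ### Unimodal flux curves -/

/-- A curve `s ↦ (u s, v s)`, `s ∈ [0, len]`, with monotone density `u` and flux `v` increasing up
to `peak` and decreasing afterwards. -/
structure FluxCurve where
  len : ℝ
  peak : ℝ
  u : ℝ → ℝ
  v : ℝ → ℝ
  peak_mem : peak ∈ Icc 0 len
  cont_u : Continuous u
  cont_v : Continuous v
  mono_u : MonotoneOn u (Icc 0 len)
  inj : ∀ a ∈ Icc 0 len, ∀ b ∈ Icc 0 len, u a = u b → v a = v b → a = b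
  v_up : StrictMonoOn v (Icc 0 peak)
  v_down : StrictAntiOn v (Icc peak len)

namespace FluxCurve

variable (C : FluxCurve)

/-- Reflection of space and of the densities. -/
def reflect : FluxCurve where
  len := C.len
  peak := C.len - C.peak
  u s := -C.u (C.len - s)
  v s := C.v (C.len - s)
  peak_mem := ⟨by linarith [C.peak_mem.2], by linarith [C.peak_mem.1]⟩
  cont_u := by have := C.cont_u; fun_prop
  cont_v := by have := C.cont_v; fun_prop
  mono_u a ha b hb hab := by
    have := C.mono_u (a := C.len - b) ⟨by linarith [hb.2], by linarith [hb.1]⟩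
      (b := C.len - a) ⟨by linarith [ha.2], by linarith [ha.1]⟩ (by linarith)
    simpa using this
  inj a ha b hb h1 h2 := by
    have := C.inj (C.len - a) ⟨by linarith [ha.2], by linarith [ha.1]⟩
      (C.len - b) ⟨by linarith [hb.2], by linarith [hb.1]⟩ (neg_injective h1) h2
    linarith
  v_up a ha b hb hab := C.v_down ⟨by linarith [hb.2], by linarith [hb.1]⟩
    ⟨by linarith [ha.2], by linarith [ha.1]⟩ (by linarith)
  v_down a ha b hb hab := C.v_up ⟨by linarith [hb.2], by linarith [hb.1]⟩
    ⟨by linarith [ha.2], by linarith [ha.1]⟩ (by linarith)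

/-- A self-similar entropy solution on the cone `R`, described by the parameter along the curve. -/
structure IsEntropic (R : Set ℝ) (σ : ℝ → ℝ) : Prop where
  meas : Measurable σ
  mem : ∀ x, σ x ∈ Icc 0 C.len
  ineq : ∀ τ ∈ Icc 0 C.len, ∀ Φ, IsSmoothBump R Φ →
    0 ≤ ∫ x, (Real.sign (σ x - τ) * (C.v (σ x) - C.v τ - x * (C.u (σ x) - C.u τ)) * deriv Φ x
      - Real.sign (σ x - τ) * (C.u (σ x) - C.u τ) * Φ x)

/-- The parameter `s` is a state at speed `ξ` of the wave from `a` to `b`. -/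
def IsHull (a b ξ s : ℝ) : Prop :=
  s ∈ uIcc a b ∧
  (a ≤ b → ∀ τ ∈ Icc a b, C.v s - ξ * C.u s ≤ C.v τ - ξ * C.u τ) ∧
  (b ≤ a → ∀ τ ∈ Icc b a, C.v τ - ξ * C.u τ ≤ C.v s - ξ * C.u s)

/-- The traces `b` at the right end that are connected to the left state `a` by waves of negative
speed. -/
def InCond (a b : ℝ) : Prop := b = a ∨ (C.peak ≤ b ∧ (a < C.peak → C.v b < C.v a))

variable {C}

theorem bdd_u : ∃ B, ∀ s ∈ Icc 0 C.len, |C.u s| ≤ B :=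
  isCompact_Icc.exists_bound_of_continuousOn C.cont_u.continuousOn

theorem bdd_v : ∃ B, ∀ s ∈ Icc 0 C.len, |C.v s| ≤ B :=
  isCompact_Icc.exists_bound_of_continuousOn C.cont_v.continuousOn

/-- Past the peak the flux decreases strictly to its value at `b`; before the peak it is at least `v
a`, which `InCond` places above `v b`. So `b` minimizes the flux on an arc run upwards, which makes
all wave speeds nonpositive. -/
theorem InCond.lt_v {a b τ : ℝ} (h : C.InCond a b) (ha : 0 ≤ a) (hb : b ≤ C.len)
    (hτ : τ ∈ Ico a b) : C.v b < C.v τ := by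
  rcases h with rfl | ⟨h1, h2⟩
  · exact absurd hτ.1 (not_le.2 hτ.2)
  · rcases le_or_gt C.peak τ with h3 | h3
    · exact C.v_down ⟨h3, hτ.2.le.trans hb⟩ ⟨h1, hb⟩ hτ.2
    · refine (h2 (hτ.1.trans_lt h3)).trans_le ?_
      exact C.v_up.monotoneOn ⟨ha, hτ.1.trans h3.le⟩ ⟨ha.trans hτ.1, h3.le⟩ hτ.1

theorem InCond.v_lt {a b τ : ℝ} (h : C.InCond a b) (ha : a ≤ C.len)
    (hτ : τ ∈ Ioc b a) : C.v τ < C.v b := by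
  rcases h with rfl | ⟨h1, h2⟩
  · exact absurd hτ.2 (not_le.2 hτ.1)
  · exact C.v_down ⟨h1, hτ.1.le.trans (hτ.2.trans ha)⟩ ⟨h1.trans hτ.1.le, hτ.2.trans ha⟩ hτ.1

/-- Under `InCond`, the wave takes only its right state at positive speeds. -/
theorem InCond.isHull_iff {a b ξ s : ℝ} (h : C.InCond a b) (ha : a ∈ Icc 0 C.len)
    (hb : b ∈ Icc 0 C.len) (hξ : 0 < ξ) : C.IsHull a b ξ s ↔ s = b := by
  -- On the arc `b` is extremal for the flux and, in the opposite sense, for the density. For `ξ >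
  -- 0` both effects favour `b` in `v - ξ u`, and a tie forces equal density and flux.
  have key : ∀ τ ∈ Icc 0 C.len, τ ∈ uIcc a b →
      (a ≤ b → C.v b ≤ C.v τ ∧ C.u τ ≤ C.u b) ∧ (b ≤ a → C.v τ ≤ C.v b ∧ C.u b ≤ C.u τ) := by
    intro τ hτ hτ'
    constructor
    · intro hab
      rw [uIcc_of_le hab] at hτ'
      refine ⟨?_, C.mono_u hτ hb hτ'.2⟩
      rcases hτ'.2.eq_or_lt with rfl | h1
      · exact le_rfl
      · exact (h.lt_v ha.1 hb.2 ⟨hτ'.1, h1⟩).le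
    · intro hab
      rw [uIcc_of_ge hab] at hτ'
      refine ⟨?_, C.mono_u hb hτ hτ'.1⟩
      rcases hτ'.1.eq_or_lt with rfl | h1
      · exact le_rfl
      · exact (h.v_lt ha.2 ⟨h1, hτ'.2⟩).le
  have hsub : ∀ τ ∈ uIcc a b, τ ∈ Icc 0 C.len := fun τ hτ =>
    ⟨(le_min ha.1 hb.1).trans hτ.1, hτ.2.trans (max_le ha.2 hb.2)⟩
  constructor
  · rintro ⟨hs, h1, h2⟩
    obtain ⟨k1, k2⟩ := key s (hsub s hs) hs
    rcases le_total a b with hab | hab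
    · obtain ⟨e1, e2⟩ := k1 hab
      have := h1 hab b ⟨hab, le_rfl⟩
      have e3 : ξ * C.u s ≤ ξ * C.u b := by gcongr
      have e4 : C.u s = C.u b := by nlinarith
      exact C.inj s (hsub s hs) b hb e4 (by rw [e4] at this; linarith)
    · obtain ⟨e1, e2⟩ := k2 hab
      have := h2 hab b ⟨le_rfl, hab⟩
      have e3 : ξ * C.u b ≤ ξ * C.u s := by gcongr
      have e4 : C.u s = C.u b := by nlinarith
      exact C.inj s (hsub s hs) b hb e4 (by rw [e4] at this; linarith)
  · rintro rfl
    refine ⟨right_mem_uIcc, fun hab τ hτ => ?_, fun hab τ hτ => ?_⟩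
    · have hτ' : τ ∈ uIcc a s := by rwa [uIcc_of_le hab]
      obtain ⟨e1, e2⟩ := (key τ (hsub τ hτ') hτ').1 hab
      have e3 : ξ * C.u τ ≤ ξ * C.u s := by gcongr
      linarith
    · have hτ' : τ ∈ uIcc a s := by rwa [uIcc_of_ge hab]
      obtain ⟨e1, e2⟩ := (key τ (hsub τ hτ') hτ').2 hab
      have e3 : ξ * C.u s ≤ ξ * C.u τ := by gcongr
      linarith

theorem abs_sign_le (x : ℝ) : |Real.sign x| ≤ 1 := by
  rcases Real.sign_apply_eq x with h | h | h <;> simp [h]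

theorem measurable_sign : Measurable Real.sign := by
  unfold Real.sign
  exact Measurable.ite measurableSet_Iio measurable_const
    (Measurable.ite measurableSet_Ioi measurable_const measurable_const)

theorem sign_mul_u {s τ : ℝ} (hs : s ∈ Icc 0 C.len) (hτ : τ ∈ Icc 0 C.len) :
    Real.sign (s - τ) * (C.u s - C.u τ) = |C.u s - C.u τ| := by
  rcases lt_trichotomy s τ with h | rfl | h
  · rw [Real.sign_of_neg (by linarith), abs_of_nonpos (by linarith [C.mono_u hs hτ h.le])]; ring
  · simp
  · rw [Real.sign_of_pos (by linarith), abs_of_nonneg (by linarith [C.mono_u hτ hs h.le])]; ring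

variable {σ : ℝ → ℝ}

/-- The self-similar flux `v - ξ u` of an entropy solution is Lipschitz, with derivative `-u`. -/
theorem IsEntropic.exists_profile (h : C.IsEntropic (Iio 0) σ) :
    ∃ A : ℝ → ℝ, (∃ K, LipschitzWith K A) ∧ (∀ᵐ x, HasDerivAt A (-C.u (σ x)) x) ∧
      (∀ᵐ x, x < 0 → C.v (σ x) - x * C.u (σ x) = A x) ∧
      ∀ τ ∈ Icc 0 C.len, IsEntropyTriple (fun x => Real.sign (σ x - τ))
        (fun x => A x - (C.v τ - x * C.u τ)) (fun x => C.u (σ x) - C.u τ) := by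
  obtain ⟨Bu, hBu⟩ := C.bdd_u
  obtain ⟨Bv, hBv⟩ := C.bdd_v
  have mU : Measurable fun x => C.u (σ x) := C.cont_u.measurable.comp h.meas
  have mV : Measurable fun x => C.v (σ x) := C.cont_v.measurable.comp h.meas
  have mS : ∀ τ, Measurable fun x => Real.sign (σ x - τ) := fun τ =>
    measurable_sign.comp (h.meas.sub_const τ)
  have bS : ∀ τ, LocBdd fun x => Real.sign (σ x - τ) := fun τ =>
    LocBdd.of_bdd fun x => abs_sign_le _
  have bU : LocBdd fun x => C.u (σ x) := LocBdd.of_bdd fun x => hBu _ (h.mem x)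
  have bV : LocBdd fun x => C.v (σ x) := LocBdd.of_bdd fun x => hBv _ (h.mem x)
  have bG : ∀ τ, LocBdd fun x => C.u (σ x) - C.u τ := fun τ =>
    bU.sub (LocBdd.of_continuous continuous_const)
  have bH : ∀ τ, LocBdd fun x => C.v (σ x) - C.v τ - x * (C.u (σ x) - C.u τ) := fun τ =>
    (bV.sub (LocBdd.of_continuous continuous_const)).sub
      ((LocBdd.of_continuous continuous_id).mul (bG τ))
  have mG : ∀ τ, Measurable fun x => C.u (σ x) - C.u τ := fun τ => mU.sub_const _
  have mH : ∀ τ, Measurable fun x => C.v (σ x) - C.v τ - x * (C.u (σ x) - C.u τ) := fun τ =>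
    (mV.sub_const _).sub (measurable_id.mul (mG τ))
  have lipineq : ∀ τ ∈ Icc 0 C.len, ∀ Φ, IsLipBump Φ →
    0 ≤ ∫ x, (Real.sign (σ x - τ) * (C.v (σ x) - C.v τ - x * (C.u (σ x) - C.u τ)) * deriv Φ x
      - Real.sign (σ x - τ) * (C.u (σ x) - C.u τ) * Φ x) := fun τ hτ Φ hΦ =>
    lip_of_smooth ((mS τ).mul (mH τ)).aestronglyMeasurable
      ((mS τ).mul (mG τ)).aestronglyMeasurable ((bS τ).mul (bH τ)) ((bS τ).mul (bG τ))
      (h.ineq τ hτ) hΦ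
  -- Against the extreme parameters `0` and `C.len` the sign is constant wherever the terms do not
  -- vanish, so the two entropy inequalities together are the conservation law.
  have h0mem : (0:ℝ) ∈ Icc 0 C.len := ⟨le_rfl, C.peak_mem.1.trans C.peak_mem.2⟩
  have hLmem : C.len ∈ Icc 0 C.len := ⟨C.peak_mem.1.trans C.peak_mem.2, le_rfl⟩
  set H : ℝ → ℝ := fun x => C.v (σ x) - x * C.u (σ x) with hH
  have mH' : Measurable H := mV.sub (measurable_id.mul mU)
  have bH' : LocBdd H := bV.sub ((LocBdd.of_continuous continuous_id).mul bU)
  -- adding an affine flux does not change the balance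
  have shift : ∀ τ Φ, IsLipBump Φ →
      ∫ x, ((C.v (σ x) - C.v τ - x * (C.u (σ x) - C.u τ)) * deriv Φ x
        - (C.u (σ x) - C.u τ) * Φ x) = ∫ x, (H x * deriv Φ x - C.u (σ x) * Φ x) := by
    intro τ Φ hΦ
    obtain ⟨a, b, hab, hb, hoff⟩ := hΦ.supp
    obtain ⟨K, hK⟩ := hΦ.lip
    set q : ℝ → ℝ := fun x => x * C.u τ - C.v τ with hq
    have hqc : Continuous q := by fun_prop
    have hqd : ∀ x, HasDerivAt q (C.u τ) x := fun x =>
      (((hasDerivAt_id x).mul_const (C.u τ)).sub_const (C.v τ)).congr_deriv (one_mul _)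
    have hqac : AbsolutelyContinuousOnInterval q (a - 1) (b + 1) := by
      have : LipschitzWith (Real.toNNReal |C.u τ|) q := LipschitzWith.of_dist_le_mul fun x y => by
        rw [Real.dist_eq, Real.dist_eq, Real.coe_toNNReal _ (abs_nonneg _), ← abs_mul]
        apply le_of_eq; congr 1; simp only [hq]; ring
      exact this.acOn _ _
    have z : ∫ x, deriv (fun x => q x * Φ x) x = 0 :=
      integral_deriv_eq_zero (hqac.fun_mul (hK.acOn _ _)) fun x hx => by simp [hoff x hx]
    have e : deriv (fun x => q x * Φ x) =ᵐ[volume] fun x => q x * deriv Φ x + C.u τ * Φ x := by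
      filter_upwards [hK.ae_differentiableAt_real] with x hx
      rw [((hqd x).fun_mul hx.hasDerivAt).deriv]; ring
    rw [integral_congr_ae e] at z
    have i1 : Integrable fun x => H x * deriv Φ x - C.u (σ x) * Φ x :=
      (hΦ.integrable_deriv mH'.aestronglyMeasurable bH').sub
      (hΦ.integrable_mul mU.aestronglyMeasurable bU)
    have i2 : Integrable fun x => q x * deriv Φ x + C.u τ * Φ x :=
      (hΦ.integrable_deriv hqc.aestronglyMeasurable (LocBdd.of_continuous hqc)).add
      (hΦ.integrable_mul aestronglyMeasurable_const (LocBdd.of_continuous continuous_const))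
    calc _ = ∫ x, ((H x * deriv Φ x - C.u (σ x) * Φ x) + (q x * deriv Φ x + C.u τ * Φ x)) := by
          congr 1; ext x; simp only [hH, hq]; ring
      _ = _ := by rw [integral_add i1 i2, z, add_zero]
  have cons : ∀ Φ, IsLipBump Φ → ∫ x, (H x * deriv Φ x - C.u (σ x) * Φ x) = 0 := by
    intro Φ hΦ
    apply le_antisymm
    · have h1 := lipineq C.len hLmem Φ hΦ
      rw [← shift C.len Φ hΦ, ← neg_nonneg, ← integral_neg]
      refine h1.trans (le_of_eq ?_)
      congr 1; ext x
      rcases (h.mem x).2.eq_or_lt with e | e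
      · rw [e]; simp
      · rw [Real.sign_of_neg (by linarith)]; ring
    · have h1 := lipineq 0 h0mem Φ hΦ
      rw [← shift 0 Φ hΦ]
      refine h1.trans (le_of_eq ?_)
      congr 1; ext x
      rcases (h.mem x).1.eq_or_lt with e | e
      · rw [← e]; simp
      · rw [Real.sign_of_pos (by linarith)]; ring
  obtain ⟨A, hAL, hAd, hAe⟩ := exists_lipschitz_primitive mH' mU bH'
    (fun x => hBu _ (h.mem x)) cons
  refine ⟨A, hAL, hAd, hAe, fun τ hτ => ?_⟩
  have hqL : ∃ K, LipschitzWith K fun x => C.v τ - x * C.u τ :=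
    ⟨Real.toNNReal |C.u τ|, LipschitzWith.of_dist_le_mul fun x y => by
        rw [Real.dist_eq, Real.dist_eq, Real.coe_toNNReal _ (abs_nonneg _), abs_sub_comm x y,
          ← abs_mul]
        apply le_of_eq; congr 1; ring⟩
  refine ⟨mS τ, mG τ, fun x => abs_sign_le _, ⟨Bu + |C.u τ|, fun x => ?_⟩, ?_, ?_, ?_, ?_⟩
  · exact (abs_sub _ _).trans (add_le_add (hBu _ (h.mem x)) le_rfl)
  · obtain ⟨K, hK⟩ := hAL
    obtain ⟨K', hK'⟩ := hqL
    exact ⟨_, hK.sub hK'⟩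
  · filter_upwards [hAd] with x hx
    have : HasDerivAt (fun x => C.v τ - x * C.u τ) (-C.u τ) x := by
      simpa using ((hasDerivAt_id x).mul_const (C.u τ)).const_sub (C.v τ)
    exact (hx.fun_sub this).congr_deriv (by ring)
  · exact fun x => sign_mul_u (h.mem x) hτ
  · intro Φ hΦ
    refine (lipineq τ hτ Φ hΦ).trans (le_of_eq (integral_congr_ae ?_))
    obtain ⟨a, b, hab, hb, hoff⟩ := hΦ.supp
    filter_upwards [hAe] with x hx
    rcases lt_or_ge x 0 with h0 | h0
    · rw [← hx h0]; simp only [hH]; ring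
    · have : x ∉ Icc a b := fun hh => by linarith [hh.2]
      simp [hoff x this, deriv_eq_zero_off hoff x this]

theorem neBot_ae_left : (𝓝[<] (0:ℝ) ⊓ ae volume).NeBot := by
  rw [inf_neBot_iff]
  intro s hs t ht
  obtain ⟨d, hd, hds⟩ := mem_nhdsLT_iff_exists_Ioo_subset.1 hs
  by_contra hne
  rw [not_nonempty_iff_eq_empty] at hne
  have : volume (Ioo d (0:ℝ)) = 0 := by
    refine measure_mono_null (t := tᶜ) (fun x hx => ?_) (mem_ae_iff.1 ht)
    intro hxt
    have : x ∈ s ∩ t := ⟨hds hx, hxt⟩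
    rw [hne] at this; exact this
  rw [Real.volume_Ioo] at this
  have hd : d < 0 := hd
  simp at this; linarith

/-- Description of an entropy solution on the negative half-line by its limits: on the left, the
limit is known up to an interval `[s₁, s₂]` of constant density. -/
theorem IsEntropic.isHull (h : C.IsEntropic (Iio 0) σ) {s₁ s₂ sR : ℝ} (h12 : s₁ ≤ s₂)
    (hs₁ : 0 ≤ s₁) (hs₂ : s₂ ≤ C.len) (hsR : sR ∈ Icc 0 C.len)
    (hs : s₁ = s₂ ∨ (C.peak ≤ s₁ ∧ C.u s₁ = C.u s₂))
    (hL₁ : ∀ τ ∈ Icc 0 C.len, τ < s₁ → ∃ c, ∀ᵐ x, x < c → τ < σ x)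
    (hL₂ : ∀ τ ∈ Icc 0 C.len, s₂ < τ → ∃ c, ∀ᵐ x, x < c → σ x < τ)
    (hR₁ : ∀ τ ∈ Icc 0 C.len, τ < sR → ∃ d < 0, ∀ᵐ x, d < x → x < 0 → τ < σ x)
    (hR₂ : ∀ τ ∈ Icc 0 C.len, sR < τ → ∃ d < 0, ∀ᵐ x, d < x → x < 0 → σ x < τ)
    {s₀ : ℝ} (hs₀ : s₀ ∈ Icc s₁ s₂) :
    (∀ᵐ x, x < 0 → C.IsHull s₀ sR x (σ x)) ∧ C.InCond s₀ sR := by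
  obtain ⟨A, ⟨K, hK⟩, hAd, hAe, hT⟩ := h.exists_profile
  have hAc := hK.continuous
  have hs₁' : s₁ ∈ Icc 0 C.len := ⟨hs₁, h12.trans hs₂⟩
  have hs₂' : s₂ ∈ Icc 0 C.len := ⟨hs₁.trans h12, hs₂⟩
  have hs₀' : s₀ ∈ Icc 0 C.len := ⟨hs₁.trans hs₀.1, hs₀.2.trans hs₂⟩
  -- the value of the profile at the right end
  have hA0 : A 0 = C.v sR := by
    have := neBot_ae_left
    set l := 𝓝[<] (0:ℝ) ⊓ ae volume with hl
    have hl1 : l ≤ 𝓝[<] 0 := inf_le_left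
    have hl2 : l ≤ ae volume := inf_le_right
    have near : ∀ d < 0, ∀ᶠ x in l, d < x ∧ x < 0 := fun d hd => by
      apply hl1
      filter_upwards [Ioo_mem_nhdsLT hd] with x hx using hx
    have hσ : Tendsto σ l (𝓝 sR) := by
      rw [tendsto_order]
      constructor
      · intro a ha
        rcases lt_or_ge a 0 with h0 | h0
        · exact Eventually.of_forall fun x => h0.trans_le (h.mem x).1
        · obtain ⟨d, hd, hh⟩ := hR₁ a ⟨h0, ha.le.trans hsR.2⟩ ha
          filter_upwards [near d hd, hl2 hh] with x h1 h2 using h2 h1.1 h1.2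
      · intro a ha
        rcases lt_or_ge C.len a with h0 | h0
        · exact Eventually.of_forall fun x => (h.mem x).2.trans_lt h0
        · obtain ⟨d, hd, hh⟩ := hR₂ a ⟨hsR.1.trans ha.le, h0⟩ ha
          filter_upwards [near d hd, hl2 hh] with x h1 h2 using h2 h1.1 h1.2
    have hx : Tendsto (fun x : ℝ => x) l (𝓝 0) := hl1.trans nhdsWithin_le_nhds
    have t1 : Tendsto (fun x => C.v (σ x) - x * C.u (σ x)) l (𝓝 (C.v sR - 0 * C.u sR)) :=
      ((C.cont_v.tendsto _).comp hσ).sub (hx.mul ((C.cont_u.tendsto _).comp hσ))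
    have t2 : Tendsto A l (𝓝 (A 0)) := (hAc.tendsto 0).comp hx
    have t3 : Tendsto A l (𝓝 (C.v sR - 0 * C.u sR)) := by
      refine t1.congr' ?_
      filter_upwards [hl2 hAe, near (-1) (by norm_num)] with x h1 h2 using h1 h2.2
    rw [tendsto_nhds_unique t2 t3]; ring
  -- bounds by the affine functions of the states of the arc
  have up : s₂ < sR → ∀ τ ∈ Icc s₂ sR, ∀ x ≤ 0, A x ≤ C.v τ - x * C.u τ := by
    intro hlt
    have hcl : IsClosed {τ | ∀ x ≤ 0, A x ≤ C.v τ - x * C.u τ} := by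
      have : {τ | ∀ x ≤ 0, A x ≤ C.v τ - x * C.u τ} =
          ⋂ x, ⋂ (_ : x ≤ 0), {τ | A x ≤ C.v τ - x * C.u τ} := by ext; simp
      rw [this]
      exact isClosed_iInter fun x => isClosed_iInter fun _ => isClosed_le continuous_const
        (C.cont_v.sub (continuous_const.mul C.cont_u))
    -- Only interior parameters are strictly separated from the limits of `σ`; the end points follow
    -- by closedness.
    rw [← closure_Ioo hlt.ne]
    refine fun τ hτ => closure_minimal ?_ hcl hτ
    intro τ hτ x hx
    have hτm : τ ∈ Icc 0 C.len := ⟨hs₂'.1.trans hτ.1.le, hτ.2.le.trans hsR.2⟩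
    obtain ⟨c, hc⟩ := hL₂ τ hτm hτ.1
    obtain ⟨d, hd, hd'⟩ := hR₁ τ hτm hτ.2
    have := (hT τ hτm).nonpos (c := c) hd
      (by filter_upwards [hc] with y hy h1 using Real.sign_of_neg (by linarith [hy h1]))
      (by filter_upwards [hd'] with y hy h1 h2 using Real.sign_of_pos (by linarith [hy h1 h2])) x hx
    linarith
  have down : sR < s₁ → ∀ τ ∈ Icc sR s₁, ∀ x ≤ 0, C.v τ - x * C.u τ ≤ A x := by
    intro hlt
    have hcl : IsClosed {τ | ∀ x ≤ 0, C.v τ - x * C.u τ ≤ A x} := by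
      have : {τ | ∀ x ≤ 0, C.v τ - x * C.u τ ≤ A x} =
          ⋂ x, ⋂ (_ : x ≤ 0), {τ | C.v τ - x * C.u τ ≤ A x} := by ext; simp
      rw [this]
      exact isClosed_iInter fun x => isClosed_iInter fun _ => isClosed_le
        (C.cont_v.sub (continuous_const.mul C.cont_u)) continuous_const
    rw [← closure_Ioo hlt.ne]
    refine fun τ hτ => closure_minimal ?_ hcl hτ
    intro τ hτ x hx
    have hτm : τ ∈ Icc 0 C.len := ⟨hsR.1.trans hτ.1.le, hτ.2.le.trans hs₁'.2⟩
    obtain ⟨c, hc⟩ := hL₁ τ hτm hτ.2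
    obtain ⟨d, hd, hd'⟩ := hR₂ τ hτm hτ.1
    have := (hT τ hτm).nonneg (c := c) hd
      (by filter_upwards [hc] with y hy h1 using Real.sign_of_pos (by linarith [hy h1]))
      (by filter_upwards [hd'] with y hy h1 h2 using Real.sign_of_neg (by linarith [hy h1 h2])) x hx
    linarith
  -- the solution stays in the arc
  have lower : ∀ᵐ x, x < 0 → min s₁ sR ≤ σ x := by
    have step : ∀ τ < min s₁ sR, ∀ᵐ x, x < 0 → τ ≤ σ x := by
      intro τ hτ
      rcases lt_or_ge τ 0 with h0 | h0
      · exact Eventually.of_forall fun x _ => h0.le.trans (h.mem x).1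
      have hτm : τ ∈ Icc 0 C.len := ⟨h0, (hτ.trans_le (min_le_right _ _)).le.trans hsR.2⟩
      obtain ⟨c, hc⟩ := hL₁ τ hτm (hτ.trans_le (min_le_left _ _))
      obtain ⟨d, hd, hd'⟩ := hR₁ τ hτm (hτ.trans_le (min_le_right _ _))
      have := (hT τ hτm).eq_one (c := c) hd
        (by filter_upwards [hc] with y hy h1 using Real.sign_of_pos (by linarith [hy h1]))
        (by filter_upwards [hd'] with y hy h1 h2 using Real.sign_of_pos (by linarith [hy h1 h2]))
      filter_upwards [this, hAe] with x hx hxe hx0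
      by_contra! hlt
      rcases hx hx0 with h1 | ⟨h1, h2⟩
      · rw [Real.sign_of_neg (by linarith)] at h1; norm_num at h1
      -- In the exceptional alternative density and flux both agree with those of `τ`, against
      -- injectivity.
      · have e1 : C.u (σ x) = C.u τ :=
          le_antisymm (C.mono_u (h.mem x) hτm hlt.le) (by linarith)
        have e2 := hxe hx0
        rw [e1] at e2
        exact hlt.ne (C.inj _ (h.mem x) _ hτm e1 (by linarith))
    have hn : ∀ n : ℕ, ∀ᵐ x, x < 0 → min s₁ sR - 1 / ((n:ℝ) + 1) ≤ σ x := fun n =>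
      step _ (by linarith [(by positivity : (0:ℝ) < 1 / ((n:ℝ) + 1))])
    filter_upwards [ae_all_iff.2 hn] with x hx hx0
    have t : Tendsto (fun n : ℕ => min s₁ sR - 1 / ((n:ℝ) + 1)) atTop (𝓝 (min s₁ sR - 0)) :=
      tendsto_const_nhds.sub tendsto_one_div_add_atTop_nhds_zero_nat
    have := le_of_tendsto' t fun n => hx n hx0
    linarith
  have upper : ∀ᵐ x, x < 0 → σ x ≤ max s₂ sR := by
    have step : ∀ τ > max s₂ sR, ∀ᵐ x, x < 0 → σ x ≤ τ := by
      intro τ hτ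
      rcases lt_or_ge C.len τ with h0 | h0
      · exact Eventually.of_forall fun x _ => (h.mem x).2.trans h0.le
      have hτm : τ ∈ Icc 0 C.len := ⟨hsR.1.trans ((le_max_right _ _).trans hτ.le), h0⟩
      obtain ⟨c, hc⟩ := hL₂ τ hτm ((le_max_left _ _).trans_lt hτ)
      obtain ⟨d, hd, hd'⟩ := hR₂ τ hτm ((le_max_right _ _).trans_lt hτ)
      have := (hT τ hτm).eq_neg_one (c := c) hd
        (by filter_upwards [hc] with y hy h1 using Real.sign_of_neg (by linarith [hy h1]))
        (by filter_upwards [hd'] with y hy h1 h2 using Real.sign_of_neg (by linarith [hy h1 h2]))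
      filter_upwards [this, hAe] with x hx hxe hx0
      by_contra! hlt
      rcases hx hx0 with h1 | ⟨h1, h2⟩
      · rw [Real.sign_of_pos (by linarith)] at h1; norm_num at h1
      · have e1 : C.u (σ x) = C.u τ :=
          le_antisymm (by linarith) (C.mono_u hτm (h.mem x) hlt.le)
        have e2 := hxe hx0
        rw [e1] at e2
        exact hlt.ne' (C.inj _ (h.mem x) _ hτm e1 (by linarith))
    have hn : ∀ n : ℕ, ∀ᵐ x, x < 0 → σ x ≤ max s₂ sR + 1 / ((n:ℝ) + 1) := fun n =>
      step _ (by linarith [(by positivity : (0:ℝ) < 1 / ((n:ℝ) + 1))])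
    filter_upwards [ae_all_iff.2 hn] with x hx hx0
    have t : Tendsto (fun n : ℕ => max s₂ sR + 1 / ((n:ℝ) + 1)) atTop (𝓝 (max s₂ sR + 0)) :=
      tendsto_const_nhds.add tendsto_one_div_add_atTop_nhds_zero_nat
    have := ge_of_tendsto' t fun n => hx n hx0
    linarith
  -- densities and fluxes on the interval of ambiguity
  have flat : ∀ τ ∈ Icc s₁ s₂, C.u τ = C.u s₁ ∧ C.v s₂ ≤ C.v τ ∧ C.v τ ≤ C.v s₁ ∧
      (τ ≠ s₁ → C.peak ≤ s₁) := by
    intro τ hτ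
    rcases hs with rfl | ⟨hp, hu⟩
    · obtain rfl := le_antisymm hτ.1 hτ.2
      exact ⟨rfl, le_rfl, le_rfl, fun hh => absurd rfl hh⟩
    · have hτm : τ ∈ Icc 0 C.len := ⟨hs₁.trans hτ.1, hτ.2.trans hs₂⟩
      refine ⟨le_antisymm ?_ (C.mono_u hs₁' hτm hτ.1), ?_, ?_, fun _ => hp⟩
      · rw [hu]; exact C.mono_u hτm hs₂' hτ.2
      · exact C.v_down.antitoneOn ⟨hp.trans hτ.1, hτm.2⟩ ⟨hp.trans h12, hs₂⟩ hτ.2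
      · exact C.v_down.antitoneOn ⟨hp, hs₁'.2⟩ ⟨hp.trans hτ.1, hτm.2⟩ hτ.1
  rcases lt_or_ge s₂ sR with hlt | hge
  · -- the wave runs to the right along the curve
    have up' : ∀ τ ∈ Icc s₀ sR, ∀ x ≤ 0, A x ≤ C.v τ - x * C.u τ := by
      intro τ hτ x hx
      rcases le_or_gt s₂ τ with h2 | h2
      · exact up hlt τ ⟨h2, hτ.2⟩ x hx
      · obtain ⟨f1, f2, -, -⟩ := flat τ ⟨hs₀.1.trans hτ.1, h2.le⟩
        obtain ⟨g1, -, -, -⟩ := flat s₂ ⟨h12, le_rfl⟩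
        have := up hlt s₂ ⟨le_rfl, hlt.le⟩ x hx
        rw [f1, ← g1]; linarith
    have arc : ∀ᵐ x, x < 0 → σ x ∈ Icc s₀ sR := by
      filter_upwards [lower, upper, hAe] with x h1 h2 h3 hx
      have l1 := h1 hx
      have l2 := h2 hx
      rw [max_eq_right hlt.le] at l2
      rw [min_eq_left (h12.trans hlt.le)] at l1
      refine ⟨?_, l2⟩
      -- A state before `s₂` would have the density of `s₂` and a strictly larger flux, violating
      -- the affine bound of `s₂`.
      by_contra! hlt'
      have l3 : σ x < s₂ := hlt'.trans_le hs₀.2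
      obtain ⟨f1, f2, f3, f4⟩ := flat (σ x) ⟨l1, l3.le⟩
      obtain ⟨g1, -, -, g4⟩ := flat s₂ ⟨h12, le_rfl⟩
      have hp := g4 (l1.trans_lt l3).ne'
      have b := up hlt s₂ ⟨le_rfl, hlt.le⟩ x hx.le
      rw [← h3 hx, f1, g1] at b
      have := C.v_down ⟨hp.trans l1, (h.mem x).2⟩ ⟨hp.trans h12, hs₂⟩ l3
      linarith
    refine ⟨?_, ?_⟩
    · filter_upwards [arc, hAe] with x h1 h2 hx
      refine ⟨by rw [uIcc_of_le (hs₀.2.trans hlt.le)]; exact h1 hx, fun _ τ hτ => ?_,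
        fun hh => absurd (hs₀.2.trans_lt hlt) (not_lt.2 hh)⟩
      rw [h2 hx]; exact up' τ hτ x hx.le
    · right
      rcases le_or_gt C.peak s₀ with hp | hp
      · exact ⟨hp.trans (hs₀.2.trans hlt.le), fun hh => absurd hp (not_le.2 hh)⟩
      have hlt0 : s₀ < sR := hs₀.2.trans_lt hlt
      have vb : ∀ τ ∈ Icc s₀ sR, C.v sR ≤ C.v τ := fun τ hτ => by
        have := up' τ hτ 0 le_rfl
        rw [hA0] at this; linarith
      have v0 := vb s₀ ⟨le_rfl, hlt0.le⟩
      refine ⟨?_, fun _ => lt_of_le_of_ne v0 fun heq => ?_⟩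
      · by_contra! hh
        exact absurd (C.v_up ⟨hs₀'.1, hp.le⟩ ⟨hsR.1, hh.le⟩ hlt0) (not_lt.2 v0)
      -- If `v sR = v s₀`, then `v - x u` at `σ x` is at most its value at `s₀`, although neither
      -- flux nor density is smaller than at `s₀` and `-x > 0`. This forces `σ x = s₀`, while `σ`
      -- exceeds `s₀` near `0`.
      · obtain ⟨d, hd, hd'⟩ := hR₁ s₀ hs₀' hlt0
        have hae : ∀ᵐ x, x ∉ Ioo d (0:ℝ) := by
          filter_upwards [arc, hAe, hd'] with x h1 h2 h3 hm
          have m := h1 hm.2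
          have b := up' s₀ ⟨le_rfl, hlt0.le⟩ x hm.2.le
          rw [← h2 hm.2] at b
          have b2 := vb _ m
          have b3 := C.mono_u hs₀' (h.mem x) m.1
          have b4 : C.u (σ x) = C.u s₀ := by nlinarith [hm.2]
          have := C.inj _ (h.mem x) _ hs₀' b4 (by rw [b4] at b; linarith)
          exact absurd this (h3 hm.1 hm.2).ne'
        have := measure_eq_zero_iff_ae_notMem.2 hae
        rw [Real.volume_Ioo] at this
        simp at this; linarith
  rcases lt_or_ge sR s₁ with hlt | hge'
  · -- the wave runs to the left along the curve
    have hdn : ∀ τ ∈ Icc sR s₁, C.v τ ≤ C.v sR := fun τ hτ => by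
      have := down hlt τ hτ 0 le_rfl
      rw [hA0] at this; linarith
    -- By the bounds at speed zero the trace has the largest flux of the arc, so neither end can lie
    -- before the peak.
    have hp : C.peak ≤ s₁ := by
      by_contra! hh
      exact absurd (C.v_up ⟨hsR.1, (hlt.trans hh).le⟩ ⟨hs₁, hh.le⟩ hlt)
        (not_lt.2 (hdn s₁ ⟨hlt.le, le_rfl⟩))
    have hpR : C.peak ≤ sR := by
      by_contra! hh
      exact absurd (C.v_up ⟨hsR.1, hh.le⟩ ⟨C.peak_mem.1, le_rfl⟩ hh)
        (not_lt.2 (hdn C.peak ⟨hh.le, hp⟩))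
    refine ⟨?_, Or.inr ⟨hpR, fun hh => absurd (hp.trans hs₀.1) (not_le.2 hh)⟩⟩
    filter_upwards [lower, upper, hAe] with x h1 h2 h3 hx
    have l1 := h1 hx
    have l2 := h2 hx
    rw [max_eq_left hge] at l2
    rw [min_eq_right hlt.le] at l1
    have l3 : σ x ≤ s₁ := by
      by_contra! hh
      obtain ⟨f1, -, -, -⟩ := flat (σ x) ⟨hh.le, l2⟩
      have b := down hlt s₁ ⟨hlt.le, le_rfl⟩ x hx.le
      rw [← h3 hx, f1] at b
      have := C.v_down ⟨hp, hs₁'.2⟩ ⟨hp.trans hh.le, (h.mem x).2⟩ hh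
      linarith
    refine ⟨?_, fun hh => absurd hh (not_le.2 (hlt.trans_le hs₀.1)), fun _ τ hτ => ?_⟩
    · rw [uIcc_of_ge (hlt.le.trans hs₀.1)]; exact ⟨l1, l3.trans hs₀.1⟩
    · rw [h3 hx]
      rcases le_or_gt τ s₁ with h4 | h4
      · exact down hlt τ ⟨hτ.1, h4⟩ x hx.le
      · obtain ⟨f1, -, f3, -⟩ := flat τ ⟨h4.le, hτ.2.trans hs₀.2⟩
        have b := down hlt s₁ ⟨hlt.le, le_rfl⟩ x hx.le
        rw [f1]; linarith
  · -- constant density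
    have hRm : sR ∈ Icc s₁ s₂ := ⟨hge', hge⟩
    obtain ⟨fR1, -, -, fR4⟩ := flat sR hRm
    obtain ⟨f01, -, -, f04⟩ := flat s₀ hs₀
    have arc : ∀ᵐ x, x < 0 → σ x ∈ Icc s₁ s₂ := by
      filter_upwards [lower, upper] with x h1 h2 hx
      have l1 := h1 hx
      have l2 := h2 hx
      rw [max_eq_left hge] at l2
      rw [min_eq_left hge'] at l1
      exact ⟨l1, l2⟩
    -- With constant density `A + x u` has zero derivative, so the flux equals its trace.
    have hconst : ∀ᵐ x, x < 0 → σ x = sR := by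
      filter_upwards [arc, hAe] with x h1 h2 hx
      have hq : LipschitzWith (Real.toNNReal |C.u s₁|) fun y : ℝ => y * C.u s₁ :=
        LipschitzWith.of_dist_le_mul fun y z => by
          rw [Real.dist_eq, Real.dist_eq, Real.coe_toNNReal _ (abs_nonneg _), ← abs_mul]
          apply le_of_eq; congr 1; ring
      obtain ⟨k, hk⟩ := ((hK.acOn x 0).fun_add (hq.acOn x 0)).const_of_ae_hasDerivAt_zero (by
        filter_upwards [hAd, arc, measure_eq_zero_iff_ae_notMem.1
          (Real.volume_singleton (a := 0))] with y hy hya hy0 hym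
        rw [uIcc_of_le hx.le] at hym
        have hy1 : y < 0 := lt_of_le_of_ne hym.2 (fun e => hy0 (by simp [e]))
        have : HasDerivAt (fun y : ℝ => y * C.u s₁) (C.u s₁) y := by
          simpa using (hasDerivAt_id y).mul_const (C.u s₁)
        have := hy.fun_add this
        rwa [(flat _ (hya hy1)).1, neg_add_cancel] at this)
      have k1 := hk x left_mem_uIcc
      have k2 := hk 0 right_mem_uIcc
      obtain ⟨f1, -, -, -⟩ := flat _ (h1 hx)
      have e := h2 hx
      rw [f1] at e
      exact C.inj _ (h.mem x) _ hsR (by rw [f1, fR1]) (by linarith)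
    refine ⟨?_, ?_⟩
    · filter_upwards [hconst] with x h1 hx
      rw [h1 hx]
      refine ⟨right_mem_uIcc, fun hh τ hτ => ?_, fun hh τ hτ => ?_⟩
      · obtain ⟨f1, -, -, -⟩ := flat τ ⟨hs₀.1.trans hτ.1, hτ.2.trans hge⟩
        rw [f1, fR1]
        rcases hτ.2.eq_or_lt with rfl | h5
        · exact le_rfl
        · have hp := fR4 ((hs₀.1.trans hτ.1).trans_lt h5).ne'
          have := C.v_down ⟨hp.trans (hs₀.1.trans hτ.1), hτ.2.trans hsR.2⟩ ⟨hp.trans hge', hsR.2⟩ h5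
          linarith
      · obtain ⟨f1, -, -, f4⟩ := flat τ ⟨hge'.trans hτ.1, hτ.2.trans hs₀.2⟩
        rw [f1, fR1]
        rcases hτ.1.eq_or_lt with rfl | h5
        · exact le_rfl
        · have hp := f4 (hge'.trans_lt h5).ne'
          have := C.v_down ⟨hp.trans hge', hsR.2⟩ ⟨hp.trans (hge'.trans hτ.1),
            hτ.2.trans hs₀'.2⟩ h5
          linarith
    · by_cases he : sR = s₀
      · exact Or.inl he
      · right
        have hp : C.peak ≤ s₁ := by
          by_contra hh
          have e1 : sR = s₁ := by by_contra h1; exact hh (fR4 h1)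
          have e2 : s₀ = s₁ := by by_contra h1; exact hh (f04 h1)
          exact he (e1.trans e2.symm)
        exact ⟨hp.trans hge', fun hh => absurd (hp.trans hs₀.1) (not_le.2 hh)⟩

/-- Two entropy solutions following the same wave agree. -/
theorem IsEntropic.eq_of_isHull {σ' : ℝ → ℝ} (h : C.IsEntropic (Iio 0) σ)
    (h' : C.IsEntropic (Iio 0) σ') {a b : ℝ}
    (H : ∀ᵐ x, x < 0 → C.IsHull a b x (σ x)) (H' : ∀ᵐ x, x < 0 → C.IsHull a b x (σ' x)) :
    ∀ᵐ x, x < 0 → σ x = σ' x := by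
  obtain ⟨A, ⟨K, hK⟩, hAd, hAe, -⟩ := h.exists_profile
  obtain ⟨A', ⟨K', hK'⟩, hAd', hAe', -⟩ := h'.exists_profile
  -- Both states attain the same extremum of `v - x u` over the arc, so the profiles agree; their
  -- derivatives then give equal densities, and the profiles equal fluxes.
  have hae : ∀ᵐ x, x < 0 → A x = A' x := by
    filter_upwards [H, H', hAe, hAe'] with x h1 h2 h3 h4 hx
    rw [← h3 hx, ← h4 hx]
    obtain ⟨m1, l1, r1⟩ := h1 hx
    obtain ⟨m2, l2, r2⟩ := h2 hx
    rcases le_total a b with hab | hab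
    · rw [uIcc_of_le hab] at m1 m2
      exact le_antisymm (l1 hab _ m2) (l2 hab _ m1)
    · rw [uIcc_of_ge hab] at m1 m2
      exact le_antisymm (r2 hab _ m1) (r1 hab _ m2)
  have heq : ∀ x < 0, A x = A' x := by
    have : A =ᵐ[volume.restrict (Iio 0)] A' := by
      rw [EventuallyEq, ae_restrict_iff' measurableSet_Iio]; exact hae
    have := Measure.eqOn_open_of_ae_eq this isOpen_Iio hK.continuous.continuousOn
      hK'.continuous.continuousOn
    exact fun x hx => this hx
  filter_upwards [hAd, hAd', hAe, hAe'] with x h1 h2 h3 h4 hx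
  have : HasDerivAt A (-C.u (σ' x)) x := by
    refine h2.congr_of_eventuallyEq ?_
    filter_upwards [Iio_mem_nhds hx] with y hy using heq y hy
  have e := neg_injective (h1.unique this)
  have e3 := h3 hx
  rw [heq x hx, ← h4 hx, e] at e3
  exact C.inj _ (h.mem x) _ (h'.mem x) e (by linarith)

end FluxCurve

end

noncomputable section

/-! ### Construction of waves -/

theorem setIntegral_deriv_Ioi {F : ℝ → ℝ} {c d : ℝ}
    (hF : ∀ x y, AbsolutelyContinuousOnInterval F x y) (h0 : ∀ x, x ∉ Icc c d → F x = 0) (z : ℝ) :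
    ∫ x in Ioi z, deriv F x = -F z := by
  set M := max z d + 1 with hM
  have hzM : z ≤ M := by linarith [le_max_left z d]
  have hdM : d < M := by linarith [le_max_right z d]
  have : ∫ x in Ioi z, deriv F x = ∫ x in Ioc z M, deriv F x := by
    refine setIntegral_eq_of_subset_of_forall_sdiff_eq_zero measurableSet_Ioi Ioc_subset_Ioi_self ?_
    intro x hx
    apply deriv_eq_zero_off h0
    intro hx'
    exact hx.2 ⟨hx.1, by linarith [hx'.2]⟩
  rw [this, ← intervalIntegral.integral_of_le hzM, (hF z M).integral_deriv_eq_sub, h0 M]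
  · ring
  · intro hh; linarith [hh.2]

/-- An upper set of reals is, up to a null set, empty, everything, or a half-line. Its end point, or
a point off the support, serves as `z`. The superlevel and sublevel sets of a monotone `σ` are such
sets, and only the sign of `F z` will matter. -/
theorem setIntegral_deriv_upperSet {F : ℝ → ℝ} {c d : ℝ}
    (hF : ∀ x y, AbsolutelyContinuousOnInterval F x y) (h0 : ∀ x, x ∉ Icc c d → F x = 0)
    {S : Set ℝ} (hS : IsUpperSet S) : ∃ z, ∫ x in S, deriv F x = -F z := by
  have hoff : F (max c d + 1) = 0 := h0 _ fun hh => by linarith [hh.2, le_max_right c d]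
  rcases S.eq_empty_or_nonempty with rfl | hne
  · exact ⟨max c d + 1, by simp [hoff]⟩
  by_cases hb : BddBelow S
  · refine ⟨sInf S, ?_⟩
    rw [← setIntegral_deriv_Ioi hF h0]
    apply setIntegral_congr_set
    have h1 : Ioi (sInf S) ⊆ S := fun x hx => by
      obtain ⟨y, hy, hyx⟩ := exists_lt_of_csInf_lt hne hx
      exact hS hyx.le hy
    have h2 : S ⊆ Ici (sInf S) := fun x hx => csInf_le hb hx
    refine EventuallyLE.antisymm ?_ (ae_le_set.2 (by rw [sdiff_eq_empty.2 h1]; simp))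
    exact (ae_le_set.2 (by rw [sdiff_eq_empty.2 h2]; simp) : S ≤ᵐ[volume] Ici (sInf S)).trans
      Ioi_ae_eq_Ici.symm.le
  · have : S = univ := by
      refine eq_univ_of_forall fun x => ?_
      rw [not_bddBelow_iff] at hb
      obtain ⟨y, hy, hyx⟩ := hb x
      exact hS hyx.le hy
    refine ⟨max c d + 1, ?_⟩
    rw [this, setIntegral_univ, hoff, integral_deriv_eq_zero (hF _ _) h0, neg_zero]

theorem setIntegral_deriv_lowerSet {F : ℝ → ℝ} {c d : ℝ}
    (hF : ∀ x y, AbsolutelyContinuousOnInterval F x y) (h0 : ∀ x, x ∉ Icc c d → F x = 0)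
    (hi : Integrable (deriv F)) {S : Set ℝ} (hm : MeasurableSet S) (hS : IsLowerSet S) :
    ∃ z, ∫ x in S, deriv F x = F z := by
  obtain ⟨z, hz⟩ := setIntegral_deriv_upperSet hF h0 hS.compl
  refine ⟨z, ?_⟩
  have := integral_add_compl hm hi
  rw [integral_deriv_eq_zero (hF _ _) h0, hz] at this
  linarith

namespace FluxCurve

variable {C : FluxCurve}

/-- A wave can be selected monotonically; `ε = 1` for lower and `ε = -1` for upper hulls. -/
theorem exists_selection {ε a b : ℝ} (hε : ε = 1 ∨ ε = -1)
    (ha : a ∈ Icc 0 C.len) (hb : b ∈ Icc 0 C.len) :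
    ∃ (σ A : ℝ → ℝ), (∀ x, σ x ∈ uIcc a b) ∧ (∀ x, C.v (σ x) - x * C.u (σ x) = A x) ∧
      (∀ x, ∀ τ ∈ uIcc a b, ε * A x ≤ ε * (C.v τ - x * C.u τ)) ∧
      (ε = 1 → Monotone σ) ∧ (ε = -1 → Antitone σ) ∧
      (∃ K, LipschitzWith K A) ∧ (∀ᵐ x, HasDerivAt A (-C.u (σ x)) x) := by
  have hsub : ∀ τ ∈ uIcc a b, τ ∈ Icc 0 C.len := fun τ hτ =>
    ⟨(le_min ha.1 hb.1).trans hτ.1, hτ.2.trans (max_le ha.2 hb.2)⟩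
  -- `ε A` is an infimum of affine functions of the speed, hence concave, with supergradient `-ε u`
  -- at the chosen state; `hstep` below is the supergradient inequality.
  have hex : ∀ x : ℝ, ∃ s ∈ uIcc a b, ∀ τ ∈ uIcc a b,
      ε * (C.v s - x * C.u s) ≤ ε * (C.v τ - x * C.u τ) := fun x => by
    have hc : Continuous fun τ => ε * (C.v τ - x * C.u τ) := by
      have := C.cont_u; have := C.cont_v; fun_prop
    exact isCompact_uIcc.exists_isMinOn ⟨a, left_mem_uIcc⟩ hc.continuousOn
  choose σ hσ hmin using hex
  have hmem : ∀ x, σ x ∈ Icc 0 C.len := fun x => hsub _ (hσ x)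
  set U : ℝ → ℝ := fun x => C.u (σ x) with hU
  set A : ℝ → ℝ := fun x => C.v (σ x) - x * C.u (σ x) with hA
  have hstep : ∀ x y, ε * A y ≤ ε * A x - (y - x) * (ε * U x) := fun x y => by
    have := hmin y _ (hσ x)
    simp only [hA, hU]; linarith
  have hUm : ∀ x y, x < y → ε * U x ≤ ε * U y := fun x y hxy => by
    have h1 := hstep x y
    have h2 := hstep y x
    nlinarith
  have hεsq : ε * ε = 1 := by rcases hε with rfl | rfl <;> norm_num
  -- Minimizers of equal density also have equal flux, so ties in the choice cannot destroy the
  -- monotonicity of `σ` on the vertical part.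
  have heq : ∀ x y, U x = U y → σ x = σ y := fun x y he => by
    have h1 := hmin x _ (hσ y)
    have h2 := hmin y _ (hσ x)
    refine C.inj _ (hmem x) _ (hmem y) he ?_
    simp only [hU] at he
    rw [he] at h1 h2
    have : ε * C.v (σ x) = ε * C.v (σ y) := by linarith
    have h3 : ε * (ε * C.v (σ x)) = ε * (ε * C.v (σ y)) := by rw [this]
    rwa [← mul_assoc, ← mul_assoc, hεsq, one_mul, one_mul] at h3
  have hmono : ε = 1 → Monotone σ := by
    rintro rfl x y hxy
    rcases hxy.eq_or_lt with rfl | hlt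
    · exact le_rfl
    by_contra! hh
    have h1 := C.mono_u (hmem y) (hmem x) hh.le
    have h2 := hUm x y hlt
    simp only [hU, one_mul] at h2
    exact hh.ne (heq y x (le_antisymm h1 h2))
  have hanti : ε = -1 → Antitone σ := by
    rintro rfl x y hxy
    rcases hxy.eq_or_lt with rfl | hlt
    · exact le_rfl
    by_contra! hh
    have h1 := C.mono_u (hmem x) (hmem y) hh.le
    have h2 := hUm x y hlt
    simp only [hU] at h2
    exact hh.ne (heq x y (le_antisymm h1 (by linarith)))
  obtain ⟨B, hB⟩ := C.bdd_u
  have habs : ∀ x, |ε * U x| ≤ B := fun x => by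
    have := hB _ (hmem x)
    rcases hε with rfl | rfl <;> simpa [hU] using this
  have hdiff : ∀ x y, |A y - A x| = |ε * A y - ε * A x| := fun x y => by
    rcases hε with rfl | rfl
    · simp
    · rw [abs_sub_comm]; congr 1; ring
  have hB0 : 0 ≤ B := (abs_nonneg _).trans (habs 0)
  refine ⟨σ, A, hσ, fun x => rfl, fun x τ hτ => hmin x τ hτ, hmono, hanti,
    ⟨Real.toNNReal B, LipschitzWith.of_dist_le_mul fun x y => ?_⟩, ?_⟩
  · rw [Real.coe_toNNReal _ hB0, Real.dist_eq, Real.dist_eq, hdiff]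
    have h1 := hstep x y
    have h2 := hstep y x
    have b1 := (abs_mul (y - x) (ε * U x)).le.trans
      (mul_le_mul_of_nonneg_left (habs x) (abs_nonneg (y - x)))
    have b2 := (abs_mul (x - y) (ε * U y)).le.trans
      (mul_le_mul_of_nonneg_left (habs y) (abs_nonneg (x - y)))
    rw [abs_sub_comm y x] at b1
    rw [abs_le]
    constructor <;> nlinarith [abs_le.1 b1, abs_le.1 b2]
  -- The supergradient inequalities at `x` and `y` give differentiability wherever the monotone
  -- function `ε U` is continuous.
  · have hcount : {x | ¬ContinuousAt (fun x => ε * U x) x}.Countable := by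
      refine Monotone.countable_not_continuousAt fun x y hxy => ?_
      rcases hxy.eq_or_lt with rfl | hlt
      · exact le_rfl
      · exact hUm x y hlt
    filter_upwards [measure_eq_zero_iff_ae_notMem.1 (hcount.measure_zero volume)] with x hx
    have hc : ContinuousAt (fun x => ε * U x) x := by simpa using hx
    rw [hasDerivAt_iff_isLittleO, Asymptotics.isLittleO_iff]
    intro r hr
    filter_upwards [Metric.continuousAt_iff'.1 hc r hr] with y hy
    rw [Real.dist_eq] at hy
    have e : |A y - A x - (y - x) • -U x| = |ε * A y - ε * A x + (y - x) * (ε * U x)| := by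
      rcases hε with rfl | rfl
      · congr 1; simp only [smul_eq_mul]; ring
      · rw [← abs_neg]; congr 1; simp only [smul_eq_mul]; ring
    rw [Real.norm_eq_abs, Real.norm_eq_abs, e]
    have h1 := hstep x y
    have h2 := hstep y x
    have h3 : |(y - x) * (ε * U y - ε * U x)| ≤ r * |y - x| := by
      rw [abs_mul, mul_comm]; gcongr
    rw [abs_le]
    constructor <;> nlinarith [abs_le.1 h3]

/-- Existence of a wave of negative speed from `a` to `b`. -/
theorem InCond.exists_wave {a b : ℝ} (h : C.InCond a b) (ha : a ∈ Icc 0 C.len)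
    (hb : b ∈ Icc 0 C.len) :
    ∃ σ : ℝ → ℝ, C.IsEntropic (Iio 0) σ ∧
      (Monotone (fun x => C.u (σ x)) ∨ Antitone fun x => C.u (σ x)) ∧
      Tendsto (fun x => C.v (σ x)) (𝓝[<] 0) (𝓝 (C.v b)) ∧
      Tendsto (fun x => C.u (σ x)) atBot (𝓝 (C.u a)) ∧
      (a ≤ b → (∀ τ ∈ Icc a b, C.u τ = C.u a → C.v a ≤ C.v τ) →
        Tendsto (fun x => C.v (σ x)) atBot (𝓝 (C.v a))) := by
  have hsub : ∀ τ ∈ uIcc a b, τ ∈ Icc 0 C.len := fun τ hτ =>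
    ⟨(le_min ha.1 hb.1).trans hτ.1, hτ.2.trans (max_le ha.2 hb.2)⟩
  obtain ⟨ε, hε, hε1, hε2⟩ : ∃ ε : ℝ, (ε = 1 ∨ ε = -1) ∧ (ε = 1 → a ≤ b) ∧ (ε = -1 → b ≤ a) := by
    rcases le_total a b with hab | hab
    · exact ⟨1, Or.inl rfl, fun _ => hab, by norm_num⟩
    · exact ⟨-1, Or.inr rfl, by norm_num, fun _ => hab⟩
  obtain ⟨σ, A, hσ, hA, hmin, hmono, hanti, ⟨K, hK⟩, hAd⟩ := C.exists_selection hε ha hb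
  have hmem : ∀ x, σ x ∈ Icc 0 C.len := fun x => hsub _ (hσ x)
  obtain ⟨Bu, hBu⟩ := C.bdd_u
  obtain ⟨Bv, hBv⟩ := C.bdd_v
  have hmeas : Measurable σ := by
    rcases hε with e | e
    · exact (hmono e).measurable
    · exact (hanti e).measurable
  -- `b` minimizes `ε v` on the arc, `a` minimizes `ε u`
  have hvb : ∀ τ ∈ uIcc a b, ε * C.v b ≤ ε * C.v τ := by
    intro τ hτ
    rcases hε with e | e
    · have hab := hε1 e
      rw [uIcc_of_le hab] at hτ
      rw [e, one_mul, one_mul]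
      rcases hτ.2.eq_or_lt with h2 | h2
      · rw [h2]
      · exact (h.lt_v ha.1 hb.2 ⟨hτ.1, h2⟩).le
    · have hab := hε2 e
      rw [uIcc_of_ge hab] at hτ
      rw [e]
      rcases hτ.1.eq_or_lt with h2 | h2
      · rw [h2]
      · linarith [h.v_lt ha.2 ⟨h2, hτ.2⟩]
  have hua : ∀ τ ∈ uIcc a b, ε * C.u a ≤ ε * C.u τ := by
    intro τ hτ
    have hτm := hsub τ hτ
    rcases hε with e | e
    · rw [uIcc_of_le (hε1 e)] at hτ
      rw [e, one_mul, one_mul]; exact C.mono_u ha hτm hτ.1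
    · rw [uIcc_of_ge (hε2 e)] at hτ
      rw [e]; linarith [C.mono_u hτm ha hτ.2]
  have habs : ∀ y : ℝ, |ε * y| = |y| := fun y => by rcases hε with rfl | rfl <;> simp
  -- Comparing with the state `a` in the minimum yields `|x| |u (σ x) - u a| ≤ 2 Bv`.
  have hut : Tendsto (fun x => C.u (σ x)) atBot (𝓝 (C.u a)) := by
    have t : Tendsto (fun x : ℝ => (2 * Bv) / (-x)) atBot (𝓝 0) :=
      tendsto_const_nhds.div_atTop tendsto_neg_atBot_atTop
    refine tendsto_iff_dist_tendsto_zero.2 (squeeze_zero' (Eventually.of_forall fun x =>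
      dist_nonneg) ?_ t)
    filter_upwards [Iio_mem_atBot 0] with x hx
    have hx : x < 0 := hx
    rw [Real.dist_eq, ← habs, mul_sub, abs_of_nonneg (by linarith [hua _ (hσ x)]),
      le_div_iff₀ (by linarith)]
    have h1 := hmin x a left_mem_uIcc
    rw [← hA x] at h1
    have h2 := (habs (C.v (σ x))).le.trans (hBv _ (hmem x))
    have h3 := (habs (C.v a)).le.trans (hBv _ ha)
    nlinarith [abs_le.1 h2, abs_le.1 h3]
  refine ⟨σ, ⟨hmeas, hmem, ?_⟩, ?_, ?_, hut, ?_⟩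
  · intro τ hτ Φ hΦ
    set F : ℝ → ℝ := fun x => (A x - (C.v τ - x * C.u τ)) * Φ x with hF
    obtain ⟨c, d, hcd⟩ : ∃ c d, ∀ x, x ∉ Icc c d → Φ x = 0 := by
      obtain ⟨r, hr⟩ := hΦ.compact.isCompact.isBounded.subset_closedBall (0:ℝ)
      refine ⟨-r, r, fun x hx => ?_⟩
      by_contra hne
      have := hr (subset_tsupport _ hne)
      rw [Real.closedBall_eq_Icc] at this
      exact hx ⟨by linarith [this.1], by linarith [this.2]⟩
    obtain ⟨KΦ, hKΦ⟩ := hΦ.contDiff.lipschitzWith_of_hasCompactSupport hΦ.compact one_ne_zero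
    have hqL : ∃ K, LipschitzWith K fun x => C.v τ - x * C.u τ :=
      ⟨Real.toNNReal |C.u τ|, LipschitzWith.of_dist_le_mul fun x y => by
        rw [Real.dist_eq, Real.dist_eq, Real.coe_toNNReal _ (abs_nonneg _), abs_sub_comm x y,
          ← abs_mul]
        apply le_of_eq; congr 1; ring⟩
    obtain ⟨Kq, hKq⟩ := hqL
    have hFL := (hK.sub hKq)
    have hFac : ∀ x y, AbsolutelyContinuousOnInterval F x y := fun x y =>
      (hFL.acOn x y).fun_mul (hKΦ.acOn x y)
    have hF0 : ∀ x, x ∉ Icc c d → F x = 0 := fun x hx => by simp [hF, hcd x hx]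
    have hFd : ∀ᵐ x, deriv F x = (C.v (σ x) - C.v τ - x * (C.u (σ x) - C.u τ)) * deriv Φ x
        - (C.u (σ x) - C.u τ) * Φ x := by
      filter_upwards [hAd] with x hx
      have h1 : HasDerivAt (fun x => C.v τ - x * C.u τ) (-C.u τ) x := by
        simpa using ((hasDerivAt_id x).mul_const (C.u τ)).const_sub (C.v τ)
      have h2 : DifferentiableAt ℝ Φ x := hΦ.contDiff.differentiable one_ne_zero x
      rw [((hx.fun_sub h1).fun_mul h2.hasDerivAt).deriv, ← hA x]; ring
    have hFi : Integrable (deriv F) := by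
      obtain ⟨L, hL⟩ := lipschitz_mul_of_supp (hKΦ) hFL hcd
      refine integrable_of_bdd_off (C := L) (measurable_deriv F).aestronglyMeasurable
        (deriv_eq_zero_off hF0) fun x _ => ?_
      have hL' : LipschitzWith L F := by
        convert hL using 2 with x
        exact mul_comm _ _
      exact norm_deriv_le_of_lipschitz hL'
    -- The level sets of the monotone `σ` are half-lines, so each integral of `F'` is a boundary
    -- value of `F` up to sign, and minimality of the profile fixes the sign of `ε F` for `τ` on the
    -- arc.
    have e1 : ∫ x, (Real.sign (σ x - τ) * (C.v (σ x) - C.v τ - x * (C.u (σ x) - C.u τ)) * deriv Φ x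
        - Real.sign (σ x - τ) * (C.u (σ x) - C.u τ) * Φ x) =
        (∫ x in {x | τ < σ x}, deriv F x) - ∫ x in {x | σ x < τ}, deriv F x := by
      have m1 : MeasurableSet {x | τ < σ x} := measurableSet_lt measurable_const hmeas
      have m2 : MeasurableSet {x | σ x < τ} := measurableSet_lt hmeas measurable_const
      rw [← integral_indicator m1, ← integral_indicator m2,
        ← integral_sub (hFi.indicator m1) (hFi.indicator m2)]
      refine integral_congr_ae ?_
      filter_upwards [hFd] with x hx
      rcases lt_trichotomy (σ x) τ with h1 | h1 | h1
      · rw [Real.sign_of_neg (by linarith), indicator_of_notMem (by simpa using h1.le),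
          indicator_of_mem (by simpa using h1), hx]; ring
      · rw [h1]; simp [h1]
      · rw [Real.sign_of_pos (by linarith), indicator_of_mem (by simpa using h1),
          indicator_of_notMem (by simpa using h1.le), hx]; ring
    rw [e1]
    have hFsign : τ ∈ uIcc a b → ∀ x, ε * F x ≤ 0 := fun hτ' x => by
      have := hmin x τ hτ'
      have h2 := hΦ.nonneg x
      have : ε * (A x - (C.v τ - x * C.u τ)) ≤ 0 := by linarith
      simp only [hF]
      rw [← mul_assoc]
      exact mul_nonpos_of_nonpos_of_nonneg this h2
    have m1 : MeasurableSet {x | τ < σ x} := measurableSet_lt measurable_const hmeas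
    have m2 : MeasurableSet {x | σ x < τ} := measurableSet_lt hmeas measurable_const
    by_cases hτ' : τ ∈ uIcc a b
    · rcases hε with e | e
      · have hm := hmono e
        obtain ⟨z, hz⟩ := setIntegral_deriv_upperSet hFac hF0 (S := {x | τ < σ x})
          fun x y hxy hx => lt_of_lt_of_le hx (hm hxy)
        obtain ⟨z', hz'⟩ := setIntegral_deriv_lowerSet hFac hF0 hFi m2
          fun x y hxy hx => lt_of_le_of_lt (hm hxy) hx
        rw [hz, hz']
        have f1 := hFsign hτ' z
        have f2 := hFsign hτ' z'
        rw [e] at f1 f2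
        linarith
      · have hm := hanti e
        obtain ⟨z, hz⟩ := setIntegral_deriv_lowerSet hFac hF0 hFi m1
          fun x y hxy hx => lt_of_lt_of_le hx (hm hxy)
        obtain ⟨z', hz'⟩ := setIntegral_deriv_upperSet hFac hF0 (S := {x | σ x < τ})
          fun x y hxy hx => lt_of_le_of_lt (hm hxy) hx
        rw [hz, hz']
        have f1 := hFsign hτ' z
        have f2 := hFsign hτ' z'
        rw [e] at f1 f2
        linarith
    -- For `τ` off the arc the sign is constant, and the entropy inequality is an equality.
    · have htot := integral_deriv_eq_zero (hFac _ _) hF0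
      have hτ'' : τ < min a b ∨ max a b < τ := by
        by_contra! hh
        exact hτ' ⟨hh.1, hh.2⟩
      rcases hτ'' with h1 | h1
      · have s1 : {x | τ < σ x} = univ := eq_univ_of_forall fun x => h1.trans_le (hσ x).1
        have s2 : {x | σ x < τ} = ∅ := eq_empty_of_forall_notMem fun x hx =>
          absurd (hσ x).1 (not_le.2 (lt_trans hx h1))
        rw [s1, s2]; simp [htot]
      · have s1 : {x | σ x < τ} = univ := eq_univ_of_forall fun x => (hσ x).2.trans_lt h1
        have s2 : {x | τ < σ x} = ∅ := eq_empty_of_forall_notMem fun x hx =>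
          absurd (hσ x).2 (not_le.2 (lt_trans h1 hx))
        rw [s1, s2]; simp [htot]
  · rcases hε with e | e
    · exact Or.inl fun x y hxy => C.mono_u (hmem x) (hmem y) (hmono e hxy)
    · exact Or.inr fun x y hxy => C.mono_u (hmem y) (hmem x) (hanti e hxy)
  -- Comparing with the state `b` in the minimum yields `|v (σ x) - v b| ≤ 2 Bu |x|`.
  · have t : Tendsto (fun x : ℝ => -x * (2 * Bu)) (𝓝[<] 0) (𝓝 0) := by
      have : Tendsto (fun x : ℝ => -x * (2 * Bu)) (𝓝 0) (𝓝 (-0 * (2 * Bu))) :=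
        (tendsto_id.neg).mul_const _
      rw [neg_zero, zero_mul] at this
      exact this.mono_left nhdsWithin_le_nhds
    refine tendsto_iff_dist_tendsto_zero.2 (squeeze_zero' (Eventually.of_forall fun x =>
      dist_nonneg) ?_ t)
    filter_upwards [self_mem_nhdsWithin] with x hx
    have hx : x < 0 := hx
    rw [Real.dist_eq, ← habs, mul_sub, abs_of_nonneg (by linarith [hvb _ (hσ x)])]
    have h1 := hmin x b right_mem_uIcc
    rw [← hA x] at h1
    have h2 := (habs (C.u (σ x))).le.trans (hBu _ (hmem x))
    have h3 := (habs (C.u b)).le.trans (hBu _ hb)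
    nlinarith [abs_le.1 h2, abs_le.1 h3]
  · intro hab hflat
    by_cases hba : a = b
    · have : ∀ x, σ x = a := fun x => by
        have := hσ x
        rw [← hba, uIcc_self] at this
        exact this
      simp only [this]
      exact tendsto_const_nhds
    have e : ε = 1 := by
      rcases hε with e | e
      · exact e
      · exact absurd (le_antisymm hab (hε2 e)) hba
    rw [uIcc_of_le hab] at hσ hmin hua
    have hle : ∀ᶠ x in atBot, C.v (σ x) ≤ C.v a := by
      filter_upwards [Iio_mem_atBot 0] with x hx
      have hx : x < 0 := hx
      have h1 := hmin x a ⟨le_rfl, hab⟩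
      have h2 := hua _ (hσ x)
      rw [← hA x, e, one_mul, one_mul] at h1
      rw [e, one_mul, one_mul] at h2
      nlinarith
    rw [tendsto_order]
    constructor
    · intro r hr
      -- States of flux at most `r < v a` form a compact set on which, by `hflat`, the density stays
      -- above `u a`; but the density of `σ` tends to `u a`.
      set S := Icc a b ∩ {τ | C.v τ ≤ r} with hS
      have hSc : IsCompact S := isCompact_Icc.inter_right (isClosed_le C.cont_v continuous_const)
      rcases S.eq_empty_or_nonempty with h0 | h0
      · refine Eventually.of_forall fun x => ?_
        by_contra! hh
        have : σ x ∈ S := ⟨hσ x, hh⟩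
        rw [h0] at this; exact this
      · obtain ⟨τ, hτ, hτmin⟩ := hSc.exists_isMinOn h0 C.cont_u.continuousOn
        have hlt : C.u a < C.u τ := by
          refine lt_of_le_of_ne (C.mono_u ha (hsub τ (by rw [uIcc_of_le hab]; exact hτ.1)) hτ.1.1) ?_
          intro he
          have h1 := hflat τ hτ.1 he.symm
          have h2 : C.v τ ≤ r := hτ.2
          linarith
        filter_upwards [hut.eventually (gt_mem_nhds hlt)] with x hx
        by_contra! hh
        exact absurd (hτmin ⟨hσ x, hh⟩) (not_le.2 hx)
    · intro r hr
      filter_upwards [hle] with x hx using hx.trans_lt hr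

end FluxCurve

end

noncomputable section

/-! ### Self-similar change of variables -/

namespace IsTest

variable {φ : ℝ → ℝ → ℝ}

theorem hasFDerivAt (h : IsTest φ) (x t : ℝ) :
    HasFDerivAt (fun p : ℝ × ℝ => φ p.1 p.2) (fderiv ℝ (fun p : ℝ × ℝ => φ p.1 p.2) (x, t)) (x, t) :=
  (h.1.differentiable one_ne_zero (x, t)).hasFDerivAt

theorem dx_eq (h : IsTest φ) (x t : ℝ) :
    dx φ x t = fderiv ℝ (fun p : ℝ × ℝ => φ p.1 p.2) (x, t) (1, 0) := by
  have h1 : HasDerivAt (fun y : ℝ => (y, t)) ((1:ℝ), (0:ℝ)) x :=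
    (hasDerivAt_id x).prodMk (hasDerivAt_const x t)
  exact ((h.hasFDerivAt x t).comp_hasDerivAt x h1).deriv

theorem dt_eq (h : IsTest φ) (x t : ℝ) :
    dt φ x t = fderiv ℝ (fun p : ℝ × ℝ => φ p.1 p.2) (x, t) (0, 1) := by
  have h1 : HasDerivAt (fun s : ℝ => (x, s)) ((0:ℝ), (1:ℝ)) t :=
    (hasDerivAt_const t x).prodMk (hasDerivAt_id t)
  exact ((h.hasFDerivAt x t).comp_hasDerivAt t h1).deriv

theorem chain (h : IsTest φ) {a b : ℝ → ℝ} {a' b' s : ℝ} (ha : HasDerivAt a a' s)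
    (hb : HasDerivAt b b' s) :
    HasDerivAt (fun s => φ (a s) (b s)) (a' * dx φ (a s) (b s) + b' * dt φ (a s) (b s)) s := by
  have := (h.hasFDerivAt (a s) (b s)).comp_hasDerivAt s (ha.prodMk hb)
  refine this.congr_deriv ?_
  rw [h.dx_eq, h.dt_eq]
  have e : (a', b') = a' • ((1:ℝ), (0:ℝ)) + b' • ((0:ℝ), (1:ℝ)) := by ext <;> simp
  rw [e, map_add, map_smul, map_smul, smul_eq_mul, smul_eq_mul]

theorem continuous (h : IsTest φ) : Continuous fun p : ℝ × ℝ => φ p.1 p.2 := h.1.continuous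

theorem continuous_dx (h : IsTest φ) : Continuous fun p : ℝ × ℝ => dx φ p.1 p.2 := by
  simp_rw [h.dx_eq]
  exact (h.1.continuous_fderiv one_ne_zero).clm_apply continuous_const

theorem continuous_dt (h : IsTest φ) : Continuous fun p : ℝ × ℝ => dt φ p.1 p.2 := by
  simp_rw [h.dt_eq]
  exact (h.1.continuous_fderiv one_ne_zero).clm_apply continuous_const

theorem exists_bound (h : IsTest φ) : ∃ M > 0, ∃ B ≥ 0,
    (∀ x t, M < |x| ∨ M < |t| → φ x t = 0 ∧ dx φ x t = 0 ∧ dt φ x t = 0) ∧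
    ∀ x t, |φ x t| ≤ B ∧ |dx φ x t| ≤ B ∧ |dt φ x t| ≤ B := by
  obtain ⟨r, hr⟩ := h.2.isCompact.isBounded.subset_closedBall (0 : ℝ × ℝ)
  set M := max r 1 with hM
  have hM0 : 0 < M := lt_of_lt_of_le one_pos (le_max_right _ _)
  have hout : ∀ x t, M < |x| ∨ M < |t| → (x, t) ∉ tsupport fun p : ℝ × ℝ => φ p.1 p.2 := by
    intro x t hxt hm
    have := hr hm
    rw [mem_closedBall_zero_iff, Prod.norm_def] at this
    have h1 : |x| ≤ r := (le_max_left _ _).trans this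
    have h2 : |t| ≤ r := (le_max_right _ _).trans this
    rcases hxt with h3 | h3 <;> linarith [le_max_left r 1]
  have hz : ∀ x t, M < |x| ∨ M < |t| → φ x t = 0 ∧ dx φ x t = 0 ∧ dt φ x t = 0 := by
    intro x t hxt
    have h0 := hout x t hxt
    refine ⟨image_eq_zero_of_notMem_tsupport (f := fun p : ℝ × ℝ => φ p.1 p.2) h0, ?_, ?_⟩
    · rw [h.dx_eq, fderiv_of_notMem_tsupport (𝕜 := ℝ) h0]; rfl
    · rw [h.dt_eq, fderiv_of_notMem_tsupport (𝕜 := ℝ) h0]; rfl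
  have hb : ∀ f : ℝ × ℝ → ℝ, Continuous f → (∀ x t, M < |x| ∨ M < |t| → f (x, t) = 0) →
      ∃ B ≥ 0, ∀ x t, |f (x, t)| ≤ B := by
    intro f hf hf0
    obtain ⟨B, hB⟩ := (isCompact_closedBall (0 : ℝ × ℝ) M).exists_bound_of_continuousOn
      hf.continuousOn
    refine ⟨max B 0, le_max_right _ _, fun x t => ?_⟩
    by_cases hx : (x, t) ∈ Metric.closedBall (0 : ℝ × ℝ) M
    · exact (hB _ hx).trans (le_max_left _ _)
    · rw [hf0 x t, abs_zero]
      · exact le_max_right _ _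
      · by_contra! hh
        apply hx
        rw [mem_closedBall_zero_iff, Prod.norm_def]
        exact max_le hh.1 hh.2
  obtain ⟨B1, p1, q1⟩ := hb _ h.continuous fun x t hh => (hz x t hh).1
  obtain ⟨B2, p2, q2⟩ := hb _ h.continuous_dx fun x t hh => (hz x t hh).2.1
  obtain ⟨B3, p3, q3⟩ := hb _ h.continuous_dt fun x t hh => (hz x t hh).2.2
  refine ⟨M, hM0, B1 + B2 + B3, by positivity, hz, fun x t => ⟨?_, ?_, ?_⟩⟩
  · linarith [q1 x t]
  · linarith [q2 x t]
  · linarith [q3 x t]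

end IsTest

/-- The integral of a test function along the ray of speed `ξ`. -/
def rayInt (φ : ℝ → ℝ → ℝ) (ξ : ℝ) : ℝ := ∫ t in Ioi (0:ℝ), φ (ξ * t) t

theorem setIntegral_Ioi_eq {f : ℝ → ℝ} {M : ℝ} (hM : 0 ≤ M) (h0 : ∀ t, M < t → f t = 0) :
    ∫ t in Ioi (0:ℝ), f t = ∫ t in (0:ℝ)..M, f t := by
  rw [intervalIntegral.integral_of_le hM]
  refine setIntegral_eq_of_subset_of_forall_sdiff_eq_zero measurableSet_Ioi Ioc_subset_Ioi_self ?_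
  intro x hx
  apply h0
  by_contra! hh
  exact hx.2 ⟨hx.1, hh⟩

theorem IsTest.hasDerivAt_rayInt {φ : ℝ → ℝ → ℝ} (h : IsTest φ) (ξ : ℝ) :
    HasDerivAt (rayInt φ) (∫ t in Ioi (0:ℝ), t * dx φ (ξ * t) t) ξ := by
  obtain ⟨M, hM, B, hB, hz, hb⟩ := h.exists_bound
  have hlt : ∀ t, M < t → M < |t| := fun t ht => ht.trans_le (le_abs_self t)
  have e : rayInt φ = fun ξ => ∫ t in (0:ℝ)..M, φ (ξ * t) t := by
    ext ξ
    exact setIntegral_Ioi_eq hM.le fun t ht => (hz _ t (Or.inr (hlt t ht))).1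
  rw [e, setIntegral_Ioi_eq hM.le fun t ht => by rw [(hz _ t (Or.inr (hlt t ht))).2.1, mul_zero]]
  have c1 : ∀ ξ : ℝ, Continuous fun t : ℝ => φ (ξ * t) t := fun ξ =>
    h.continuous.comp ((continuous_const.mul continuous_id).prodMk continuous_id)
  have c2 : ∀ ξ : ℝ, Continuous fun t : ℝ => t * dx φ (ξ * t) t := fun ξ =>
    continuous_id.mul
      (h.continuous_dx.comp ((continuous_const.mul continuous_id).prodMk continuous_id))
  refine (intervalIntegral.hasDerivAt_integral_of_dominated_loc_of_deriv_le
    (F := fun ξ t => φ (ξ * t) t) (F' := fun ξ t => t * dx φ (ξ * t) t) (s := univ)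
    (bound := fun _ => M * B) univ_mem
    (Eventually.of_forall fun ξ => (c1 ξ).aestronglyMeasurable) ((c1 ξ).intervalIntegrable _ _)
    (c2 ξ).aestronglyMeasurable (Eventually.of_forall fun t ht x _ => ?_) (by simp)
    (Eventually.of_forall fun t _ x _ => ?_)).2
  · rw [uIoc_of_le hM.le] at ht
    rw [Real.norm_eq_abs, abs_mul, abs_of_pos ht.1]
    exact mul_le_mul ht.2 (hb _ _).2.1 (abs_nonneg _) hM.le
  · have h1 : HasDerivAt (fun x : ℝ => x * t) t x := by
      simpa using (hasDerivAt_id x).mul_const t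
    exact (h.chain h1 (hasDerivAt_const x t)).congr_deriv (by ring)

theorem IsTest.contDiff_rayInt {φ : ℝ → ℝ → ℝ} (h : IsTest φ) : ContDiff ℝ 1 (rayInt φ) := by
  rw [contDiff_one_iff_deriv]
  refine ⟨fun ξ => (h.hasDerivAt_rayInt ξ).differentiableAt, ?_⟩
  obtain ⟨M, hM, B, hB, hz, hb⟩ := h.exists_bound
  have e : deriv (rayInt φ) = fun ξ => ∫ t in (0:ℝ)..M, t * dx φ (ξ * t) t := by
    ext ξ
    rw [(h.hasDerivAt_rayInt ξ).deriv]
    exact setIntegral_Ioi_eq hM.le fun t ht => by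
      rw [(hz _ t (Or.inr (ht.trans_le (le_abs_self t)))).2.1, mul_zero]
  rw [e]
  refine intervalIntegral.continuous_parametric_intervalIntegral_of_continuous' ?_ _ _
  exact continuous_snd.mul
    (h.continuous_dx.comp ((continuous_fst.mul continuous_snd).prodMk continuous_snd))

/-- Integration by parts along a ray. -/
theorem IsTest.ray_parts {φ : ℝ → ℝ → ℝ} (h : IsTest φ) (E Q ξ : ℝ) :
    ∫ t in Ioi (0:ℝ), t * (E * dt φ (ξ * t) t + Q * dx φ (ξ * t) t) =
      (Q - ξ * E) * deriv (rayInt φ) ξ - E * rayInt φ ξ := by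
  obtain ⟨M, hM, B, hB, hz, hb⟩ := h.exists_bound
  have hz' : ∀ x t, M < t → φ x t = 0 ∧ dx φ x t = 0 ∧ dt φ x t = 0 := fun x t ht =>
    hz x t (Or.inr (ht.trans_le (le_abs_self t)))
  have cφ : Continuous fun t : ℝ => φ (ξ * t) t :=
    h.continuous.comp ((continuous_const.mul continuous_id).prodMk continuous_id)
  have cx : Continuous fun t : ℝ => dx φ (ξ * t) t :=
    h.continuous_dx.comp ((continuous_const.mul continuous_id).prodMk continuous_id)
  have ct : Continuous fun t : ℝ => dt φ (ξ * t) t :=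
    h.continuous_dt.comp ((continuous_const.mul continuous_id).prodMk continuous_id)
  have c1 : Continuous fun t : ℝ => φ (ξ * t) t + t * (ξ * dx φ (ξ * t) t + 1 * dt φ (ξ * t) t) :=
    cφ.add (continuous_id.mul ((continuous_const.mul cx).add (continuous_const.mul ct)))
  have c2 : Continuous fun t : ℝ => (Q - ξ * E) * (t * dx φ (ξ * t) t) :=
    continuous_const.mul (continuous_id.mul cx)
  have c3 : Continuous fun t : ℝ => E * φ (ξ * t) t := continuous_const.mul cφ
  have c4 : Continuous fun t : ℝ =>
      E * (φ (ξ * t) t + t * (ξ * dx φ (ξ * t) t + 1 * dt φ (ξ * t) t)) := continuous_const.mul c1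
  have c5 : Continuous fun t : ℝ => (Q - ξ * E) * (t * dx φ (ξ * t) t) - E * φ (ξ * t) t :=
    c2.sub c3
  set N := M + 1 with hN
  have hMN : M < N := by rw [hN]; linarith
  have hN0 : 0 ≤ N := by linarith
  rw [(h.hasDerivAt_rayInt ξ).deriv, rayInt,
    setIntegral_Ioi_eq hN0 fun t ht => by
      rw [(hz' _ t (hMN.trans ht)).2.1, (hz' _ t (hMN.trans ht)).2.2]; simp,
    setIntegral_Ioi_eq hN0 fun t ht => by rw [(hz' _ t (hMN.trans ht)).2.1, mul_zero],
    setIntegral_Ioi_eq hN0 fun t ht => (hz' _ t (hMN.trans ht)).1]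
  -- The integrand is the derivative of `t φ(ξ t, t)`, which vanishes at `0` and, beyond the
  -- support, at `N`.
  have ftc : ∫ t in (0:ℝ)..N, (φ (ξ * t) t + t * (ξ * dx φ (ξ * t) t + 1 * dt φ (ξ * t) t))
      = N * φ (ξ * N) N - 0 * φ (ξ * 0) 0 := by
    refine intervalIntegral.integral_eq_sub_of_hasDerivAt (f := fun t => t * φ (ξ * t) t)
      (fun t _ => ?_) (c1.intervalIntegrable _ _)
    have h1 : HasDerivAt (fun t : ℝ => ξ * t) ξ t := by
      simpa using (hasDerivAt_id t).const_mul ξ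
    exact ((hasDerivAt_id t).fun_mul (h.chain h1 (hasDerivAt_id t))).congr_deriv (by simp)
  rw [(hz' _ N hMN).1] at ftc
  have i1 : ∀ f : ℝ → ℝ, Continuous f → IntervalIntegrable f volume 0 N := fun f hf =>
    hf.intervalIntegrable _ _
  have e1 : ∫ t in (0:ℝ)..N, t * (E * dt φ (ξ * t) t + Q * dx φ (ξ * t) t) =
      ∫ t in (0:ℝ)..N, (E * (φ (ξ * t) t + t * (ξ * dx φ (ξ * t) t + 1 * dt φ (ξ * t) t))
        + ((Q - ξ * E) * (t * dx φ (ξ * t) t) - E * φ (ξ * t) t)) := by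
    congr 1; ext t; ring
  rw [e1, intervalIntegral.integral_add (i1 _ c4) (i1 _ c5),
    intervalIntegral.integral_sub (i1 _ c2) (i1 _ c3),
    intervalIntegral.integral_const_mul, intervalIntegral.integral_const_mul,
    intervalIntegral.integral_const_mul, ftc]
  ring

/-! ### Integrals and null sets on cones -/

/-- The two open half-lines. -/
structure IsCone (R : Set ℝ) : Prop where
  meas : MeasurableSet R
  mul_mem : ∀ {c x : ℝ}, 0 < c → (x * c ∈ R ↔ x ∈ R)

theorem isCone_Iio : IsCone (Iio 0) :=
  ⟨measurableSet_Iio, fun {c x} hc => by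
    simp only [mem_Iio]
    exact ⟨fun h => by by_contra! hx; exact absurd h (not_lt.2 (mul_nonneg hx hc.le)),
      fun h => mul_neg_of_neg_of_pos h hc⟩⟩

theorem isCone_Ioi : IsCone (Ioi 0) :=
  ⟨measurableSet_Ioi, fun {c x} hc => by
    simp only [mem_Ioi]
    exact ⟨fun h => by
      by_contra! hx; exact absurd h (not_lt.2 (mul_nonpos_of_nonpos_of_nonneg hx hc.le)),
      fun h => mul_pos h hc⟩⟩

theorem IsCone.div_mem {R : Set ℝ} (hR : IsCone R) {x t : ℝ} (ht : 0 < t) :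
    x / t ∈ R ↔ x ∈ R := by
  rw [div_eq_mul_inv]; exact hR.mul_mem (inv_pos.2 ht)

theorem IsCone.setIntegral_scale {R : Set ℝ} (hR : IsCone R) {t : ℝ} (ht : 0 < t) (f : ℝ → ℝ) :
    ∫ x in R, f x = ∫ ξ in R, t * f (ξ * t) := by
  rw [← integral_indicator hR.meas, ← integral_indicator hR.meas]
  have h1 := Measure.integral_comp_mul_right (R.indicator f) t
  have h2 : (fun ξ => R.indicator f (ξ * t)) = R.indicator fun ξ => f (ξ * t) := by
    ext ξ
    by_cases hξ : ξ ∈ R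
    · rw [indicator_of_mem hξ, indicator_of_mem ((hR.mul_mem ht).2 hξ)]
    · rw [indicator_of_notMem hξ, indicator_of_notMem (fun hh => hξ ((hR.mul_mem ht).1 hh))]
  rw [h2, abs_of_pos (inv_pos.2 ht), smul_eq_mul] at h1
  have h3 : (R.indicator fun ξ => t * f (ξ * t)) = fun ξ => t * R.indicator (fun ξ => f (ξ * t)) ξ := by
    ext ξ
    by_cases hξ : ξ ∈ R
    · rw [indicator_of_mem hξ, indicator_of_mem hξ]
    · rw [indicator_of_notMem hξ, indicator_of_notMem hξ, mul_zero]
  rw [h3, integral_const_mul, h1, ← mul_assoc, mul_inv_cancel₀ ht.ne', one_mul]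

/-- The self-similar change of variables for the weak formulation. -/
theorem IsTest.integral_cone {φ : ℝ → ℝ → ℝ} (h : IsTest φ) {R : Set ℝ} (hR : IsCone R)
    {E Q : ℝ → ℝ} {K : ℝ} (hE : Measurable E) (hQ : Measurable Q) (bE : ∀ x, |E x| ≤ K)
    (bQ : ∀ x, |Q x| ≤ K) :
    IntegrableOn (fun ξ => (Q ξ - ξ * E ξ) * deriv (rayInt φ) ξ - E ξ * rayInt φ ξ) R ∧
    ∫ p in R ×ˢ Ioi (0:ℝ), (E (p.1 / p.2) * dt φ p.1 p.2 + Q (p.1 / p.2) * dx φ p.1 p.2) =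
      ∫ ξ in R, ((Q ξ - ξ * E ξ) * deriv (rayInt φ) ξ - E ξ * rayInt φ ξ) := by
  obtain ⟨M, hM, B, hB, hz, hb⟩ := h.exists_bound
  have hK : 0 ≤ K := (abs_nonneg _).trans (bE 0)
  set G : ℝ × ℝ → ℝ := fun p => E (p.1 / p.2) * dt φ p.1 p.2 + Q (p.1 / p.2) * dx φ p.1 p.2 with hG
  have mdiv : Measurable fun p : ℝ × ℝ => p.1 / p.2 := measurable_fst.div measurable_snd
  have mG : Measurable G := ((hE.comp mdiv).mul h.continuous_dt.measurable).add
    ((hQ.comp mdiv).mul h.continuous_dx.measurable)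
  have bG : ∀ p, |G p| ≤ K * B + K * B := fun p => by
    refine (abs_add_le _ _).trans ?_
    rw [abs_mul, abs_mul]
    have := (hb p.1 p.2).2.1
    have := (hb p.1 p.2).2.2
    have := bE (p.1 / p.2)
    have := bQ (p.1 / p.2)
    gcongr
  have iG : Integrable G := by
    rw [← integrableOn_iff_integrable_of_support_subset (s := Icc (-M) M ×ˢ Icc (-M) M)]
    · refine Measure.integrableOn_of_bounded (M := K * B + K * B) ?_ mG.aestronglyMeasurable
        (Eventually.of_forall bG)
      exact (isCompact_Icc.prod isCompact_Icc).measure_lt_top.ne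
    · intro p hp
      by_contra hh
      apply hp
      have : M < |p.1| ∨ M < |p.2| := by
        by_contra! h2
        exact hh ⟨abs_le.1 h2.1, abs_le.1 h2.2⟩
      obtain ⟨-, h1, h2⟩ := hz _ _ this
      simp [hG, h1, h2]
  set μ := volume.restrict R with hμ
  set ν := volume.restrict (Ioi (0:ℝ)) with hν
  have hprod : (volume.restrict (R ×ˢ Ioi (0:ℝ)) : Measure (ℝ × ℝ)) = μ.prod ν := by
    rw [hμ, hν, Measure.prod_restrict]; rfl
  have iG' : Integrable G (μ.prod ν) := by rw [← hprod]; exact iG.restrict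
  -- The substitution `x = ξ t` at fixed `t` contributes the Jacobian `t` that appears in
  -- `IsTest.ray_parts`.
  set f : ℝ → ℝ → ℝ := fun t ξ => t * G (ξ * t, t) with hf
  have mf : Measurable (Function.uncurry f) := by
    refine measurable_fst.mul (mG.comp ?_)
    exact (measurable_snd.mul measurable_fst).prodMk measurable_fst
  have scale : ∀ t, 0 < t → ∀ g : ℝ → ℝ, ∫ x in R, g x = ∫ ξ in R, t * g (ξ * t) :=
    fun t ht g => hR.setIntegral_scale ht g
  have hfi : Integrable (Function.uncurry f) (ν.prod μ) := by
    rw [integrable_prod_iff mf.aestronglyMeasurable]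
    have hsw := iG'.swap
    rw [integrable_prod_iff (mG.comp measurable_swap).aestronglyMeasurable] at hsw
    constructor
    · filter_upwards [ae_restrict_mem measurableSet_Ioi] with t ht
      have ht : 0 < t := ht
      refine Integrable.const_mul ?_ t
      have i2 : Integrable fun x => G (x, t) := by
        refine integrable_of_bdd_off (a := -M) (b := M) (C := K * B + K * B)
          (mG.comp (measurable_id.prodMk measurable_const)).aestronglyMeasurable (fun x hx => ?_)
          fun x _ => bG _
        have : M < |x| := by
          by_contra! h2
          exact hx (abs_le.1 h2)
        obtain ⟨-, h1, h2⟩ := hz x t (Or.inl this)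
        simp [hG, h1, h2]
      exact ((integrable_comp_mul_right_iff (fun x => G (x, t)) ht.ne').2 i2).restrict
    · refine hsw.2.congr ?_
      filter_upwards [ae_restrict_mem measurableSet_Ioi] with t ht
      have ht : 0 < t := ht
      rw [hμ]
      simp only [Function.uncurry_apply_pair, hf, norm_mul]
      rw [scale t ht, Real.norm_of_nonneg ht.le]
      rfl
  have hinner : ∀ᵐ ξ ∂μ, ∫ t, f t ξ ∂ν = (Q ξ - ξ * E ξ) * deriv (rayInt φ) ξ - E ξ * rayInt φ ξ := by
    refine Eventually.of_forall fun ξ => ?_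
    rw [← h.ray_parts (E ξ) (Q ξ) ξ, hν]
    refine setIntegral_congr_fun measurableSet_Ioi fun t ht => ?_
    have ht : 0 < t := ht
    simp only [hf, hG]
    rw [mul_div_assoc, div_self ht.ne', mul_one]
  constructor
  · have := hfi.integral_prod_right
    exact this.congr (by
      filter_upwards [hinner] with ξ hξ using hξ)
  · rw [hprod, integral_prod_symm _ iG']
    have : ∫ t, ∫ x, G (x, t) ∂μ ∂ν = ∫ t, ∫ ξ, f t ξ ∂μ ∂ν := by
      refine integral_congr_ae ?_
      filter_upwards [ae_restrict_mem measurableSet_Ioi] with t ht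
      exact scale t ht fun x => G (x, t)
    rw [this, integral_integral_swap hfi]
    exact integral_congr_ae hinner

/-- A property of almost every speed holds almost everywhere on the road. -/
theorem IsCone.ae_prod {R : Set ℝ} (hR : IsCone R) {P : ℝ → Prop} (h : ∀ᵐ ξ, ξ ∈ R → P ξ) :
    ∀ᵐ p : ℝ × ℝ ∂(volume.restrict (R ×ˢ Ioi 0)), P (p.1 / p.2) := by
  obtain ⟨N, hN, hNm, hN0⟩ := exists_measurable_superset_of_null (mem_ae_iff.1 h)
  have mdiv : Measurable fun p : ℝ × ℝ => p.1 / p.2 := measurable_fst.div measurable_snd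
  have key : ∀ᵐ p : ℝ × ℝ ∂(volume.restrict (R ×ˢ Ioi 0)), p.1 / p.2 ∉ N := by
    have hprod : (volume.restrict (R ×ˢ Ioi (0:ℝ)) : Measure (ℝ × ℝ)) =
        (volume.restrict R).prod (volume.restrict (Ioi 0)) := by
      rw [Measure.prod_restrict]; rfl
    have h1 : ∀ᵐ q : ℝ × ℝ ∂((volume.restrict (Ioi 0)).prod (volume.restrict R)), q.2 / q.1 ∉ N := by
      have hms : MeasurableSet {q : ℝ × ℝ | q.2 / q.1 ∉ N} :=
        (measurable_snd.div measurable_fst) hNm.compl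
      rw [Measure.ae_prod_iff_ae_ae hms]
      filter_upwards [ae_restrict_mem measurableSet_Ioi] with t ht
      have ht : 0 < t := ht
      apply ae_restrict_of_ae
      have := Real.volume_preimage_mul_right (inv_ne_zero ht.ne') N
      rw [hN0, mul_zero] at this
      exact measure_eq_zero_iff_ae_notMem.1 this
    rw [hprod, ← Measure.prod_swap]
    exact (ae_map_iff measurable_swap.aemeasurable (mdiv hNm.compl)).2 h1
  filter_upwards [key, ae_restrict_mem (hR.meas.prod measurableSet_Ioi)] with p h1 h2
  by_contra h3
  refine h1 (hN ?_)
  intro h4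
  exact h3 (h4 ((hR.div_mem h2.2).2 h2.1))

/-- Fubini, together with the fact that `ξ ↦ ξ t` preserves null sets and the cone. -/
theorem IsCone.ae_of_ae_prod {R : Set ℝ} (hR : IsCone R) {P : ℝ × ℝ → Prop}
    (h : ∀ᵐ p : ℝ × ℝ ∂(volume.restrict (R ×ˢ Ioi 0)), P p) :
    ∀ᵐ t ∂(volume.restrict (Ioi (0:ℝ))), ∀ᵐ ξ, ξ ∈ R → P (ξ * t, t) := by
  have hprod : (volume.restrict (R ×ˢ Ioi (0:ℝ)) : Measure (ℝ × ℝ)) =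
      (volume.restrict R).prod (volume.restrict (Ioi 0)) := by
    rw [Measure.prod_restrict]; rfl
  rw [hprod, ← Measure.prod_swap] at h
  have h1 := Measure.ae_ae_of_ae_prod (ae_of_ae_map measurable_swap.aemeasurable h)
  filter_upwards [h1, ae_restrict_mem measurableSet_Ioi] with t ht ht0
  have ht0 : 0 < t := ht0
  rw [ae_restrict_iff' hR.meas] at ht
  have := Real.volume_preimage_mul_right ht0.ne' {x | ¬(x ∈ R → P (x, t))}
  have hnull : volume {x | ¬(x ∈ R → P (x, t))} = 0 := mem_ae_iff.1 ht
  rw [hnull, mul_zero] at this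
  filter_upwards [measure_eq_zero_iff_ae_notMem.1 this] with ξ hξ hξR
  by_contra h2
  exact hξ fun h3 => h2 (h3 ((hR.mul_mem ht0).2 hξR))

end

noncomputable section

/-! ### Entropy inequalities and the weak formulation on a road -/

/-- The parameter function represents the solution only almost everywhere, so its limits are taken
along filters such as `atBot ⊓ ae volume`; the comparison principles need them in the form with an
explicit bound. -/
theorem exists_ae_of_atBot {p : ℝ → Prop} (h : ∀ᶠ x in atBot ⊓ ae volume, p x) :
    ∃ c, ∀ᵐ x, x < c → p x := by
  obtain ⟨s, hs, t, ht, hst⟩ := mem_inf_iff_superset.1 h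
  obtain ⟨c, hc⟩ := mem_atBot_sets.1 hs
  refine ⟨c, ?_⟩
  filter_upwards [ht] with x hx hxc
  exact hst ⟨hc x hxc.le, hx⟩

theorem exists_ae_of_left {p : ℝ → Prop} (h : ∀ᶠ x in 𝓝[<] 0 ⊓ ae volume, p x) :
    ∃ d < 0, ∀ᵐ x, d < x → x < 0 → p x := by
  obtain ⟨s, hs, t, ht, hst⟩ := mem_inf_iff_superset.1 h
  obtain ⟨d, hd, hc⟩ := mem_nhdsLT_iff_exists_Ioo_subset.1 hs
  refine ⟨d, hd, ?_⟩
  filter_upwards [ht] with x hx h1 h2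
  exact hst ⟨hc ⟨h1, h2⟩, hx⟩

theorem neBot_atBot_ae : (atBot ⊓ ae (volume : Measure ℝ)).NeBot := by
  rw [inf_neBot_iff]
  intro s hs t ht
  obtain ⟨c, hc⟩ := mem_atBot_sets.1 hs
  by_contra hne
  rw [not_nonempty_iff_eq_empty] at hne
  have : volume (Iic c) = 0 := by
    refine measure_mono_null (t := tᶜ) (fun x hx => ?_) (mem_ae_iff.1 ht)
    intro hxt
    have : x ∈ s ∩ t := ⟨hc x hx, hxt⟩
    rw [hne] at this; exact this
  simp at this

theorem le_of_ae_le {f : ℝ → ℝ} (hf : Continuous f) {c r : ℝ} (h : ∀ᵐ x, x < c → f x ≤ r) :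
    ∀ x < c, f x ≤ r := by
  by_contra! hh
  obtain ⟨x, hx, hfx⟩ := hh
  have ho : IsOpen (Iio c ∩ {x | r < f x}) := isOpen_Iio.inter (isOpen_lt continuous_const hf)
  have hpos := ho.measure_pos volume ⟨x, hx, hfx⟩
  refine hpos.ne' (measure_mono_null (fun y hy => ?_) (mem_ae_iff.1 h))
  intro h1
  exact absurd (h1 hy.1) (not_le.2 hy.2)

/-- The mass of a test function along steep rays. -/
theorem IsTest.tendsto_rayInt {φ : ℝ → ℝ → ℝ} (h : IsTest φ) :
    Tendsto (fun x => -x * rayInt φ x) atBot (𝓝 (∫ x in Iio (0:ℝ), φ x 0)) := by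
  obtain ⟨M, hM, B, hB, hz, hb⟩ := h.exists_bound
  have e0 : ∫ x in Iio (0:ℝ), φ x 0 = ∫ τ in Ioi (0:ℝ), φ (-τ) 0 := by
    rw [integral_comp_neg_Ioi (c := 0) (f := fun x => φ x 0), neg_zero, integral_Iic_eq_integral_Iio]
  -- With `τ = -x t` the ray is parametrized by its distance from the junction, at time `τ / (-x)`;
  -- as `x → -∞` it flattens onto the initial line.
  have e1 : ∀ x < 0, -x * rayInt φ x = ∫ τ in Ioi (0:ℝ), φ (-τ) (τ / (-x)) := by
    intro x hx
    have hs : 0 < -x := by linarith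
    have := integral_comp_mul_left_Ioi (fun τ => φ (-τ) (τ / (-x))) 0 hs
    rw [mul_zero, smul_eq_mul] at this
    have e2 : rayInt φ x = ∫ t in Ioi (0:ℝ), φ (-(-x * t)) (-x * t / (-x)) := by
      unfold rayInt
      congr 1; ext t
      rw [mul_div_cancel_left₀ _ hs.ne']; congr 1; ring
    rw [e2, this, ← mul_assoc, mul_inv_cancel₀ hs.ne', one_mul]
  rw [e0]
  have : Tendsto (fun x => ∫ τ in Ioi (0:ℝ), φ (-τ) (τ / (-x))) atBot
      (𝓝 (∫ τ in Ioi (0:ℝ), φ (-τ) 0)) := by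
    refine tendsto_integral_filter_of_dominated_convergence
      (fun τ => (Icc 0 M).indicator (fun _ => B) τ) ?_ ?_ ?_ ?_
    · refine Eventually.of_forall fun x => ?_
      exact (h.continuous.comp (continuous_neg.prodMk (continuous_id.div_const _))).aestronglyMeasurable
    · refine Eventually.of_forall fun x => ?_
      filter_upwards [ae_restrict_mem measurableSet_Ioi] with τ hτ
      have hτ : 0 < τ := hτ
      rcases le_or_gt τ M with h1 | h1
      · rw [indicator_of_mem (show τ ∈ Icc 0 M from ⟨hτ.le, h1⟩)]; exact (hb _ _).1
      · rw [(hz (-τ) _ (Or.inl (by rw [abs_neg, abs_of_pos hτ]; exact h1))).1, norm_zero]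
        exact indicator_nonneg (fun _ _ => hB) _
    · exact ((integrable_indicator_iff measurableSet_Icc).2
        (integrableOn_const (by simp))).restrict
    · refine Eventually.of_forall fun τ => ?_
      have t1 : Tendsto (fun x : ℝ => τ / (-x)) atBot (𝓝 0) :=
        tendsto_const_nhds.div_atTop tendsto_neg_atBot_atTop
      exact (h.continuous.tendsto (-τ, 0)).comp (tendsto_const_nhds.prodMk_nhds t1)
  refine this.congr' ?_
  filter_upwards [Iio_mem_atBot 0] with x hx
  exact (e1 x hx).symm

/-- A test function with support in the open road gives a smooth bump in the speed. -/
theorem IsTest.isSmoothBump_rayInt {φ : ℝ → ℝ → ℝ} (h : IsTest φ) (h0 : ∀ x t, 0 ≤ φ x t)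
    {R : Set ℝ} (hR : IsCone R)
    (hs : tsupport (fun p : ℝ × ℝ => φ p.1 p.2) ⊆ R ×ˢ Ioi 0) : IsSmoothBump R (rayInt φ) := by
  set T := tsupport (fun p : ℝ × ℝ => φ p.1 p.2) with hT
  have hTc : IsCompact T := h.2.isCompact
  set S := (fun p : ℝ × ℝ => p.1 / p.2) '' T with hS
  have hSc : IsCompact S := by
    refine hTc.image_of_continuousOn (continuousOn_fst.div continuousOn_snd fun p hp => ?_)
    exact (hs hp).2.ne'
  have hSR : S ⊆ R := by
    rintro _ ⟨p, hp, rfl⟩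
    exact (hR.div_mem (hs hp).2).2 (hs hp).1
  have hoff : ∀ ξ, ξ ∉ S → rayInt φ ξ = 0 := by
    intro ξ hξ
    unfold rayInt
    rw [setIntegral_congr_fun (g := fun _ => 0) measurableSet_Ioi]
    · simp
    · intro t ht
      have ht : 0 < t := ht
      have : (ξ * t, t) ∉ T := fun hm => hξ ⟨_, hm, by
        simp only; rw [mul_div_assoc, div_self ht.ne', mul_one]⟩
      exact image_eq_zero_of_notMem_tsupport (f := fun p : ℝ × ℝ => φ p.1 p.2) this
  have hts : tsupport (rayInt φ) ⊆ S := by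
    refine closure_minimal ?_ hSc.isClosed
    intro x hx; by_contra hx'; exact hx (hoff x hx')
  exact ⟨h.contDiff_rayInt, HasCompactSupport.intro hSc hoff, hts.trans hSR,
    fun ξ => integral_nonneg fun t => h0 _ _⟩

/-- A smooth bump in the speed is obtained from a test function on the open road. -/
theorem IsSmoothBump.exists_test {R : Set ℝ} {Φ : ℝ → ℝ} (h : IsSmoothBump R Φ) (hR : IsCone R) :
    ∃ φ, IsTest φ ∧ (∀ x t, 0 ≤ φ x t) ∧ tsupport (fun p : ℝ × ℝ => φ p.1 p.2) ⊆ R ×ˢ Ioi 0 ∧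
      ∃ c > 0, ∀ ξ, rayInt φ ξ = c * Φ ξ := by
  -- With `ρ` supported in `[1, 3]`, the product `Φ (x / t) ρ t` stays away from the singular time
  -- `0`, and its ray integral is `Φ` times `∫ ρ > 0`.
  let ρ : ContDiffBump (2:ℝ) := ⟨1/2, 1, by norm_num, by norm_num⟩
  have hρ0 : ∀ t, t ∉ Icc (1:ℝ) 3 → ρ t = 0 := by
    intro t ht
    apply ρ.zero_of_le_dist
    show (1:ℝ) ≤ dist t 2
    rw [Real.dist_eq]
    by_contra! hh
    rw [abs_lt] at hh
    exact ht ⟨by linarith [hh.1], by linarith [hh.2]⟩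
  set φ : ℝ → ℝ → ℝ := fun x t => Φ (x / t) * ρ t with hφ
  set S := (fun p : ℝ × ℝ => (p.1 * p.2, p.2)) '' (tsupport Φ ×ˢ Icc 1 3) with hS
  have hSc : IsCompact S := (h.compact.isCompact.prod isCompact_Icc).image (by fun_prop)
  have hSR : S ⊆ R ×ˢ Ioi 0 := by
    rintro _ ⟨⟨x, t⟩, ⟨hx, ht⟩, rfl⟩
    have ht0 : 0 < t := by linarith [ht.1]
    exact ⟨(hR.mul_mem ht0).2 (h.subset hx), ht0⟩
  have hoff : ∀ p : ℝ × ℝ, p ∉ S → φ p.1 p.2 = 0 := by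
    rintro ⟨x, t⟩ hp
    simp only [hφ]
    by_cases ht : t ∈ Icc (1:ℝ) 3
    · have ht0 : t ≠ 0 := by linarith [ht.1]
      have : x / t ∉ tsupport Φ := fun hm => hp ⟨(x / t, t), ⟨hm, ht⟩, by
        simp only; rw [div_mul_cancel₀ _ ht0]⟩
      rw [image_eq_zero_of_notMem_tsupport this, zero_mul]
    · rw [hρ0 t ht, mul_zero]
  have hts : tsupport (fun p : ℝ × ℝ => φ p.1 p.2) ⊆ S := by
    refine closure_minimal ?_ hSc.isClosed
    intro x hx; by_contra hx'; exact hx (hoff x hx')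
  have hρi : Continuous ρ := ρ.continuous
  refine ⟨φ, ⟨?_, HasCompactSupport.intro hSc hoff⟩, fun x t => mul_nonneg (h.nonneg _) ρ.nonneg,
    hts.trans hSR, ∫ t, ρ t, ρ.integral_pos, fun ξ => ?_⟩
  · rw [contDiff_iff_contDiffAt]
    rintro ⟨x, t⟩
    rcases lt_or_ge t 1 with ht | ht
    · have : (fun p : ℝ × ℝ => φ p.1 p.2) =ᶠ[𝓝 (x, t)] fun _ => 0 := by
        filter_upwards [(isOpen_Iio.preimage continuous_snd).mem_nhds
          (show (x, t) ∈ Prod.snd ⁻¹' Iio (1:ℝ) from ht)] with p hp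
        have hp : p.2 < 1 := hp
        simp only [hφ]
        rw [hρ0 p.2 fun hh => by linarith [hh.1], mul_zero]
      exact contDiffAt_const.congr_of_eventuallyEq this
    · have ht0 : t ≠ 0 := by linarith
      refine ContDiffAt.mul ?_ (ρ.contDiff.contDiffAt.comp (x, t) contDiffAt_snd)
      exact h.contDiff.contDiffAt.comp (x, t) (contDiffAt_fst.div contDiffAt_snd ht0)
  · unfold rayInt
    rw [mul_comm, ← integral_const_mul]
    have : ∫ t, Φ ξ * ρ t = ∫ t in Ioi (0:ℝ), Φ ξ * ρ t := by
      rw [setIntegral_eq_integral_of_forall_compl_eq_zero]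
      intro t ht
      rw [hρ0 t fun hh => ht (show (0:ℝ) < t by linarith [hh.1]), mul_zero]
    rw [this]
    refine setIntegral_congr_fun measurableSet_Ioi fun t ht => ?_
    have ht : 0 < t := ht
    simp only [hφ]
    rw [mul_div_assoc, div_self ht.ne', mul_one]

theorem IsSmoothBump.eq_zero {R : Set ℝ} {Φ : ℝ → ℝ} (h : IsSmoothBump R Φ) {x : ℝ} (hx : x ∉ R) :
    Φ x = 0 ∧ deriv Φ x = 0 := by
  have hx' : x ∉ tsupport Φ := fun hm => hx (h.subset hm)
  refine ⟨image_eq_zero_of_notMem_tsupport hx', ?_⟩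
  by_contra hd
  exact hx' (support_deriv_subset hd)

namespace FluxCurve

variable {C : FluxCurve} {σ : ℝ → ℝ}

theorem bdd_pair (C : FluxCurve) :
    ∃ K, ∀ s ∈ Icc 0 C.len, |C.u s| ≤ K ∧ |C.v s| ≤ K := by
  obtain ⟨B, hB⟩ := C.bdd_u
  obtain ⟨B', hB'⟩ := C.bdd_v
  exact ⟨max B B', fun s hs => ⟨(hB s hs).trans (le_max_left _ _), (hB' s hs).trans (le_max_right _ _)⟩⟩

/-- The entropy inequality in space and time, as an integral over the speed. -/
theorem entropy_integral_eq (hσ : Measurable σ) (hm : ∀ x, σ x ∈ Icc 0 C.len) {R : Set ℝ}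
    (hR : IsCone R) {τ : ℝ} {φ : ℝ → ℝ → ℝ} (h : IsTest φ) {c : ℝ} {Φ : ℝ → ℝ}
    (hΦ : IsSmoothBump R Φ) (hc : ∀ ξ, rayInt φ ξ = c * Φ ξ) :
    ∫ p in R ×ˢ Ioi (0:ℝ),
      (Real.sign (σ (p.1 / p.2) - τ) * (C.u (σ (p.1 / p.2)) - C.u τ) * dt φ p.1 p.2 +
        Real.sign (σ (p.1 / p.2) - τ) * (C.v (σ (p.1 / p.2)) - C.v τ) * dx φ p.1 p.2) =
    c * ∫ x, (Real.sign (σ x - τ) * (C.v (σ x) - C.v τ - x * (C.u (σ x) - C.u τ)) * deriv Φ x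
      - Real.sign (σ x - τ) * (C.u (σ x) - C.u τ) * Φ x) := by
  obtain ⟨K, hK⟩ := C.bdd_pair
  have hK0 : 0 ≤ K := (abs_nonneg _).trans (hK _ (hm 0)).1
  have mS : Measurable fun x => Real.sign (σ x - τ) := measurable_sign.comp (hσ.sub_const τ)
  have mU : Measurable fun x => C.u (σ x) := C.cont_u.measurable.comp hσ
  have mV : Measurable fun x => C.v (σ x) := C.cont_v.measurable.comp hσ
  have b1 : ∀ y z s : ℝ, |y| ≤ K → |Real.sign s * (y - z)| ≤ K + |C.u τ| + |C.v τ| + |z| := by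
    intro y z s hy
    rw [abs_mul]
    have h1 := abs_sign_le s
    have h2 := abs_sub y z
    have := abs_nonneg (C.u τ)
    have := abs_nonneg (C.v τ)
    calc |Real.sign s| * |y - z| ≤ 1 * |y - z| := by gcongr
      _ ≤ _ := by linarith
  have := (h.integral_cone hR (E := fun x => Real.sign (σ x - τ) * (C.u (σ x) - C.u τ))
    (Q := fun x => Real.sign (σ x - τ) * (C.v (σ x) - C.v τ))
    (K := K + |C.u τ| + |C.v τ| + (|C.u τ| + |C.v τ|))
    (mS.mul (mU.sub_const _)) (mS.mul (mV.sub_const _))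
    (fun x => (b1 _ _ _ (hK _ (hm x)).1).trans (by linarith [abs_nonneg (C.v τ)]))
    (fun x => (b1 _ _ _ (hK _ (hm x)).2).trans (by linarith [abs_nonneg (C.u τ)]))).2
  rw [this, ← integral_const_mul]
  have hd : ∀ ξ, deriv (rayInt φ) ξ = c * deriv Φ ξ := fun ξ => by
    have e : rayInt φ = fun ξ => c * Φ ξ := funext hc
    rw [e, deriv_const_mul _ (hΦ.contDiff.differentiable one_ne_zero ξ)]
  rw [setIntegral_eq_integral_of_forall_compl_eq_zero]
  · congr 1; ext x
    rw [hd, hc]; ring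
  · intro x hx
    rw [hd, hc, (hΦ.eq_zero hx).1, (hΦ.eq_zero hx).2]; simp

theorem IsEntropic.test_nonneg {R : Set ℝ} (h : C.IsEntropic R σ) (hR : IsCone R) {τ : ℝ}
    (hτ : τ ∈ Icc 0 C.len) {φ : ℝ → ℝ → ℝ} (hφ : IsTest φ) (h0 : ∀ x t, 0 ≤ φ x t)
    (hs : tsupport (fun p : ℝ × ℝ => φ p.1 p.2) ⊆ R ×ˢ Ioi 0) :
    0 ≤ ∫ p in R ×ˢ Ioi (0:ℝ),
      (Real.sign (σ (p.1 / p.2) - τ) * (C.u (σ (p.1 / p.2)) - C.u τ) * dt φ p.1 p.2 +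
        Real.sign (σ (p.1 / p.2) - τ) * (C.v (σ (p.1 / p.2)) - C.v τ) * dx φ p.1 p.2) := by
  have hb := hφ.isSmoothBump_rayInt h0 hR hs
  rw [entropy_integral_eq h.meas h.mem hR hφ (c := 1) hb (by simp), one_mul]
  exact h.ineq τ hτ _ hb

/-- Every smooth bump in the speed is, up to a positive factor, the ray integral of a test function
on the road, so nothing is lost in passing to one variable. -/
theorem isEntropic_of_test {R : Set ℝ} (hR : IsCone R) (hσ : Measurable σ)
    (hm : ∀ x, σ x ∈ Icc 0 C.len)
    (H : ∀ τ ∈ Icc 0 C.len, ∀ φ : ℝ → ℝ → ℝ, IsTest φ → (∀ x t, 0 ≤ φ x t) →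
      tsupport (fun p : ℝ × ℝ => φ p.1 p.2) ⊆ R ×ˢ Ioi 0 →
      0 ≤ ∫ p in R ×ˢ Ioi (0:ℝ),
        (Real.sign (σ (p.1 / p.2) - τ) * (C.u (σ (p.1 / p.2)) - C.u τ) * dt φ p.1 p.2 +
        Real.sign (σ (p.1 / p.2) - τ) * (C.v (σ (p.1 / p.2)) - C.v τ) * dx φ p.1 p.2)) :
    C.IsEntropic R σ := by
  refine ⟨hσ, hm, fun τ hτ Φ hΦ => ?_⟩
  obtain ⟨φ, hφ, h0, hs, c, hc, hcΦ⟩ := hΦ.exists_test hR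
  have := H τ hτ φ hφ h0 hs
  rw [entropy_integral_eq hσ hm hR hφ hΦ hcΦ] at this
  exact nonneg_of_mul_nonneg_right this hc

/-- The balance on an incoming road. -/
theorem IsEntropic.weak_identity (h : C.IsEntropic (Iio 0) σ) {u₀ γ : ℝ}
    (hu : Tendsto (fun x => C.u (σ x)) (atBot ⊓ ae volume) (𝓝 u₀))
    (hγ : Tendsto (fun x => C.v (σ x)) (𝓝[<] 0 ⊓ ae volume) (𝓝 γ))
    {φ : ℝ → ℝ → ℝ} (hφ : IsTest φ) :
    ∫ p in Iio (0:ℝ) ×ˢ Ioi (0:ℝ),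
      (C.u (σ (p.1 / p.2)) * dt φ p.1 p.2 + C.v (σ (p.1 / p.2)) * dx φ p.1 p.2) =
    γ * (∫ t in Ioi (0:ℝ), φ 0 t) - u₀ * ∫ x in Iio (0:ℝ), φ x 0 := by
  obtain ⟨A, ⟨K, hK⟩, hAd, hAe, -⟩ := h.exists_profile
  have hAc := hK.continuous
  obtain ⟨B, hB⟩ := C.bdd_pair
  have mU : Measurable fun x => C.u (σ x) := C.cont_u.measurable.comp h.meas
  have mV : Measurable fun x => C.v (σ x) := C.cont_v.measurable.comp h.meas
  obtain ⟨hi, he⟩ := hφ.integral_cone isCone_Iio mU mV (fun x => (hB _ (h.mem x)).1)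
    (fun x => (hB _ (h.mem x)).2)
  rw [he]
  have hA0 : A 0 = γ := by
    have := neBot_ae_left
    set l := 𝓝[<] (0:ℝ) ⊓ ae volume with hl
    have hl1 : l ≤ 𝓝[<] 0 := inf_le_left
    have hl2 : l ≤ ae volume := inf_le_right
    have hx : Tendsto (fun x : ℝ => x) l (𝓝 0) := hl1.trans nhdsWithin_le_nhds
    have t1 : Tendsto (fun x => x * C.u (σ x)) l (𝓝 0) := by
      have t2 : Tendsto (fun x : ℝ => |x| * B) l (𝓝 0) := by
        simpa using (hx.abs).mul_const B
      refine squeeze_zero_norm (fun x => ?_) t2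
      rw [norm_mul, Real.norm_eq_abs, Real.norm_eq_abs]
      have := (hB _ (h.mem x)).1
      gcongr
    have t3 : Tendsto A l (𝓝 (γ - 0)) := by
      refine (hγ.sub t1).congr' ?_
      filter_upwards [hl2 hAe, hl1 self_mem_nhdsWithin] with x h1 h2 using h1 h2
    rw [tendsto_nhds_unique ((hAc.tendsto 0).comp hx) t3, sub_zero]
  set Φ := rayInt φ with hΦ
  have hΦC : ContDiff ℝ 1 Φ := hφ.contDiff_rayInt
  have hcong : (fun ξ => (C.v (σ ξ) - ξ * C.u (σ ξ)) * deriv Φ ξ - C.u (σ ξ) * Φ ξ)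
      =ᵐ[volume.restrict (Iio 0)] fun ξ => A ξ * deriv Φ ξ - C.u (σ ξ) * Φ ξ := by
    rw [EventuallyEq, ae_restrict_iff' measurableSet_Iio]
    filter_upwards [hAe] with x hx h0
    rw [hx h0]
  rw [integral_congr_ae hcong]
  have hi2 : IntegrableOn (fun ξ => A ξ * deriv Φ ξ - C.u (σ ξ) * Φ ξ) (Iic 0) := by
    rw [integrableOn_Iic_iff_integrableOn_Iio]
    exact hi.congr hcong
  rw [← integral_Iic_eq_integral_Iio]
  have hlim := intervalIntegral_tendsto_integral_Iic 0 hi2 (tendsto_id (α := ℝ) (x := atBot))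
  have hval : ∀ x : ℝ, ∫ ξ in x..0, (A ξ * deriv Φ ξ - C.u (σ ξ) * Φ ξ) = A 0 * Φ 0 - A x * Φ x := by
    intro x
    rw [← ((hK.acOn x 0).fun_mul
      hΦC.contDiffOn.absolutelyContinuousOnInterval).integral_deriv_eq_sub]
    refine intervalIntegral.integral_congr_ae ?_
    filter_upwards [hAd] with y hy _
    rw [(hy.fun_mul (hΦC.differentiable one_ne_zero y).hasDerivAt).deriv]; ring
  -- Off a null set `A x + x u₀ = v - x (u - u₀)` is `o(|x|)`; continuity of `A` removes the
  -- exceptional set. The boundary term at `-∞` then produces the initial data.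
  have hquot : Tendsto (fun x => A x / (-x)) atBot (𝓝 u₀) := by
    rw [Metric.tendsto_nhds]
    intro ε hε
    obtain ⟨c, hc⟩ := exists_ae_of_atBot (hu.eventually (Metric.ball_mem_nhds u₀ (half_pos hε)))
    have hle : ∀ x < min c 0, |A x + x * u₀| + (ε / 2) * x ≤ B := by
      refine le_of_ae_le (by fun_prop) ?_
      filter_upwards [hc, hAe] with x h1 h2 hx
      have hxc : x < c := hx.trans_le (min_le_left _ _)
      have hx0 : x < 0 := hx.trans_le (min_le_right _ _)
      have h3 := h1 hxc
      rw [Real.dist_eq] at h3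
      have h4 : A x + x * u₀ = C.v (σ x) - x * (C.u (σ x) - u₀) := by rw [← h2 hx0]; ring
      rw [h4]
      have h5 := abs_sub (C.v (σ x)) (x * (C.u (σ x) - u₀))
      rw [abs_mul, abs_of_neg hx0] at h5
      have h6 := (hB _ (h.mem x)).2
      nlinarith
    have hlarge : ∀ᶠ x : ℝ in atBot, x < -(2 * B + 1) / ε := Iio_mem_atBot _
    filter_upwards [Iio_mem_atBot (min c 0), hlarge] with x h1 h2
    have h1 : x < min c 0 := h1
    have hx0 : x < 0 := h1.trans_le (min_le_right _ _)
    have h3 := hle x h1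
    rw [lt_div_iff₀ hε] at h2
    have h4 : A x / (-x) - u₀ = (A x + x * u₀) / (-x) := by
      have hne : -x ≠ 0 := by linarith
      rw [eq_div_iff hne, sub_mul, div_mul_cancel₀ _ hne]; ring
    rw [Real.dist_eq, h4, abs_div, abs_of_pos (by linarith : 0 < -x), div_lt_iff₀ (by linarith)]
    nlinarith
  have hprod : Tendsto (fun x => A x * Φ x) atBot (𝓝 (u₀ * ∫ x in Iio (0:ℝ), φ x 0)) := by
    refine (hquot.mul hφ.tendsto_rayInt).congr' ?_
    filter_upwards [Iio_mem_atBot 0] with x hx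
    have hx : x < 0 := hx
    have : -x ≠ 0 := by linarith
    rw [← mul_assoc, div_mul_cancel₀ _ this]
  have hlim2 : Tendsto (fun x : ℝ => ∫ ξ in x..0, (A ξ * deriv Φ ξ - C.u (σ ξ) * Φ ξ)) atBot
      (𝓝 (A 0 * Φ 0 - u₀ * ∫ x in Iio (0:ℝ), φ x 0)) := by
    simp_rw [hval]
    exact tendsto_const_nhds.sub hprod
  rw [tendsto_nhds_unique hlim hlim2, hA0]
  congr 2
  simp only [hΦ, rayInt, zero_mul]

/-! ### Reflection -/

theorem IsSmoothBump.comp_neg {Φ : ℝ → ℝ} {R : Set ℝ} (h : IsSmoothBump R Φ) :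
    IsSmoothBump (-R) fun x => Φ (-x) := by
  refine ⟨h.contDiff.comp contDiff_neg, h.compact.comp_homeomorph (Homeomorph.neg ℝ), ?_,
    fun x => h.nonneg _⟩
  have : tsupport (fun x => Φ (-x)) = (Homeomorph.neg ℝ) ⁻¹' tsupport Φ :=
    tsupport_comp_eq_preimage Φ (Homeomorph.neg ℝ)
  rw [this]
  intro x hx
  exact h.subset hx

/-- Under `x ↦ -x` the sign, the speed, the density and the derivative of the bump all change sign,
an even number of them in each term. -/
theorem reflect_integral_eq {σ σ' : ℝ → ℝ} (hσ : ∀ x, σ' x = C.len - σ (-x)) (τ : ℝ) (Φ : ℝ → ℝ) :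
    ∫ x, (Real.sign (σ' x - (C.len - τ)) * (C.reflect.v (σ' x) - C.reflect.v (C.len - τ)
        - x * (C.reflect.u (σ' x) - C.reflect.u (C.len - τ))) * deriv (fun y => Φ (-y)) x
      - Real.sign (σ' x - (C.len - τ)) * (C.reflect.u (σ' x) - C.reflect.u (C.len - τ)) * Φ (-x)) =
    ∫ x, (Real.sign (σ x - τ) * (C.v (σ x) - C.v τ - x * (C.u (σ x) - C.u τ)) * deriv Φ x
      - Real.sign (σ x - τ) * (C.u (σ x) - C.u τ) * Φ x) := by
  rw [← integral_neg_eq_self (fun x => (Real.sign (σ x - τ) *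
    (C.v (σ x) - C.v τ - x * (C.u (σ x) - C.u τ)) * deriv Φ x
      - Real.sign (σ x - τ) * (C.u (σ x) - C.u τ) * Φ x))]
  congr 1; ext x
  have e : σ' x - (C.len - τ) = -(σ (-x) - τ) := by rw [hσ]; ring
  rw [e, deriv_comp_neg, Real.sign_neg]
  simp only [reflect, hσ, sub_sub_cancel]
  ring

theorem IsEntropic.reflect {R : Set ℝ} (h : C.IsEntropic R σ) :
    C.reflect.IsEntropic (-R) fun x => C.len - σ (-x) := by
  have hlen : C.reflect.len = C.len := rfl
  refine ⟨measurable_const.sub (h.meas.comp measurable_neg), fun x => ?_, fun τ hτ Φ hΦ => ?_⟩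
  · have := h.mem (-x)
    rw [hlen]
    exact ⟨by linarith [this.2], by linarith [this.1]⟩
  · have hΦ' := IsSmoothBump.comp_neg hΦ
    rw [neg_neg] at hΦ'
    rw [hlen] at hτ
    have h1 := h.ineq (C.len - τ) ⟨by linarith [hτ.2], by linarith [hτ.1]⟩ _ hΦ'
    rw [← reflect_integral_eq (σ' := fun x => C.len - σ (-x)) (fun x => rfl)] at h1
    simpa only [sub_sub_cancel, neg_neg] using h1

theorem IsEntropic.of_reflect {R : Set ℝ} (h : C.reflect.IsEntropic (-R) σ) :
    C.IsEntropic R fun x => C.len - σ (-x) := by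
  have hlen : C.reflect.len = C.len := rfl
  refine ⟨measurable_const.sub (h.meas.comp measurable_neg), fun x => ?_, fun τ hτ Φ hΦ => ?_⟩
  · have := h.mem (-x)
    rw [hlen] at this
    exact ⟨by linarith [this.2], by linarith [this.1]⟩
  · have hΦ' := IsSmoothBump.comp_neg hΦ
    have h1 := h.ineq (C.len - τ) (by rw [hlen]; exact ⟨by linarith [hτ.2], by linarith [hτ.1]⟩) _ hΦ'
    rwa [reflect_integral_eq (σ := fun x => C.len - σ (-x)) (fun x => by simp)] at h1

theorem isTest_comp_neg {φ : ℝ → ℝ → ℝ} (h : IsTest φ) : IsTest fun x t => φ (-x) t := by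
  have e : (fun p : ℝ × ℝ => φ (-p.1) p.2) =
      (fun p : ℝ × ℝ => φ p.1 p.2) ∘ ((Homeomorph.neg ℝ).prodCongr (Homeomorph.refl ℝ)) := rfl
  refine ⟨?_, ?_⟩
  · exact h.1.comp (contDiff_fst.neg.prodMk contDiff_snd)
  · rw [e]; exact h.2.comp_homeomorph _

/-- The balance on an outgoing road. -/
theorem IsEntropic.weak_identity_out (h : C.IsEntropic (Ioi 0) σ) {u₀ γ : ℝ}
    (hu : Tendsto (fun x => C.u (σ x)) (atTop ⊓ ae volume) (𝓝 u₀))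
    (hγ : Tendsto (fun x => C.v (σ x)) (𝓝[>] 0 ⊓ ae volume) (𝓝 γ))
    {φ : ℝ → ℝ → ℝ} (hφ : IsTest φ) :
    ∫ p in Ioi (0:ℝ) ×ˢ Ioi (0:ℝ),
      (C.u (σ (p.1 / p.2)) * dt φ p.1 p.2 + C.v (σ (p.1 / p.2)) * dx φ p.1 p.2) =
    -γ * (∫ t in Ioi (0:ℝ), φ 0 t) - u₀ * ∫ x in Ioi (0:ℝ), φ x 0 := by
  have h' := h.reflect
  rw [neg_Ioi, neg_zero] at h'
  have hae : Tendsto (fun x : ℝ => -x) (ae volume) (ae volume) :=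
    (Measure.measurePreserving_neg (volume : Measure ℝ)).quasiMeasurePreserving.tendsto_ae
  have hu' : Tendsto (fun x => C.reflect.u (C.len - σ (-x))) (atBot ⊓ ae volume) (𝓝 (-u₀)) := by
    have t : Tendsto (fun x : ℝ => -x) (atBot ⊓ ae volume) (atTop ⊓ ae volume) :=
      tendsto_neg_atBot_atTop.inf hae
    refine (hu.comp t).neg.congr fun x => ?_
    simp [FluxCurve.reflect]
  have hγ' : Tendsto (fun x => C.reflect.v (C.len - σ (-x))) (𝓝[<] 0 ⊓ ae volume) (𝓝 γ) := by
    have t : Tendsto (fun x : ℝ => -x) (𝓝[<] 0 ⊓ ae volume) (𝓝[>] 0 ⊓ ae volume) := by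
      have := tendsto_neg_nhdsLT (a := (0:ℝ))
      rw [neg_zero] at this
      exact this.inf hae
    refine (hγ.comp t).congr fun x => ?_
    simp [FluxCurve.reflect]
  have key := h'.weak_identity hu' hγ' (isTest_comp_neg hφ)
  have e1 : ∫ x in Iio (0:ℝ), φ (-x) 0 = ∫ x in Ioi (0:ℝ), φ x 0 := by
    rw [← integral_Iic_eq_integral_Iio, integral_comp_neg_Iic (c := 0) (f := fun x => φ x 0), neg_zero]
  have e2 : ∫ p in Ioi (0:ℝ) ×ˢ Ioi (0:ℝ),
      (C.u (σ (p.1 / p.2)) * dt φ p.1 p.2 + C.v (σ (p.1 / p.2)) * dx φ p.1 p.2) =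
      ∫ p in Iio (0:ℝ) ×ˢ Ioi (0:ℝ), (C.u (σ (-p.1 / p.2)) * dt φ (-p.1) p.2 +
        C.v (σ (-p.1 / p.2)) * dx φ (-p.1) p.2) := by
    set T : ℝ × ℝ ≃ᵐ ℝ × ℝ := (MeasurableEquiv.neg ℝ).prodCongr (MeasurableEquiv.refl ℝ) with hT
    have mp : MeasurePreserving T volume volume :=
      (Measure.measurePreserving_neg (volume : Measure ℝ)).prod (MeasurePreserving.id volume)
    have := mp.setIntegral_preimage_emb T.measurableEmbedding
      (fun p => C.u (σ (p.1 / p.2)) * dt φ p.1 p.2 + C.v (σ (p.1 / p.2)) * dx φ p.1 p.2)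
      (Ioi (0:ℝ) ×ˢ Ioi (0:ℝ))
    rw [← this]
    have hpre : T ⁻¹' (Ioi (0:ℝ) ×ˢ Ioi (0:ℝ)) = Iio (0:ℝ) ×ˢ Ioi (0:ℝ) := by
      ext p
      simp [hT, MeasurableEquiv.prodCongr]
    rw [hpre]; rfl
  rw [e1, neg_zero] at key
  rw [e2]
  rw [show (∫ p in Iio (0:ℝ) ×ˢ Ioi (0:ℝ), (C.reflect.u (C.len - σ (-(p.1 / p.2))) *
      dt (fun x t => φ (-x) t) p.1 p.2 + C.reflect.v (C.len - σ (-(p.1 / p.2))) *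
      dx (fun x t => φ (-x) t) p.1 p.2)) = -∫ p in Iio (0:ℝ) ×ˢ Ioi (0:ℝ),
        (C.u (σ (-p.1 / p.2)) * dt φ (-p.1) p.2 + C.v (σ (-p.1 / p.2)) * dx φ (-p.1) p.2) from ?_]
    at key
  · linarith [key]
  · rw [← integral_neg]
    congr 1; ext p
    have d1 : dx (fun x t => φ (-x) t) p.1 p.2 = -dx φ (-p.1) p.2 :=
      deriv_comp_neg (fun y => φ y p.2) p.1
    have d2 : dt (fun x t => φ (-x) t) p.1 p.2 = dt φ (-p.1) p.2 := rfl
    rw [d1, d2]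
    simp only [FluxCurve.reflect, sub_sub_cancel, neg_div]
    ring

end FluxCurve

end

noncomputable section

/-! ### The graph of a flux with a jump as a curve -/

namespace JumpFlux

variable (F : JumpFlux)

theorem continuousOn₁ : ContinuousOn F.f₁ (Icc 0 F.ustar) := F.contDiff₁.continuousOn

theorem continuousOn₂ : ContinuousOn F.f₂ (Icc F.ustar F.umax) := by
  intro x hx
  rcases hx.1.eq_or_lt with h | h
  · subst h
    have : ContinuousWithinAt F.f₂ (Ioi F.ustar) F.ustar := F.right_limit
    exact (continuousWithinAt_Ioi_iff_Ici.1 this).mono Icc_subset_Ici_self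
  · refine (F.contDiff₂.continuousOn x ⟨h, hx.2⟩).mono_of_mem_nhdsWithin ?_
    filter_upwards [self_mem_nhdsWithin, mem_nhdsWithin_of_mem_nhds (Ioi_mem_nhds h)] with y h1 h2
    exact ⟨h2, h1.2⟩

theorem strictMonoOn₁ : StrictMonoOn F.f₁ (Icc 0 F.ustar) :=
  strictMonoOn_of_deriv_pos (convex_Icc _ _) F.continuousOn₁ (by
    rw [interior_Icc]; exact F.deriv₁_pos)

theorem strictAntiOn₂ : StrictAntiOn F.f₂ (Icc F.ustar F.umax) :=
  strictAntiOn_of_deriv_neg (convex_Icc _ _) F.continuousOn₂ (by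
    rw [interior_Icc]; exact F.deriv₂_neg)

/-- The height of the jump. -/
def jumpSize : ℝ := F.f₁ F.ustar - F.f₂ F.ustar

theorem jumpSize_pos : 0 < F.jumpSize := sub_pos.2 F.jump

/-- The parameter is the density up to `ustar`, then the flux drop along the vertical part, run
through at unit speed, and then the density shifted by `jumpSize`. The formula by `min` and `max`
makes continuity and monotonicity immediate. -/
def curveU (s : ℝ) : ℝ := max (min s F.ustar) (s - F.jumpSize)

/-- A sum of the contributions of the three pieces, each with its argument clamped to its own range
so that it is constant elsewhere. The final subtraction removes the value `f₂ ustar` that the third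
piece contributes before it becomes active. -/
def curveV (s : ℝ) : ℝ :=
  F.f₁ (max 0 (min s F.ustar)) - max 0 (min (s - F.ustar) F.jumpSize) +
    F.f₂ (max F.ustar (min (s - F.jumpSize) F.umax)) - F.f₂ F.ustar

variable {F} {s τ : ℝ}

theorem curveU_left (h : s ≤ F.ustar) : F.curveU s = s := by
  have := F.jumpSize_pos
  rw [curveU, min_eq_left h, max_eq_left (by linarith)]

theorem curveU_mid (h : F.ustar ≤ s) (h' : s ≤ F.ustar + F.jumpSize) : F.curveU s = F.ustar := by
  rw [curveU, min_eq_right h, max_eq_left (by linarith)]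

theorem curveU_right (h : F.ustar + F.jumpSize ≤ s) : F.curveU s = s - F.jumpSize := by
  have := F.jumpSize_pos
  rw [curveU, min_eq_right (by linarith), max_eq_right (by linarith)]

theorem curveV_left (h0 : 0 ≤ s) (h : s ≤ F.ustar) : F.curveV s = F.f₁ s := by
  have := F.jumpSize_pos
  rw [curveV, min_eq_left h, max_eq_right h0, max_eq_left ((min_le_left _ _).trans (by linarith)),
    max_eq_left ((min_le_left _ _).trans (by linarith))]
  ring

theorem curveV_mid (h : F.ustar ≤ s) (h' : s ≤ F.ustar + F.jumpSize) :
    F.curveV s = F.f₁ F.ustar - (s - F.ustar) := by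
  have := F.ustar_pos
  rw [curveV, min_eq_right h, max_eq_right this.le, min_eq_left (by linarith : s - F.ustar ≤ _),
    max_eq_right (by linarith), max_eq_left ((min_le_left _ _).trans (by linarith))]
  ring

theorem curveV_right (h : F.ustar + F.jumpSize ≤ s) (h' : s ≤ F.umax + F.jumpSize) :
    F.curveV s = F.f₂ (s - F.jumpSize) := by
  have h1 := F.ustar_pos
  have h2 := F.jumpSize_pos
  rw [curveV, min_eq_right (by linarith), max_eq_right h1.le,
    min_eq_right (by linarith : F.jumpSize ≤ _), max_eq_right h2.le, min_eq_left (by linarith),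
    max_eq_right (by linarith)]
  simp only [jumpSize]; ring

variable (F)

theorem monotone_curveU : Monotone F.curveU := fun a b h =>
  max_le_max (min_le_min h le_rfl) (by linarith)

theorem continuous_curveV : Continuous F.curveV := by
  have h1 := F.ustar_pos
  have h2 := F.ustar_lt
  have c1 : Continuous fun s => F.f₁ (max 0 (min s F.ustar)) :=
    F.continuousOn₁.comp_continuous (by fun_prop) fun s =>
      ⟨le_max_left _ _, max_le h1.le (min_le_right _ _)⟩
  have c2 : Continuous fun s => F.f₂ (max F.ustar (min (s - F.jumpSize) F.umax)) :=
    F.continuousOn₂.comp_continuous (by fun_prop) fun s =>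
      ⟨le_max_left _ _, max_le h2.le (min_le_right _ _)⟩
  unfold curveV
  fun_prop

theorem strictAntiOn_curveV : StrictAntiOn F.curveV (Icc F.ustar (F.umax + F.jumpSize)) := by
  have h1 := F.ustar_pos
  have h2 := F.ustar_lt
  have h3 := F.jumpSize_pos
  have := (StrictAntiOn.union (s := Icc F.ustar (F.ustar + F.jumpSize))
    (t := Icc (F.ustar + F.jumpSize) (F.umax + F.jumpSize)) (f := F.curveV)
    (c := F.ustar + F.jumpSize) ?_ ?_ ⟨right_mem_Icc.2 (by linarith), fun x hx => hx.2⟩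
    ⟨left_mem_Icc.2 (by linarith), fun x hx => hx.1⟩)
  · rwa [Icc_union_Icc_eq_Icc (by linarith) (by linarith)] at this
  · intro a ha b hb hab
    rw [curveV_mid ha.1 ha.2, curveV_mid hb.1 hb.2]; linarith
  · intro a ha b hb hab
    rw [curveV_right ha.1 ha.2, curveV_right hb.1 hb.2]
    exact F.strictAntiOn₂ ⟨by linarith [ha.1], by linarith [ha.2]⟩
      ⟨by linarith [hb.1], by linarith [hb.2]⟩ (by linarith)

/-- Off the vertical part the density has slope one in the parameter, so two parameters can share a
density only there. -/
theorem eq_ustar_of_u_eq (h : s < τ) (h1 : F.curveU s = F.curveU τ) :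
    F.ustar ≤ s ∧ τ ≤ F.ustar + F.jumpSize := by
  have hJ := F.jumpSize_pos
  constructor
  · by_contra! hc
    rw [curveU_left hc.le] at h1
    rcases le_total τ F.ustar with h3 | h3
    · rw [curveU_left h3] at h1; linarith
    · have := F.monotone_curveU h3
      rw [curveU_left le_rfl] at this; linarith
  · by_contra! hc
    rw [curveU_right hc.le] at h1
    rcases le_total (F.ustar + F.jumpSize) s with h3 | h3
    · rw [curveU_right h3] at h1; linarith
    · have := F.monotone_curveU h3
      rw [curveU_right le_rfl] at this; linarith

/-- The graph of the multivalued flux, parametrized from left to right. -/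
def curve : FluxCurve where
  len := F.umax + F.jumpSize
  peak := F.ustar
  u := F.curveU
  v := F.curveV
  peak_mem := ⟨F.ustar_pos.le, by linarith [F.ustar_lt, F.jumpSize_pos]⟩
  cont_u := by unfold curveU; fun_prop
  cont_v := F.continuous_curveV
  mono_u := F.monotone_curveU.monotoneOn _
  inj a ha b hb h1 h2 := by
    have hJ := F.jumpSize_pos
    rcases lt_trichotomy a b with h | h | h
    · obtain ⟨h3, h4⟩ := F.eq_ustar_of_u_eq h h1
      rw [curveV_mid h3 (by linarith), curveV_mid (by linarith) h4] at h2; linarith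
    · exact h
    · obtain ⟨h3, h4⟩ := F.eq_ustar_of_u_eq h h1.symm
      rw [curveV_mid h3 (by linarith), curveV_mid (by linarith) h4] at h2; linarith
  v_up a ha b hb hab := by
    rw [curveV_left ha.1 ha.2, curveV_left hb.1 hb.2]; exact F.strictMonoOn₁ ha hb hab
  v_down := F.strictAntiOn_curveV

/-- The point of the graph with parameter `s`. -/
def pt (s : ℝ) : ℝ × ℝ := (F.curve.u s, F.curve.v s)

/-- The parameter of a point of the graph. -/
def param (p : ℝ × ℝ) : ℝ :=
  if p.1 < F.ustar then p.1 else if p.1 = F.ustar then F.ustar + F.f₁ F.ustar - p.2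
  else p.1 + F.jumpSize

theorem measurable_param : Measurable F.param :=
  Measurable.ite (measurableSet_lt measurable_fst measurable_const) measurable_fst
    (Measurable.ite (measurable_fst (measurableSet_singleton _))
      (measurable_const.sub measurable_snd) (measurable_fst.add_const _))

theorem len_eq : F.curve.len = F.umax + F.jumpSize := rfl

theorem peak_eq : F.curve.peak = F.ustar := rfl

theorem len_nonneg : 0 ≤ F.curve.len := by
  rw [len_eq]; linarith [F.ustar_pos, F.ustar_lt, F.jumpSize_pos]

theorem curve_v_zero : F.curve.v 0 = 0 :=
  (curveV_left (F := F) le_rfl F.ustar_pos.le).trans F.zero_left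

theorem curve_v_len : F.curve.v F.curve.len = 0 := by
  have : F.curve.v F.curve.len = _ := curveV_right (F := F) (s := F.umax + F.jumpSize)
    (by linarith [F.ustar_lt]) le_rfl
  rw [this, add_sub_cancel_right, F.zero_right]

theorem param_mem {p : ℝ × ℝ} (hp : p ∈ F.graph) :
    F.param p ∈ Icc 0 F.curve.len ∧ F.pt (F.param p) = p := by
  obtain ⟨u, v⟩ := p
  obtain ⟨⟨h1, h2⟩, h3⟩ := hp
  have a1 := F.ustar_pos
  have a2 := F.ustar_lt
  have a3 := F.jumpSize_pos
  simp only at h1 h2 h3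
  rw [multi] at h3
  rw [len_eq]
  rcases lt_trichotomy u F.ustar with h | h | h
  · rw [if_pos h, mem_singleton_iff] at h3
    have e : F.param (u, v) = u := if_pos h
    rw [e]
    refine ⟨⟨h1, by linarith⟩, Prod.ext (curveU_left h.le) ?_⟩
    exact (curveV_left h1 h.le).trans h3.symm
  · rw [if_neg (by linarith), if_pos h] at h3
    have e : F.param (u, v) = F.ustar + F.f₁ F.ustar - v := by
      simp only [param]; rw [if_neg (by linarith), if_pos h]
    have e3 : F.jumpSize = F.f₁ F.ustar - F.f₂ F.ustar := rfl
    rw [e]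
    have b1 : F.ustar ≤ F.ustar + F.f₁ F.ustar - v := by linarith [h3.2]
    have b2 : F.ustar + F.f₁ F.ustar - v ≤ F.ustar + F.jumpSize := by linarith [h3.1]
    refine ⟨⟨by linarith, by linarith⟩, Prod.ext ((curveU_mid b1 b2).trans h.symm) ?_⟩
    refine (curveV_mid b1 b2).trans ?_
    ring
  · rw [if_neg (by linarith), if_neg h.ne', mem_singleton_iff] at h3
    have e : F.param (u, v) = u + F.jumpSize := by
      simp only [param]; rw [if_neg (by linarith), if_neg h.ne']
    rw [e]
    refine ⟨⟨by linarith, by linarith⟩, Prod.ext ?_ ?_⟩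
    · refine (curveU_right (by linarith)).trans ?_; ring
    · refine (curveV_right (by linarith) (by linarith)).trans ?_
      rw [add_sub_cancel_right]; exact h3.symm

theorem pt_mem (hs : s ∈ Icc 0 F.curve.len) : F.pt s ∈ F.graph := by
  have a1 := F.ustar_pos
  have a2 := F.ustar_lt
  have a3 := F.jumpSize_pos
  have e3 : F.jumpSize = F.f₁ F.ustar - F.f₂ F.ustar := rfl
  rw [len_eq] at hs
  have mid : F.ustar ≤ s → s ≤ F.ustar + F.jumpSize → F.pt s ∈ F.graph := by
    intro h h'
    have e1 : (F.pt s).1 = F.ustar := curveU_mid h h'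
    have e2 : (F.pt s).2 = _ := curveV_mid h h'
    refine ⟨by rw [e1]; exact ⟨a1.le, a2.le⟩, ?_⟩
    rw [e1, e2, multi, if_neg (lt_irrefl _), if_pos rfl]
    exact ⟨by linarith, by linarith⟩
  rcases lt_or_ge s F.ustar with h | h
  · have e1 : (F.pt s).1 = s := curveU_left h.le
    have e2 : (F.pt s).2 = _ := curveV_left hs.1 h.le
    refine ⟨by rw [e1]; exact ⟨hs.1, by linarith⟩, ?_⟩
    rw [e1, e2, multi, if_pos h]; rfl
  rcases le_or_gt s (F.ustar + F.jumpSize) with h' | h'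
  · exact mid h h'
  · have e1 : (F.pt s).1 = s - F.jumpSize := curveU_right h'.le
    have e2 : (F.pt s).2 = _ := curveV_right h'.le hs.2
    refine ⟨by rw [e1]; exact ⟨by linarith, by linarith [hs.2]⟩, ?_⟩
    rw [e1, e2, multi, if_neg (by linarith), if_neg (by linarith)]; rfl

theorem pt_inj (hs : s ∈ Icc 0 F.curve.len) (hτ : τ ∈ Icc 0 F.curve.len) (h : F.pt s = F.pt τ) :
    s = τ := F.curve.inj s hs τ hτ (congrArg Prod.fst h) (congrArg Prod.snd h)

/-! ### The order and the hull states in terms of the parameter -/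

theorem precedes_pt_of_le (h : s ≤ τ) : Precedes (F.pt s) (F.pt τ) := by
  rcases h.eq_or_lt with rfl | h
  · exact Or.inr ⟨rfl, le_rfl⟩
  rcases (F.monotone_curveU h.le).lt_or_eq with h1 | h1
  · exact Or.inl h1
  · obtain ⟨h2, h3⟩ := F.eq_ustar_of_u_eq h h1
    refine Or.inr ⟨h1, ?_⟩
    have e1 : (F.pt s).2 = _ := curveV_mid h2 (by linarith)
    have e2 : (F.pt τ).2 = _ := curveV_mid (by linarith) h3
    rw [e1, e2]; linarith

theorem precedes_antisymm {p q : ℝ × ℝ} (h : Precedes p q) (h' : Precedes q p) : p = q := by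
  rcases h with h | h <;> rcases h' with h' | h'
  · linarith
  · linarith [h'.1]
  · linarith [h.1]
  · exact Prod.ext h.1 (le_antisymm h'.2 h.2)

theorem precedes_pt (hs : s ∈ Icc 0 F.curve.len) (hτ : τ ∈ Icc 0 F.curve.len) :
    Precedes (F.pt s) (F.pt τ) ↔ s ≤ τ := by
  refine ⟨fun h => ?_, F.precedes_pt_of_le⟩
  by_contra! hc
  exact hc.ne' (F.pt_inj hs hτ (precedes_antisymm h (F.precedes_pt_of_le hc.le)))

/-- A later parameter has larger density, or the same density and smaller flux. This turns the
entropy inequalities on the graph into the scalar ones of `FluxCurve.IsEntropic`. -/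
theorem orderSign_pt (hs : s ∈ Icc 0 F.curve.len) (hτ : τ ∈ Icc 0 F.curve.len) :
    orderSign (F.pt s) (F.pt τ) = Real.sign (s - τ) := by
  have main : ∀ a ∈ Icc 0 F.curve.len, ∀ b ∈ Icc 0 F.curve.len, a < b →
      (F.pt a).1 < (F.pt b).1 ∨ ((F.pt a).1 = (F.pt b).1 ∧ (F.pt b).2 < (F.pt a).2) := by
    intro a ha b hb hab
    rcases F.precedes_pt_of_le hab.le with h | ⟨h, h'⟩
    · exact Or.inl h
    · refine Or.inr ⟨h, h'.lt_of_ne fun e => hab.ne (F.pt_inj ha hb (Prod.ext h e.symm))⟩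
  rcases lt_trichotomy s τ with h | h | h
  · rw [Real.sign_of_neg (sub_neg.2 h), orderSign]
    rcases main s hs τ hτ h with h1 | ⟨h1, h2⟩
    · rw [if_pos h1]
    · rw [if_neg h1.not_lt, if_neg h1.symm.not_lt, Real.sign_of_neg (sub_neg.2 h2)]
  · subst h
    simp [orderSign]
  · rw [Real.sign_of_pos (sub_pos.2 h), orderSign]
    rcases main τ hτ s hs h with h1 | ⟨h1, h2⟩
    · rw [if_neg h1.not_gt, if_pos h1]
    · rw [if_neg h1.symm.not_lt, if_neg h1.not_lt, Real.sign_of_pos (sub_pos.2 h2)]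

theorem isHullState_pt {a b ξ : ℝ} (ha : a ∈ Icc 0 F.curve.len) (hb : b ∈ Icc 0 F.curve.len)
    (hs : s ∈ Icc 0 F.curve.len) :
    F.IsHullState (F.pt a) (F.pt b) ξ (F.pt s) ↔ F.curve.IsHull a b ξ s := by
  have hm : ∀ {x y τ}, x ∈ Icc 0 F.curve.len → y ∈ Icc 0 F.curve.len → τ ∈ Icc x y →
      τ ∈ Icc 0 F.curve.len := fun hx hy h => ⟨hx.1.trans h.1, h.2.trans hy.2⟩
  constructor
  · rintro ⟨-, h1, h2⟩
    refine ⟨?_, fun hab τ hτ => ?_, fun hab τ hτ => ?_⟩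
    · rcases le_total a b with hab | hab
      · obtain ⟨h3, h4, -⟩ := h1 (F.precedes_pt_of_le hab)
        rw [uIcc_of_le hab]
        exact ⟨(F.precedes_pt ha hs).1 h3, (F.precedes_pt hs hb).1 h4⟩
      · obtain ⟨h3, h4, -⟩ := h2 (F.precedes_pt_of_le hab)
        rw [uIcc_of_ge hab]
        exact ⟨(F.precedes_pt hb hs).1 h3, (F.precedes_pt hs ha).1 h4⟩
    · exact (h1 (F.precedes_pt_of_le hab)).2.2 (F.pt τ) (F.pt_mem (hm ha hb hτ))
        (F.precedes_pt_of_le hτ.1) (F.precedes_pt_of_le hτ.2)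
    · exact (h2 (F.precedes_pt_of_le hab)).2.2 (F.pt τ) (F.pt_mem (hm hb ha hτ))
        (F.precedes_pt_of_le hτ.1) (F.precedes_pt_of_le hτ.2)
  · rintro ⟨h0, h1, h2⟩
    refine ⟨F.pt_mem hs, fun hab => ?_, fun hab => ?_⟩
    · rw [F.precedes_pt ha hb] at hab
      rw [uIcc_of_le hab] at h0
      refine ⟨F.precedes_pt_of_le h0.1, F.precedes_pt_of_le h0.2, fun k hk hk1 hk2 => ?_⟩
      obtain ⟨m, e⟩ := F.param_mem hk
      rw [← e] at hk1 hk2 ⊢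
      exact h1 hab _ ⟨(F.precedes_pt ha m).1 hk1, (F.precedes_pt m hb).1 hk2⟩
    · rw [F.precedes_pt hb ha] at hab
      rw [uIcc_of_ge hab] at h0
      refine ⟨F.precedes_pt_of_le h0.1, F.precedes_pt_of_le h0.2, fun k hk hk1 hk2 => ?_⟩
      obtain ⟨m, e⟩ := F.param_mem hk
      rw [← e] at hk1 hk2 ⊢
      exact h2 hab _ ⟨(F.precedes_pt hb m).1 hk1, (F.precedes_pt m ha).1 hk2⟩

end JumpFlux

end

noncomputable section

/-! ### The densities at the junction -/

namespace FluxCurve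

variable (C : FluxCurve) {a b : ℝ}

/-- The mirror image of `InCond`. -/
def OutCond (a b : ℝ) : Prop := b = a ∨ (b ≤ C.peak ∧ (C.peak < a → C.v b < C.v a))

theorem reflect_inCond : C.reflect.InCond (C.len - a) (C.len - b) ↔ C.OutCond a b := by
  simp only [InCond, OutCond, reflect, sub_sub_cancel, sub_right_inj, sub_le_sub_iff_left,
    sub_lt_sub_iff_left]

end FluxCurve

namespace JumpFlux

variable (F : JumpFlux)

theorem ucrit_spec : F.ucrit ∈ Icc 0 F.ustar ∧ F.f₁ F.ucrit = F.f₂ F.ustar := by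
  have h : ∃ u ∈ Icc 0 F.ustar, F.f₁ u = F.f₂ F.ustar := by
    have := intermediate_value_Icc F.ustar_pos.le F.continuousOn₁
    refine this ⟨?_, F.jump.le⟩
    rw [F.zero_left, ← F.zero_right]
    exact F.strictAntiOn₂.antitoneOn (left_mem_Icc.2 F.ustar_lt.le)
      (right_mem_Icc.2 F.ustar_lt.le) F.ustar_lt.le
  exact ⟨Function.invFunOn_mem h, Function.invFunOn_eq h⟩

theorem ucrit_lt : F.ucrit < F.ustar := by
  obtain ⟨h, h'⟩ := F.ucrit_spec
  refine h.2.lt_of_ne fun e => ?_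
  rw [e] at h'
  exact F.jump.ne' h'

theorem eta_spec_left {u : ℝ} (h0 : 0 ≤ u) (h : u ≤ F.ucrit) :
    F.eta u ∈ Icc F.ustar F.umax ∧ F.f₂ (F.eta u) = F.f₁ u := by
  obtain ⟨h1, h2⟩ := F.ucrit_spec
  have h3 : ∃ w ∈ Icc F.ustar F.umax, F.f₂ w = F.f₁ u := by
    have := intermediate_value_Icc' F.ustar_lt.le F.continuousOn₂
    refine this ⟨?_, ?_⟩
    · rw [F.zero_right, ← F.zero_left]
      exact F.strictMonoOn₁.monotoneOn (left_mem_Icc.2 F.ustar_pos.le) ⟨h0, h.trans h1.2⟩ h0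
    · rw [← h2]
      exact F.strictMonoOn₁.monotoneOn ⟨h0, h.trans h1.2⟩ h1 h
  rw [eta, if_pos h]
  exact ⟨Function.invFunOn_mem h3, Function.invFunOn_eq h3⟩

theorem eta_spec_right {u : ℝ} (h : F.ustar ≤ u) (h' : u ≤ F.umax) :
    F.eta u ∈ Icc 0 F.ustar ∧ F.f₁ (F.eta u) = F.f₂ u := by
  have h3 : ∃ w ∈ Icc 0 F.ustar, F.f₁ w = F.f₂ u := by
    have := intermediate_value_Icc F.ustar_pos.le F.continuousOn₁
    refine this ⟨?_, ?_⟩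
    · rw [F.zero_left, ← F.zero_right]
      exact F.strictAntiOn₂.antitoneOn ⟨h, h'⟩ (right_mem_Icc.2 F.ustar_lt.le) h'
    · exact (F.strictAntiOn₂.antitoneOn (left_mem_Icc.2 F.ustar_lt.le) ⟨h, h'⟩ h).trans F.jump.le
  rw [eta, if_neg (by linarith [F.ucrit_lt]), if_neg (by linarith)]
  exact ⟨Function.invFunOn_mem h3, Function.invFunOn_eq h3⟩

variable {F} {a b : ℝ}

theorem curve_u_of_le (h : a ≤ F.ustar) : F.curve.u a = a := curveU_left h

theorem curve_v_of_le (h0 : 0 ≤ a) (h : a ≤ F.ustar) : F.curve.v a = F.f₁ a := curveV_left h0 h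

theorem ustar_le_curve_u (h : F.ustar ≤ a) : F.ustar ≤ F.curve.u a := by
  have := F.monotone_curveU h
  rwa [curveU_left le_rfl] at this

theorem lt_ustar_of_u_lt (h : F.curve.u a < F.ustar) : a < F.ustar := by
  by_contra! hc
  exact (ustar_le_curve_u hc).not_gt h

theorem curve_u_mem (h : a ∈ Icc 0 F.curve.len) : F.curve.u a ∈ Icc 0 F.umax :=
  (F.pt_mem h).1

/-- The vertical part carries only fluxes of at least `f(u*+)`. -/
theorem right_of_v_lt (ha : F.ustar ≤ a) (hv : F.curve.v a < F.f₂ F.ustar) :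
    F.ustar + F.jumpSize < a := by
  by_contra! hc
  have : F.curve.v a = _ := curveV_mid ha hc
  have e : F.jumpSize = F.f₁ F.ustar - F.f₂ F.ustar := rfl
  linarith

/-- If `u a ≤ ucrit`, a new trace has flux below `f₁ a ≤ f(u*+)`; it must lie on the branch `f₂`,
strictly beyond the state `η` of equal flux. In the remaining cases it suffices that a new trace
lies past the peak. -/
theorem mem_inSet (ha : a ∈ Icc 0 F.curve.len) (hb : b ∈ Icc 0 F.curve.len)
    (h : F.curve.InCond a b) : F.curve.u b ∈ F.inSet (F.curve.u a) := by
  have hub := curve_u_mem hb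
  rw [inSet]
  split_ifs with h1 h2
  · have h2 := lt_ustar_of_u_lt (h1.trans_lt F.ucrit_lt)
    rcases h with rfl | ⟨h3, h4⟩
    · exact Or.inl rfl
    have h5 := h4 h2
    rw [curve_v_of_le ha.1 h2.le] at h5
    rw [curve_u_of_le h2.le] at h1 ⊢
    obtain ⟨h6, h7⟩ := F.eta_spec_left ha.1 h1
    obtain ⟨c1, c2⟩ := F.ucrit_spec
    have h8 : F.f₁ a ≤ F.f₂ F.ustar := by
      rw [← c2]
      exact F.strictMonoOn₁.monotoneOn ⟨ha.1, h2.le⟩ c1 h1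
    have h9 := right_of_v_lt h3 (h5.trans_le h8)
    have e1 : F.curve.u b = b - F.jumpSize := curveU_right h9.le
    have e2 : F.curve.v b = F.f₂ (b - F.jumpSize) := curveV_right h9.le hb.2
    rw [e1] at hub ⊢
    rw [e2, ← h7] at h5
    exact Or.inr ⟨(F.strictAntiOn₂.lt_iff_gt ⟨by linarith, hub.2⟩ h6).1 h5, hub.2⟩
  · have h2 := lt_ustar_of_u_lt h2
    rcases h with rfl | ⟨h3, h4⟩
    · exact Or.inl rfl
    · exact Or.inr ⟨ustar_le_curve_u h3, hub.2⟩
  · rcases h with rfl | ⟨h3, h4⟩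
    · exact ⟨not_lt.1 h2, hub.2⟩
    · exact ⟨ustar_le_curve_u h3, hub.2⟩

theorem aheadFlux_mem {u₀ : ℝ} (c : Bool) (h : u₀ ∈ Icc 0 F.umax) :
    (u₀, F.aheadFlux u₀ c) ∈ F.graph := by
  refine ⟨h, ?_⟩
  have := F.jump.le
  simp only [aheadFlux, multi]
  split_ifs
  · rfl
  · exact ⟨le_rfl, this⟩
  · exact ⟨this, le_rfl⟩
  · rfl

theorem mem_outSet {u₀ : ℝ} {c : Bool} (ha : a ∈ Icc 0 F.curve.len) (hb : b ∈ Icc 0 F.curve.len)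
    (hp : F.pt a = (u₀, F.aheadFlux u₀ c)) (h : F.curve.OutCond a b) :
    F.curve.u b ∈ F.outSet u₀ c := by
  have hub := curve_u_mem hb
  have hu : F.curve.u a = u₀ := congrArg Prod.fst hp
  have hv : F.curve.v a = F.aheadFlux u₀ c := congrArg Prod.snd hp
  have hJ := F.jumpSize_pos
  have eJ : F.jumpSize = F.f₁ F.ustar - F.f₂ F.ustar := rfl
  have hle : b ≤ F.ustar → F.curve.u b ∈ Icc 0 F.ustar := fun h => by
    rw [curve_u_of_le h]; exact ⟨hb.1, h⟩
  rw [outSet]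
  split_ifs with h1 h2 h3
  · rcases h with rfl | ⟨h3, h4⟩
    · rw [hu] at hub ⊢; exact ⟨hub.1, h1.le⟩
    · exact hle h3
  · subst h2
    rw [aheadFlux, if_neg (lt_irrefl _), if_pos rfl, if_pos h3] at hv
    -- In the congested case the initial state is the lower end of the vertical part, past the peak,
    -- so a new trace must have flux below `f(u*+)`, that is density below `ucrit`.
    have hpa : F.pt a = F.pt (F.ustar + F.jumpSize) := by
      refine Prod.ext ?_ ?_
      · exact hu.trans (curveU_mid (by linarith) le_rfl).symm
      · refine hv.trans (((curveV_mid (by linarith) le_rfl).trans ?_).symm)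
        linarith
    have hea := F.pt_inj ha ⟨by linarith [F.ustar_pos], by rw [len_eq]; linarith [F.ustar_lt]⟩ hpa
    rcases h with rfl | ⟨h4, h5⟩
    · exact Or.inl hu
    · have h4 : b ≤ F.ustar := h4
      have h6 := h5 (by rw [hea, peak_eq]; linarith)
      obtain ⟨c1, c2⟩ := F.ucrit_spec
      rw [hv, curve_v_of_le hb.1 h4, ← c2] at h6
      rw [curve_u_of_le h4]
      exact Or.inr ⟨hb.1, (F.strictMonoOn₁.lt_iff_lt ⟨hb.1, h4⟩ c1).1 h6⟩
  · subst h2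
    rcases h with rfl | ⟨h4, h5⟩
    · rw [hu]; exact ⟨F.ustar_pos.le, le_rfl⟩
    · exact hle h4
  · have h3 : F.ustar < u₀ := lt_of_le_of_ne (not_lt.1 h1) (Ne.symm h2)
    rw [aheadFlux, if_neg h1, if_neg h2] at hv
    rcases h with rfl | ⟨h4, h5⟩
    · exact Or.inl hu
    · have h4 : b ≤ F.ustar := h4
      have h6 : F.curve.v b < F.curve.v a := h5 (by
        by_contra! hc
        rw [peak_eq] at hc
        rw [curve_u_of_le hc] at hu
        linarith)
      rw [hv, curve_v_of_le hb.1 h4] at h6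
      have hua : u₀ ≤ F.umax := by rw [← hu]; exact (curve_u_mem ha).2
      obtain ⟨c1, c2⟩ := F.eta_spec_right h3.le hua
      rw [← c2] at h6
      rw [curve_u_of_le h4]
      exact Or.inr ⟨hb.1, (F.strictMonoOn₁.lt_iff_lt ⟨hb.1, h4⟩ c1).1 h6⟩

end JumpFlux

end

noncomputable section

/-! ### Waves on incoming and outgoing roads -/

namespace FluxCurve

variable {C : FluxCurve} {σ : ℝ → ℝ} {a b s ξ : ℝ}

theorem mem_reflect (h : s ∈ Icc 0 C.len) : C.len - s ∈ Icc 0 C.reflect.len := by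
  have : C.reflect.len = C.len := rfl
  rw [this]
  exact ⟨by linarith [h.2], by linarith [h.1]⟩

/-- The parameter converges as soon as density and flux do. -/
theorem exists_tendsto {l : Filter ℝ} [l.NeBot] (hσ : ∀ x, σ x ∈ Icc 0 C.len) {p q : ℝ}
    (hu : Tendsto (fun x => C.u (σ x)) l (𝓝 p)) (hv : Tendsto (fun x => C.v (σ x)) l (𝓝 q)) :
    ∃ s ∈ Icc 0 C.len, C.u s = p ∧ C.v s = q ∧ Tendsto σ l (𝓝 s) := by
  have lim : ∀ {f : ℝ → ℝ} {r y : ℝ}, Continuous f → Tendsto (fun x => f (σ x)) l (𝓝 r) →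
      MapClusterPt y l σ → f y = r := fun hf hr hy =>
    eq_of_nhds_neBot ((hy.continuousAt_comp hf.continuousAt).neBot.mono (inf_le_inf_left _ hr))
  have key : ∀ y, MapClusterPt y l σ → C.u y = p ∧ C.v y = q := fun y hy =>
    ⟨lim C.cont_u hu hy, lim C.cont_v hv hy⟩
  obtain ⟨s, hs, hc⟩ := isCompact_Icc.exists_mapClusterPt (u := σ) (f := l)
    (le_principal_iff.2 (mem_map.2 (Eventually.of_forall hσ)))
  obtain ⟨e1, e2⟩ := key s hc
  refine ⟨s, hs, e1, e2, isCompact_Icc.tendsto_nhds_of_unique_mapClusterPt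
    (Eventually.of_forall hσ) fun y hy hyc => ?_⟩
  obtain ⟨e3, e4⟩ := key y hyc
  exact C.inj y hy s hs (e3.trans e1.symm) (e4.trans e2.symm)

theorem IsEntropic.isHull_in (h : C.IsEntropic (Iio 0) σ) {s₁ s₂ : ℝ} (h12 : s₁ ≤ s₂)
    (hs₁ : 0 ≤ s₁) (hs₂ : s₂ ≤ C.len) (hb : b ∈ Icc 0 C.len)
    (hs : s₁ = s₂ ∨ (C.peak ≤ s₁ ∧ C.u s₁ = C.u s₂))
    (hL₁ : ∀ τ ∈ Icc 0 C.len, τ < s₁ → ∀ᶠ x in atBot ⊓ ae volume, τ < σ x)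
    (hL₂ : ∀ τ ∈ Icc 0 C.len, s₂ < τ → ∀ᶠ x in atBot ⊓ ae volume, σ x < τ)
    (hR : Tendsto σ (𝓝[<] 0 ⊓ ae volume) (𝓝 b)) (ha : a ∈ Icc s₁ s₂) :
    (∀ᵐ x, x < 0 → C.IsHull a b x (σ x)) ∧ C.InCond a b :=
  h.isHull h12 hs₁ hs₂ hb hs (fun τ hτ h => exists_ae_of_atBot (hL₁ τ hτ h))
    (fun τ hτ h => exists_ae_of_atBot (hL₂ τ hτ h))
    (fun _ _ h => exists_ae_of_left (hR.eventually_const_lt h))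
    (fun _ _ h => exists_ae_of_left (hR.eventually_lt_const h)) ha

/-- Reflection negates speed and density and reverses the parameter; `v - ξ u` is unchanged, and the
roles of the two ends are exchanged. -/
theorem reflect_isHull :
    C.reflect.IsHull (C.len - a) (C.len - b) (-ξ) (C.len - s) ↔ C.IsHull b a ξ s := by
  have hm : C.len - s ∈ uIcc (C.len - a) (C.len - b) ↔ s ∈ uIcc b a := by
    rw [uIcc_comm b a, mem_uIcc, mem_uIcc]
    constructor <;> rintro (⟨h1, h2⟩ | ⟨h1, h2⟩)
    · exact Or.inr ⟨by linarith, by linarith⟩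
    · exact Or.inl ⟨by linarith, by linarith⟩
    · exact Or.inr ⟨by linarith, by linarith⟩
    · exact Or.inl ⟨by linarith, by linarith⟩
  have key : ∀ p q (P : ℝ → ℝ → Prop), (∀ τ ∈ Icc (C.len - p) (C.len - q),
      P (C.reflect.v τ) (C.reflect.u τ)) ↔ ∀ τ ∈ Icc q p, P (C.v τ) (-C.u τ) := by
    intro p q P
    constructor
    · intro h τ hτ
      have := h (C.len - τ) ⟨by linarith [hτ.2], by linarith [hτ.1]⟩
      simpa [reflect] using this
    · intro h τ hτ
      exact h (C.len - τ) ⟨by linarith [hτ.2], by linarith [hτ.1]⟩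
  have e1 : C.reflect.v (C.len - s) = C.v s := by simp [reflect]
  have e2 : C.reflect.u (C.len - s) = -C.u s := by simp [reflect]
  simp only [IsHull]
  rw [hm, key a b (fun v u => C.reflect.v (C.len - s) - -ξ * C.reflect.u (C.len - s) ≤ v - -ξ * u),
    key b a (fun v u => v - -ξ * u ≤ C.reflect.v (C.len - s) - -ξ * C.reflect.u (C.len - s)),
    e1, e2]
  simp only [neg_mul_neg, sub_le_sub_iff_left]

theorem OutCond.isHull_iff (h : C.OutCond a b) (ha : a ∈ Icc 0 C.len) (hb : b ∈ Icc 0 C.len)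
    (hξ : ξ < 0) : C.IsHull b a ξ s ↔ s = b := by
  rw [← reflect_isHull, (C.reflect_inCond.2 h).isHull_iff (mem_reflect ha) (mem_reflect hb)
    (neg_pos.2 hξ), sub_right_inj]

theorem tendsto_neg_ae : Tendsto (fun x : ℝ => -x) (ae volume) (ae volume) :=
  (Measure.measurePreserving_neg (volume : Measure ℝ)).quasiMeasurePreserving.tendsto_ae

theorem tendsto_neg_left : Tendsto (fun x : ℝ => -x) (𝓝[<] 0) (𝓝[>] 0) := by
  simpa using tendsto_neg_nhdsLT (a := (0:ℝ))

theorem tendsto_neg_right : Tendsto (fun x : ℝ => -x) (𝓝[>] 0) (𝓝[<] 0) := by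
  simpa using tendsto_neg_nhdsGT (a := (0:ℝ))

theorem IsEntropic.isHull_out (h : C.IsEntropic (Ioi 0) σ) (ha : a ∈ Icc 0 C.len)
    (hb : b ∈ Icc 0 C.len) (hL : Tendsto σ (atTop ⊓ ae volume) (𝓝 a))
    (hR : Tendsto σ (𝓝[>] 0 ⊓ ae volume) (𝓝 b)) :
    (∀ᵐ x, 0 < x → C.IsHull b a x (σ x)) ∧ C.OutCond a b := by
  have h' := h.reflect
  rw [neg_Ioi, neg_zero] at h'
  have hL' : Tendsto (fun x => C.len - σ (-x)) (atBot ⊓ ae volume) (𝓝 (C.len - a)) :=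
    (hL.comp (tendsto_neg_atBot_atTop.inf tendsto_neg_ae)).const_sub _
  have hR' : Tendsto (fun x => C.len - σ (-x)) (𝓝[<] 0 ⊓ ae volume) (𝓝 (C.len - b)) :=
    (hR.comp (tendsto_neg_left.inf tendsto_neg_ae)).const_sub _
  have ha' := mem_reflect ha
  obtain ⟨h1, h2⟩ := h'.isHull_in le_rfl ha'.1 ha'.2 (mem_reflect hb) (Or.inl rfl)
    (fun _ _ h => hL'.eventually_const_lt h) (fun _ _ h => hL'.eventually_lt_const h) hR'
    ⟨le_rfl, le_rfl⟩
  refine ⟨?_, C.reflect_inCond.1 h2⟩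
  filter_upwards [tendsto_neg_ae h1] with x hx hx0
  have := hx (neg_neg_of_pos hx0)
  rwa [neg_neg, reflect_isHull] at this

theorem IsEntropic.eq_of_isHull_out {σ' : ℝ → ℝ} (h : C.IsEntropic (Ioi 0) σ)
    (h' : C.IsEntropic (Ioi 0) σ') (H : ∀ᵐ x, 0 < x → C.IsHull b a x (σ x))
    (H' : ∀ᵐ x, 0 < x → C.IsHull b a x (σ' x)) : ∀ᵐ x, 0 < x → σ x = σ' x := by
  have hr := h.reflect
  have hr' := h'.reflect
  rw [neg_Ioi, neg_zero] at hr hr'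
  have key : ∀ {ρ : ℝ → ℝ}, (∀ᵐ x, 0 < x → C.IsHull b a x (ρ x)) →
      ∀ᵐ x, x < 0 → C.reflect.IsHull (C.len - a) (C.len - b) x (C.len - ρ (-x)) := by
    intro ρ hρ
    filter_upwards [tendsto_neg_ae hρ] with x hx hx0
    have := reflect_isHull.2 (hx (neg_pos_of_neg hx0))
    rwa [neg_neg] at this
  filter_upwards [tendsto_neg_ae (hr.eq_of_isHull hr' (key H) (key H'))] with x hx hx0
  have := hx (neg_neg_of_pos hx0)
  simp only [neg_neg] at this
  linarith

theorem OutCond.exists_wave (h : C.OutCond a b) (ha : a ∈ Icc 0 C.len) (hb : b ∈ Icc 0 C.len) :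
    ∃ σ : ℝ → ℝ, C.IsEntropic (Ioi 0) σ ∧
      (Monotone (fun x => C.u (σ x)) ∨ Antitone fun x => C.u (σ x)) ∧
      Tendsto (fun x => C.v (σ x)) (𝓝[>] 0) (𝓝 (C.v b)) ∧
      Tendsto (fun x => C.u (σ x)) atTop (𝓝 (C.u a)) ∧
      (b ≤ a → (∀ τ ∈ Icc b a, C.u τ = C.u a → C.v a ≤ C.v τ) →
        Tendsto (fun x => C.v (σ x)) atTop (𝓝 (C.v a))) := by
  obtain ⟨σ, h1, h2, h3, h4, h5⟩ := (C.reflect_inCond.2 h).exists_wave (mem_reflect ha)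
    (mem_reflect hb)
  have ev : ∀ s, C.reflect.v (C.len - s) = C.v s := fun s => by simp [reflect]
  have eu : ∀ s, C.reflect.u (C.len - s) = -C.u s := fun s => by simp [reflect]
  have ev' : ∀ s, C.reflect.v s = C.v (C.len - s) := fun s => rfl
  have eu' : ∀ s, C.reflect.u s = -C.u (C.len - s) := fun s => rfl
  refine ⟨fun x => C.len - σ (-x), IsEntropic.of_reflect (by rwa [neg_Ioi, neg_zero]), ?_, ?_, ?_,
    fun hba hτ => ?_⟩
  · simp only [eu'] at h2
    rcases h2 with h2 | h2
    · exact Or.inl fun x y hxy => neg_le_neg_iff.1 (h2 (neg_le_neg hxy))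
    · exact Or.inr fun x y hxy => neg_le_neg_iff.1 (h2 (neg_le_neg hxy))
  · rw [ev] at h3
    exact h3.comp tendsto_neg_right
  · rw [eu] at h4
    simpa [eu', Function.comp_def] using (h4.comp tendsto_neg_atTop_atBot).neg
  · have := h5 (by linarith) (fun τ hτ' e => ?_)
    · rw [ev] at this
      exact this.comp tendsto_neg_atTop_atBot
    · rw [eu, eu', neg_inj] at e
      rw [ev, ev']
      exact hτ _ ⟨by linarith [hτ'.2], by linarith [hτ'.1]⟩ e

/-! ### The range of the flux at the junction -/

/-- The maximal flux through the end of a road with initial state `a`. -/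
def cap (C : FluxCurve) (a : ℝ) : ℝ := if a < C.peak then C.v a else C.v C.peak

theorem v_nonneg (h0 : C.v 0 = 0) (h1 : C.v C.len = 0) (hs : s ∈ Icc 0 C.len) : 0 ≤ C.v s := by
  rcases le_total s C.peak with h | h
  · rw [← h0]
    exact C.v_up.monotoneOn (left_mem_Icc.2 C.peak_mem.1) ⟨hs.1, h⟩ hs.1
  · rw [← h1]
    exact C.v_down.antitoneOn ⟨h, hs.2⟩ (right_mem_Icc.2 C.peak_mem.2) hs.2

theorem InCond.v_le_cap (h : C.InCond a b) (hb : b ∈ Icc 0 C.len) : C.v b ≤ C.cap a := by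
  have hp : C.peak ≤ b → C.v b ≤ C.v C.peak := fun h =>
    C.v_down.antitoneOn (left_mem_Icc.2 C.peak_mem.2) ⟨h, hb.2⟩ h
  rw [cap]
  rcases h with rfl | ⟨h1, h2⟩
  · split_ifs with h3
    · exact le_rfl
    · exact hp (not_lt.1 h3)
  · split_ifs with h3
    · exact (h2 h3).le
    · exact hp h1

/-- Fluxes below the capacity are taken on the decreasing part by the intermediate value theorem.
For `a` before the peak the capacity itself is attained by leaving the state unchanged. -/
theorem exists_inCond (h1 : C.v C.len = 0) (ha : a ∈ Icc 0 C.len) {γ : ℝ}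
    (hγ : γ ∈ Icc 0 (C.cap a)) : ∃ b ∈ Icc 0 C.len, C.InCond a b ∧ C.v b = γ := by
  have key : γ ≤ C.v C.peak → ∃ b ∈ Icc C.peak C.len, C.v b = γ := fun h =>
    intermediate_value_Icc' C.peak_mem.2 C.cont_v.continuousOn ⟨h1.trans_le hγ.1, h⟩
  have hpos := C.peak_mem.1
  have h2 := hγ.2
  rw [cap] at h2
  split_ifs at h2 with h3
  · rcases h2.eq_or_lt with h4 | h4
    · exact ⟨a, ha, Or.inl rfl, h4.symm⟩
    · obtain ⟨b, hb, e⟩ := key (h4.le.trans (C.v_up.monotoneOn ⟨ha.1, h3.le⟩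
        (right_mem_Icc.2 hpos) h3.le))
      exact ⟨b, ⟨hpos.trans hb.1, hb.2⟩, Or.inr ⟨hb.1, fun _ => e ▸ h4⟩, e⟩
  · obtain ⟨b, hb, e⟩ := key h2
    exact ⟨b, ⟨hpos.trans hb.1, hb.2⟩, Or.inr ⟨hb.1, fun h => (h3 h).elim⟩, e⟩

/-- On the decreasing part the flux determines the parameter, and a state `a` before the peak has
strictly larger flux than any other admissible trace. -/
theorem InCond.eq_of_v_eq {b' : ℝ} (h : C.InCond a b) (h' : C.InCond a b') (hb : b ∈ Icc 0 C.len)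
    (hb' : b' ∈ Icc 0 C.len) (e : C.v b = C.v b') : b = b' := by
  have key : ∀ {c c'}, c ∈ Icc 0 C.len → c' ∈ Icc 0 C.len → C.peak ≤ c → C.peak ≤ c' →
      C.v c = C.v c' → c = c' := fun hc hc' h1 h2 e =>
    C.v_down.injOn ⟨h1, hc.2⟩ ⟨h2, hc'.2⟩ e
  have mixed : ∀ {c}, a ∈ Icc 0 C.len → c ∈ Icc 0 C.len → C.v a = C.v c → C.peak ≤ c →
      (a < C.peak → C.v c < C.v a) → a = c := by
    intro c ha hc e h1 h2
    rcases lt_or_ge a C.peak with h3 | h3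
    · exact absurd e (h2 h3).ne'
    · exact key ha hc h3 h1 e
  rcases h with rfl | ⟨h1, h2⟩ <;> rcases h' with rfl | ⟨h3, h4⟩
  · rfl
  · exact mixed hb hb' e h3 h4
  · exact (mixed hb' hb e.symm h1 h2).symm
  · exact key hb hb' h1 h3 e

theorem OutCond.v_le_cap (h : C.OutCond a b) (hb : b ∈ Icc 0 C.len) :
    C.v b ≤ C.reflect.cap (C.len - a) := by
  have := (C.reflect_inCond.2 h).v_le_cap (mem_reflect hb)
  simpa [reflect] using this

theorem exists_outCond (h0 : C.v 0 = 0) (ha : a ∈ Icc 0 C.len) {γ : ℝ}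
    (hγ : γ ∈ Icc 0 (C.reflect.cap (C.len - a))) :
    ∃ b ∈ Icc 0 C.len, C.OutCond a b ∧ C.v b = γ := by
  obtain ⟨b, hb, h1, h2⟩ := exists_inCond (C := C.reflect) (by simpa [reflect] using h0)
    (mem_reflect ha) hγ
  have hb' : b ∈ Icc 0 C.len := hb
  refine ⟨C.len - b, ⟨by linarith [hb'.2], by linarith [hb'.1]⟩, ?_, h2⟩
  rw [← reflect_inCond, sub_sub_cancel]
  exact h1

theorem OutCond.eq_of_v_eq {b' : ℝ} (h : C.OutCond a b) (h' : C.OutCond a b')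
    (hb : b ∈ Icc 0 C.len) (hb' : b' ∈ Icc 0 C.len) (e : C.v b = C.v b') : b = b' := by
  have := (C.reflect_inCond.2 h).eq_of_v_eq (C.reflect_inCond.2 h') (mem_reflect hb)
    (mem_reflect hb') (by simpa [reflect] using e)
  linarith

end FluxCurve

end

noncomputable section

/-! ### States on the roads -/

theorem tendsto_div_left {t : ℝ} (ht : 0 < t) :
    Tendsto (fun x : ℝ => x / t) (𝓝[<] 0) (𝓝[<] 0) := by
  refine tendsto_nhdsWithin_iff.2 ⟨?_, ?_⟩
  · have : Tendsto (fun x : ℝ => x / t) (𝓝 0) (𝓝 (0 / t)) := tendsto_id.div_const t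
    rw [zero_div] at this
    exact this.mono_left nhdsWithin_le_nhds
  · filter_upwards [self_mem_nhdsWithin] with x hx
    exact div_neg_of_neg_of_pos hx ht

theorem tendsto_div_right {t : ℝ} (ht : 0 < t) :
    Tendsto (fun x : ℝ => x / t) (𝓝[>] 0) (𝓝[>] 0) := by
  refine tendsto_nhdsWithin_iff.2 ⟨?_, ?_⟩
  · have : Tendsto (fun x : ℝ => x / t) (𝓝 0) (𝓝 (0 / t)) := tendsto_id.div_const t
    rw [zero_div] at this
    exact this.mono_left nhdsWithin_le_nhds
  · filter_upwards [self_mem_nhdsWithin] with x hx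
    exact div_pos hx ht

namespace IsRoadState

variable {F : JumpFlux} {R : Set ℝ} {u v : ℝ → ℝ → ℝ}

theorem ray (h : IsRoadState F R u v) (hR : IsCone R) {x t : ℝ} (hx : x ∈ R) (ht : 0 < t) :
    u x t = u (x / t) 1 ∧ v x t = v (x / t) 1 := by
  have := h.centered t ht (x / t) ((hR.div_mem ht).2 hx) 1 one_pos
  rwa [mul_div_cancel₀ _ ht.ne', mul_one] at this

/-- A state on a road is given by a single function of the speed. -/
theorem exists_entropic (h : IsRoadState F R u v) (hR : IsCone R) :
    ∃ σ, F.curve.IsEntropic R σ ∧ (∀ᵐ x, x ∈ R → (u x 1, v x 1) = F.pt (σ x)) ∧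
      ∀ᵐ p : ℝ × ℝ ∂(volume.restrict (R ×ˢ Ioi 0)),
        (u p.1 p.2, v p.1 p.2) = F.pt (σ (p.1 / p.2)) := by
  obtain ⟨g, hg, hug⟩ := h.meas_u
  obtain ⟨g', hg', hvg⟩ := h.meas_v
  have := (ae_restrict_iff' (measurableSet_Ioi (a := (0:ℝ)))).1
    (hR.ae_of_ae_prod (hug.and (hvg.and h.mem_graph)))
  -- A single time at which the representatives are correct on almost every ray suffices, the state
  -- being constant along rays.
  obtain ⟨t, ht, hae⟩ : ∃ t ∈ Ioi (0:ℝ), ∀ᵐ ξ, ξ ∈ R →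
      u (ξ * t) t = g (ξ * t, t) ∧ v (ξ * t) t = g' (ξ * t, t) ∧
        (u (ξ * t) t, v (ξ * t) t) ∈ F.graph := by
    have h1 := (ae_restrict_iff' (measurableSet_Ioi (a := (0:ℝ)))).2 this
    have : (ae (volume.restrict (Ioi (0:ℝ)))).NeBot := by
      rw [ae_neBot]; simp
    obtain ⟨t, h2, h3⟩ := (h1.and (ae_restrict_mem measurableSet_Ioi)).exists
    exact ⟨t, h3, h2⟩
  have ht : 0 < t := ht
  -- Clamping keeps the parameter in range on the exceptional null set too.
  set σ : ℝ → ℝ := fun ξ =>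
    max 0 (min (F.param (g (ξ * t, t), g' (ξ * t, t))) F.curve.len) with hσ
  have hm : ∀ x, σ x ∈ Icc 0 F.curve.len := fun x =>
    ⟨le_max_left _ _, max_le F.len_nonneg (min_le_right _ _)⟩
  have hσm : Measurable σ := by
    have m1 : Measurable fun ξ : ℝ => (ξ * t, t) := by fun_prop
    have := F.measurable_param.comp
      ((hg.measurable.comp m1).prodMk (hg'.measurable.comp m1))
    exact measurable_const.max (this.min measurable_const)
  have hx : ∀ᵐ x, x ∈ R → (u x 1, v x 1) = F.pt (σ x) := by
    filter_upwards [hae] with x hx hxR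
    obtain ⟨h1, h2, h3⟩ := hx hxR
    have h4 := h.ray hR ((hR.mul_mem ht).2 hxR) ht
    rw [mul_div_cancel_right₀ _ ht.ne'] at h4
    obtain ⟨h5, h6⟩ := F.param_mem h3
    rw [← h4.1, ← h4.2]
    simp only [hσ, ← h1, ← h2]
    rw [min_eq_left h5.2, max_eq_right h5.1, h6]
  have hx2 : ∀ᵐ p : ℝ × ℝ ∂(volume.restrict (R ×ˢ Ioi 0)),
      (u p.1 p.2, v p.1 p.2) = F.pt (σ (p.1 / p.2)) := by
    filter_upwards [hR.ae_prod hx, ae_restrict_mem (hR.meas.prod measurableSet_Ioi)] with p hp hpR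
    rw [(h.ray hR hpR.1 hpR.2).1, (h.ray hR hpR.1 hpR.2).2]
    exact hp
  refine ⟨σ, FluxCurve.isEntropic_of_test hR hσm hm fun τ hτ φ hφ h0 hs => ?_, hx, hx2⟩
  refine (h.entropy (F.pt τ) (F.pt_mem hτ) φ hφ h0 hs).trans (le_of_eq (integral_congr_ae ?_))
  filter_upwards [hx2] with p hp
  have e1 : u p.1 p.2 = F.curve.u (σ (p.1 / p.2)) := congrArg Prod.fst hp
  have e2 : v p.1 p.2 = F.curve.v (σ (p.1 / p.2)) := congrArg Prod.snd hp
  rw [hp, F.orderSign_pt (hm _) hτ, e1, e2, FluxCurve.sign_mul_u (hm _) hτ]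
  rfl

theorem exists_trace_left (h : IsRoadState F (Iio 0) u v) :
    ∃ p, ∀ t, 0 < t → Tendsto (fun x => u x t) (𝓝[<] 0) (𝓝 p) := by
  obtain ⟨p, hp⟩ := (h.bv 1 one_pos).exists_tendsto_left 0
  rw [inter_self] at hp
  refine ⟨p, fun t ht => (hp.comp (tendsto_div_left ht)).congr' ?_⟩
  filter_upwards [self_mem_nhdsWithin] with x hx
  exact (h.ray isCone_Iio hx ht).1.symm

theorem exists_trace_right (h : IsRoadState F (Ioi 0) u v) :
    ∃ p, ∀ t, 0 < t → Tendsto (fun x => u x t) (𝓝[>] 0) (𝓝 p) := by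
  obtain ⟨p, hp⟩ := (h.bv 1 one_pos).exists_tendsto_right 0
  rw [inter_self] at hp
  refine ⟨p, fun t ht => (hp.comp (tendsto_div_right ht)).congr' ?_⟩
  filter_upwards [self_mem_nhdsWithin] with x hx
  exact (h.ray isCone_Ioi hx ht).1.symm

end IsRoadState

theorem neBot_atTop_ae : (atTop ⊓ ae (volume : Measure ℝ)).NeBot :=
  (neBot_atBot_ae.map _).mono (tendsto_neg_atBot_atTop.inf FluxCurve.tendsto_neg_ae)

theorem neBot_ae_right : (𝓝[>] (0:ℝ) ⊓ ae volume).NeBot :=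
  (FluxCurve.neBot_ae_left.map _).mono (FluxCurve.tendsto_neg_left.inf FluxCurve.tendsto_neg_ae)

/-- The variation of a monotone reparametrization is at most that of the identity on `[0, M]`. -/
theorem boundedVariationOn_of_mem {f : ℝ → ℝ} {M : ℝ} (h : Monotone f ∨ Antitone f)
    (hf : ∀ x, f x ∈ Icc 0 M) (s : Set ℝ) : BoundedVariationOn f s := by
  have hM := BoundedVariationOn.id_Icc 0 M
  rcases h with h | h
  · exact ne_top_of_le_ne_top hM
      (eVariationOn.comp_le_of_monotoneOn id f (h.monotoneOn s) fun x _ => hf x)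
  · exact ne_top_of_le_ne_top hM
      (eVariationOn.comp_le_of_antitoneOn id f (h.antitoneOn s) fun x _ => hf x)

/-- A monotone entropy solution along the curve is a state on the road. -/
theorem FluxCurve.IsEntropic.isRoadState {F : JumpFlux} {R : Set ℝ} {σ : ℝ → ℝ}
    (h : F.curve.IsEntropic R σ) (hR : IsCone R)
    (hm : Monotone (fun x => F.curve.u (σ x)) ∨ Antitone fun x => F.curve.u (σ x)) :
    IsRoadState F R (fun x t => F.curve.u (σ (x / t))) (fun x t => F.curve.v (σ (x / t))) := by
  have mσ : Measurable fun p : ℝ × ℝ => σ (p.1 / p.2) :=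
    h.meas.comp (measurable_fst.div measurable_snd)
  refine ⟨(F.curve.cont_u.measurable.comp mσ).aestronglyMeasurable,
    (F.curve.cont_v.measurable.comp mσ).aestronglyMeasurable,
    Eventually.of_forall fun p => F.pt_mem (h.mem _), fun t ht => ?_, fun c hc x _ t _ => ?_,
    fun k hk φ hφ h0 hs => ?_⟩
  · refine boundedVariationOn_of_mem (M := F.umax) (hm.imp ?_ ?_)
      (fun x => JumpFlux.curve_u_mem (h.mem _)) R
    · exact fun hm x y hxy => hm (div_le_div_of_nonneg_right hxy ht.le)
    · exact fun hm x y hxy => hm (div_le_div_of_nonneg_right hxy ht.le)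
  · simp only [mul_div_mul_left _ _ hc.ne', and_self]
  · obtain ⟨hτ, e⟩ := F.param_mem hk
    refine (h.test_nonneg hR hτ hφ h0 hs).trans (le_of_eq ?_)
    congr 1; ext p
    have e1 : F.curve.u (F.param k) = k.1 := congrArg Prod.fst e
    have e2 : F.curve.v (F.param k) = k.2 := congrArg Prod.snd e
    have e3 := F.orderSign_pt (h.mem (p.1 / p.2)) hτ
    rw [e] at e3
    rw [FluxCurve.sign_mul_u (h.mem _) hτ, ← e3, e1, e2]
    rfl

end

noncomputable section

/-! ### Maximization of the flux through the junction -/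

section Polytope

variable {n m : ℕ}

/-- The incoming fluxes compatible with the capacities `c`, `d` of the roads. -/
def feasible (β : Matrix (Fin n) (Fin m) ℝ) (c : Fin n → ℝ) (d : Fin m → ℝ) : Set (Fin n → ℝ) :=
  {γ | (∀ i, γ i ∈ Icc 0 (c i)) ∧ ∀ j, ∑ i, β i j * γ i ∈ Icc 0 (d j)}

variable {β : Matrix (Fin n) (Fin m) ℝ} {c : Fin n → ℝ} {d : Fin m → ℝ}

theorem exists_max_feasible (hc : ∀ i, 0 ≤ c i) (hd : ∀ j, 0 ≤ d j) :
    ∃ γ ∈ feasible β c d, ∀ γ' ∈ feasible β c d, ∑ i, γ' i ≤ ∑ i, γ i := by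
  have hcpt : IsCompact (feasible β c d) := by
    refine (isCompact_univ_pi fun i => isCompact_Icc (a := 0) (b := c i)).of_isClosed_subset ?_
      fun γ hγ i _ => hγ.1 i
    rw [feasible, ofPred_and, ofPred_forall, ofPred_forall]
    refine IsClosed.inter (isClosed_iInter fun i => ?_) (isClosed_iInter fun j => ?_)
    · exact isClosed_Icc.preimage (continuous_apply i)
    · exact isClosed_Icc.preimage (by fun_prop : Continuous fun γ : Fin n → ℝ => ∑ i, β i j * γ i)
  exact hcpt.exists_isMaxOn ⟨0, fun i => by simpa using hc i, fun j => by simpa using hd j⟩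
    (by fun_prop : Continuous fun γ : Fin n → ℝ => ∑ i, γ i).continuousOn

theorem inner_normalVec_inl (i : Fin n) (γ : EuclideanSpace ℝ (Fin n)) :
    inner ℝ (normalVec β (Sum.inl i)) γ = γ i := by
  simp [normalVec, EuclideanSpace.inner_single_left]

theorem inner_normalVec_inr (j : Fin m) (γ : EuclideanSpace ℝ (Fin n)) :
    inner ℝ (normalVec β (Sum.inr j)) γ = ∑ i, β i j * γ i := by
  simp [normalVec, PiLp.inner_apply, mul_comm]

theorem inner_one (γ : EuclideanSpace ℝ (Fin n)) :
    inner ℝ (WithLp.toLp 2 (fun _ => 1) : EuclideanSpace ℝ (Fin n)) γ = ∑ i, γ i := by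
  simp [PiLp.inner_apply]

theorem mem_feasible_iff (γ : EuclideanSpace ℝ (Fin n)) : (γ : Fin n → ℝ) ∈ feasible β c d ↔
    ∀ k, inner ℝ (normalVec β k) γ ∈ Icc 0 (Sum.elim c d k) := by
  rw [Sum.forall]
  simp only [inner_normalVec_inl, inner_normalVec_inr, Sum.elim_inl, Sum.elim_inr]
  rfl

/-- The vector `(1, …, 1)` is not a combination of normals orthogonal to a common vector. -/
theorem IsDistributionMatrix.one_notMem_span (hβ : IsDistributionMatrix β) (hn : 1 ≤ n)
    {S : Set (Fin n ⊕ Fin m)} {w : EuclideanSpace ℝ (Fin n)} (hw : w ≠ 0)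
    (hS : ∀ k ∈ S, inner ℝ (normalVec β k) w = 0) :
    (WithLp.toLp 2 (fun _ => 1) : EuclideanSpace ℝ (Fin n)) ∉
      Submodule.span ℝ (normalVec β '' S) := by
  intro h1
  -- A linearly independent family of the normals with the same span has fewer than `n` members,
  -- because the span lies in the orthogonal complement of `w`. Genericity therefore applies to it.
  obtain ⟨κ, a, hinj, hspan, hli⟩ := exists_linearIndependent' ℝ (fun k : S => normalVec β k)
  have hr : range (fun k : S => normalVec β k) = normalVec β '' S := by
    rw [image_eq_range]
  rw [hr] at hspan
  have : Finite κ := Finite.of_injective _ hinj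
  have := Fintype.ofFinite κ
  set I : Finset (Fin n ⊕ Fin m) := Finset.univ.map ⟨fun x => (a x : Fin n ⊕ Fin m),
    Subtype.val_injective.comp hinj⟩ with hI
  have hcard : I.card = Fintype.card κ := by rw [hI, Finset.card_map]; rfl
  have hlt : Fintype.card κ < n := by
    rw [← finrank_span_eq_card hli, hspan]
    have hle : Submodule.span ℝ (normalVec β '' S) < ⊤ := by
      refine lt_of_le_of_ne le_top fun htop => hw ?_
      have hle : Submodule.span ℝ (normalVec β '' S) ≤ (Submodule.span ℝ {w})ᗮ := by
        rw [Submodule.span_le]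
        rintro _ ⟨k, hk, rfl⟩
        rw [SetLike.mem_coe, Submodule.mem_orthogonal_singleton_iff_inner_left]
        exact hS k hk
      rw [htop] at hle
      have := hle (Submodule.mem_top (x := w))
      rw [Submodule.mem_orthogonal_singleton_iff_inner_left] at this
      exact inner_self_eq_zero.1 this
    have := Submodule.finrank_lt hle.ne
    rwa [finrank_euclideanSpace_fin] at this
  refine hβ.generic I ?_ (by rwa [hcard]) ?_
  · by_contra hne
    rw [Finset.not_nonempty_iff_eq_empty] at hne
    rw [hne, Finset.card_empty] at hcard
    have : IsEmpty κ := Fintype.card_eq_zero_iff.1 hcard.symm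
    rw [← hspan, range_eq_empty, Submodule.span_empty, Submodule.mem_bot] at h1
    have := congrArg (fun γ : EuclideanSpace ℝ (Fin n) => γ ⟨0, hn⟩) h1
    simp at this
  · rw [← hspan] at h1
    refine Submodule.span_le.2 ?_ h1
    rintro _ ⟨x, rfl⟩
    rw [SetLike.mem_coe, Submodule.mem_orthogonal']
    intro y hy
    have hx : (a x : Fin n ⊕ Fin m) ∈ I := by simp [hI]
    have := (Submodule.mem_iInf _).1 ((Submodule.mem_iInf _).1 hy (a x)) hx
    exact (Submodule.mem_orthogonal_singleton_iff_inner_right).1 this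

/-- A constraint active at the midpoint of two maximizers is active at both, so its normal is
orthogonal to their difference. By genericity `(1, …, 1)` is not in the span `K` of these normals,
and its component `p` orthogonal to `K` is nonzero. A small step from the midpoint along `p`
preserves the active constraints, does not violate the others, and increases the total flux, a
contradiction. -/
theorem IsDistributionMatrix.max_feasible_unique (hβ : IsDistributionMatrix β) (hn : 1 ≤ n)
    {γ γ' : Fin n → ℝ} (h : γ ∈ feasible β c d) (h' : γ' ∈ feasible β c d)
    (hm : ∀ δ ∈ feasible β c d, ∑ i, δ i ≤ ∑ i, γ i)
    (hm' : ∀ δ ∈ feasible β c d, ∑ i, δ i ≤ ∑ i, γ' i) : γ = γ' := by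
  by_contra hne
  set N := normalVec β with hN
  set e := Sum.elim c d with he
  set one : EuclideanSpace ℝ (Fin n) := WithLp.toLp 2 fun _ => 1 with hone
  set g : EuclideanSpace ℝ (Fin n) := WithLp.toLp 2 γ with hg
  set g' : EuclideanSpace ℝ (Fin n) := WithLp.toLp 2 γ' with hg'
  have hw : g - g' ≠ 0 := fun h0 => hne ((WithLp.toLp_injective 2) (sub_eq_zero.1 h0))
  have hf := (mem_feasible_iff (β := β) (c := c) (d := d) g).1 h
  have hf' := (mem_feasible_iff (β := β) (c := c) (d := d) g').1 h'
  have hs : inner ℝ one g = inner ℝ one g' := by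
    rw [inner_one, inner_one]; exact le_antisymm (hm' _ h) (hm _ h')
  set x : EuclideanSpace ℝ (Fin n) := (1 / 2 : ℝ) • (g + g') with hx
  have hxk : ∀ k, inner ℝ (N k) x = (inner ℝ (N k) g + inner ℝ (N k) g') / 2 := by
    intro k
    rw [hx, inner_smul_right, inner_add_right]; ring
  set S : Set (Fin n ⊕ Fin m) := {k | inner ℝ (N k) x = 0 ∨ inner ℝ (N k) x = e k} with hS
  have hSw : ∀ k ∈ S, inner ℝ (N k) (g - g') = 0 := by
    intro k hk
    have h1 := hf k
    have h2 := hf' k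
    rw [inner_sub_right]
    rcases hk with hk | hk <;> rw [hxk] at hk <;> linarith [h1.1, h1.2, h2.1, h2.2]
  have hspan := hβ.one_notMem_span hn hw hSw
  set K := Submodule.span ℝ (N '' S) with hK
  set p : EuclideanSpace ℝ (Fin n) := one - K.starProjection one with hp
  have hpo : p ∈ Kᗮ := K.sub_starProjection_mem_orthogonal one
  have hp0 : p ≠ 0 := by
    intro h0
    refine hspan ?_
    have : one = K.starProjection one := sub_eq_zero.1 h0
    change one ∈ K
    rw [this]
    exact K.starProjection_apply_mem one
  have hpos : 0 < inner ℝ one p := by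
    have h1 : inner ℝ (K.starProjection one) p = 0 :=
      (Submodule.mem_orthogonal K p).1 hpo _ (K.starProjection_apply_mem one)
    have h2 : inner ℝ one p = inner ℝ p p := by
      conv_rhs => rw [hp, inner_sub_left, ← hp, h1, sub_zero]
    rw [h2]
    exact real_inner_self_pos.2 hp0
  have hev : ∀ᶠ ε : ℝ in 𝓝[>] 0, ∀ k, inner ℝ (N k) (x + ε • p) ∈ Icc 0 (e k) := by
    rw [eventually_all]
    intro k
    have hmem : inner ℝ (N k) x ∈ Icc 0 (e k) := by
      rw [hxk]
      have h1 := hf k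
      have h2 := hf' k
      exact ⟨by linarith [h1.1, h2.1], by linarith [h1.2, h2.2]⟩
    by_cases hk : k ∈ S
    · refine Eventually.of_forall fun ε => ?_
      have : inner ℝ (N k) p = 0 :=
        (Submodule.mem_orthogonal K p).1 hpo _ (Submodule.subset_span ⟨k, hk, rfl⟩)
      rw [inner_add_right (N k) x, real_inner_smul_right (N k) p, this, mul_zero, add_zero]
      exact hmem
    · have h1 : inner ℝ (N k) x ∈ Ioo 0 (e k) :=
        ⟨lt_of_le_of_ne hmem.1 fun h => hk (Or.inl h.symm),
          lt_of_le_of_ne hmem.2 fun h => hk (Or.inr h)⟩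
      have hcont : Tendsto (fun ε : ℝ => inner ℝ (N k) (x + ε • p)) (𝓝 0)
          (𝓝 (inner ℝ (N k) (x + (0:ℝ) • p))) :=
        (by fun_prop : Continuous fun ε : ℝ => inner ℝ (N k) (x + ε • p)).tendsto 0
      rw [zero_smul, add_zero] at hcont
      filter_upwards [(hcont.mono_left nhdsWithin_le_nhds).eventually (Ioo_mem_nhds h1.1 h1.2)]
        with ε hε
      exact ⟨hε.1.le, hε.2.le⟩
  obtain ⟨ε, h1, h2⟩ := (hev.and self_mem_nhdsWithin).exists
  have h2 : 0 < ε := h2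
  have h3 := hm _ ((mem_feasible_iff (x + ε • p)).2 h1)
  rw [← inner_one, ← hone, inner_add_right one x, real_inner_smul_right one p, hx, real_inner_smul_right,
    inner_add_right one g, ← hs] at h3
  have h4 : inner ℝ one g = ∑ i, γ i := inner_one g
  have := mul_pos h2 hpos
  linarith

end Polytope

end

noncomputable section

/-! ### Boundary behaviour of the states on the roads -/

/-- A test function concentrated away from the junction. -/
theorem exists_test_left : ∃ θ : ℝ → ℝ → ℝ, IsTest θ ∧ (∀ t, θ 0 t = 0 ∧ dx θ 0 t = 0) ∧
    ∫ x in Iio (0:ℝ), θ x 0 ≠ 0 := by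
  let b : ContDiffBump (0:ℝ) := ⟨1 / 2, 1, by norm_num, by norm_num⟩
  have hb : ∀ {x : ℝ}, 1 ≤ |x| → b x = 0 := fun {x} hx =>
    b.zero_of_le_dist (by rw [Real.dist_eq, sub_zero]; exact hx)
  have hθ : ∀ x t : ℝ, -1 ≤ x → b (x + 2) * b t = 0 := fun x t hx => by
    rw [hb (by rw [abs_of_nonneg] <;> linarith), zero_mul]
  refine ⟨fun x t => b (x + 2) * b t, ⟨?_, ?_⟩, fun t => ⟨hθ 0 t (by norm_num), ?_⟩, ?_⟩
  · exact (b.contDiff.comp (contDiff_fst.add contDiff_const)).mul (b.contDiff.comp contDiff_snd)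
  · refine HasCompactSupport.intro ((isCompact_Icc (a := (-3:ℝ)) (b := -1)).prod
      (isCompact_Icc (a := (-1:ℝ)) (b := 1))) fun p hp => ?_
    by_cases h1 : p.1 ∈ Icc (-3:ℝ) (-1)
    · have h2 : p.2 ∉ Icc (-1:ℝ) 1 := fun h => hp ⟨h1, h⟩
      change b (p.1 + 2) * b p.2 = 0
      rw [hb (x := p.2) ?_, mul_zero]
      by_contra! hc
      exact h2 ⟨(abs_lt.1 hc).1.le, (abs_lt.1 hc).2.le⟩
    · change b (p.1 + 2) * b p.2 = 0
      rw [hb (x := p.1 + 2) ?_, zero_mul]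
      by_contra! hc
      exact h1 ⟨by linarith [(abs_lt.1 hc).1], by linarith [(abs_lt.1 hc).2]⟩
  · have : (fun y : ℝ => b (y + 2) * b t) =ᶠ[𝓝 0] fun _ => 0 := by
      filter_upwards [Ioi_mem_nhds (show (-1:ℝ) < 0 by norm_num)] with y hy
      exact hθ y t (le_of_lt hy)
    rw [dx, this.deriv_eq, deriv_const]
  · rw [setIntegral_eq_integral_of_forall_compl_eq_zero fun x hx =>
      hθ x 0 (by linarith [not_lt.1 (show ¬ x < 0 from hx)]), integral_mul_const,
      integral_add_right_eq_self (fun x => b x), b.one_of_mem_closedBall (by simp [b.rIn_pos.le]),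
      mul_one]
    exact b.integral_pos.ne'

theorem exists_test_right : ∃ θ : ℝ → ℝ → ℝ, IsTest θ ∧ (∀ t, θ 0 t = 0 ∧ dx θ 0 t = 0) ∧
    ∫ x in Ioi (0:ℝ), θ x 0 ≠ 0 := by
  obtain ⟨θ, h1, h2, h3⟩ := exists_test_left
  refine ⟨fun x t => θ (-x) t, FluxCurve.isTest_comp_neg h1, fun t => ⟨?_, ?_⟩, ?_⟩
  · change θ (-0) t = 0
    rw [neg_zero]; exact (h2 t).1
  · have : dx (fun x t => θ (-x) t) 0 t = -dx θ (-0) t := deriv_comp_neg (fun y => θ y t) 0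
    rw [this, neg_zero, (h2 t).2, neg_zero]
  · rwa [integral_comp_neg_Ioi (c := 0) (f := fun x => θ x 0), neg_zero,
      integral_Iic_eq_integral_Iio]

variable {F : JumpFlux} {u v : ℝ → ℝ → ℝ} {σ : ℝ → ℝ} {γ u₀ a b : ℝ}

/-- The states on an incoming road are given by the function `σ` of the speed, with flux trace `γ`,
parameter `b` at the junction and density `u₀` far away. -/
structure InProfile (F : JumpFlux) (u v : ℝ → ℝ → ℝ) (γ : ℝ) (σ : ℝ → ℝ) (b u₀ : ℝ) : Prop where
  entropic : F.curve.IsEntropic (Iio 0) σ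
  ae_eq : ∀ᵐ p : ℝ × ℝ ∂(volume.restrict (Iio 0 ×ˢ Ioi 0)),
    (u p.1 p.2, v p.1 p.2) = F.pt (σ (p.1 / p.2))
  mem : b ∈ Icc 0 F.curve.len
  flux : F.curve.v b = γ
  trace : ∀ t, 0 < t → Tendsto (fun x => u x t) (𝓝[<] 0) (𝓝 (F.curve.u b))
  tendsto_zero : Tendsto σ (𝓝[<] 0 ⊓ ae volume) (𝓝 b)
  tendsto_far : Tendsto (fun x => F.curve.u (σ x)) (atBot ⊓ ae volume) (𝓝 u₀)

/-- The mirror image of `InProfile`. -/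
structure OutProfile (F : JumpFlux) (u v : ℝ → ℝ → ℝ) (γ : ℝ) (σ : ℝ → ℝ) (b u₀ : ℝ) : Prop where
  entropic : F.curve.IsEntropic (Ioi 0) σ
  ae_eq : ∀ᵐ p : ℝ × ℝ ∂(volume.restrict (Ioi 0 ×ˢ Ioi 0)),
    (u p.1 p.2, v p.1 p.2) = F.pt (σ (p.1 / p.2))
  ae_eq_one : ∀ᵐ x, x ∈ Ioi (0:ℝ) → (u x 1, v x 1) = F.pt (σ x)
  mem : b ∈ Icc 0 F.curve.len
  flux : F.curve.v b = γ
  trace : ∀ t, 0 < t → Tendsto (fun x => u x t) (𝓝[>] 0) (𝓝 (F.curve.u b))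
  tendsto_zero : Tendsto σ (𝓝[>] 0 ⊓ ae volume) (𝓝 b)
  tendsto_far : Tendsto (fun x => F.curve.u (σ x)) (atTop ⊓ ae volume) (𝓝 u₀)

/-- Bounded variation gives limits of the density at the junction and far away; with the flux trace
also the parameter converges at the junction. Here `u₀` is merely the far limit, identified with the
data later by the weak formulation. -/
theorem IsRoadState.exists_inProfile (h : IsRoadState F (Iio 0) u v)
    (hγ : Tendsto (fun x => v x 1) (𝓝[<] 0) (𝓝 γ)) : ∃ σ b u₀, InProfile F u v γ σ b u₀ := by
  obtain ⟨σ, h1, h2, h3⟩ := h.exists_entropic isCone_Iio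
  obtain ⟨p, hp⟩ := h.exists_trace_left
  obtain ⟨u₀, hu₀⟩ := (h.bv 1 one_pos).exists_tendsto_atBot
  rw [inf_eq_right.2 (le_principal_iff.2 (Iio_mem_atBot 0))] at hu₀
  have := FluxCurve.neBot_ae_left
  have e1 : ∀ᶠ x in 𝓝[<] 0 ⊓ ae volume, (u x 1, v x 1) = F.pt (σ x) := by
    filter_upwards [h2.filter_mono inf_le_right,
      mem_inf_of_left self_mem_nhdsWithin] with x hx hx0
    exact hx hx0
  have e2 : ∀ᶠ x in atBot ⊓ ae volume, (u x 1, v x 1) = F.pt (σ x) := by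
    filter_upwards [h2.filter_mono inf_le_right,
      mem_inf_of_left (Iio_mem_atBot (0:ℝ))] with x hx hx0
    exact hx hx0
  obtain ⟨b, hb, hbu, hbv, hσ⟩ := FluxCurve.exists_tendsto h1.mem
    (((hp 1 one_pos).mono_left inf_le_left).congr' (e1.mono fun x hx => congrArg Prod.fst hx))
    ((hγ.mono_left inf_le_left).congr' (e1.mono fun x hx => congrArg Prod.snd hx))
  exact ⟨σ, b, u₀, h1, h3, hb, hbv, by rwa [hbu], hσ,
    (hu₀.mono_left inf_le_left).congr' (e2.mono fun x hx => congrArg Prod.fst hx)⟩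

theorem IsRoadState.exists_outProfile (h : IsRoadState F (Ioi 0) u v)
    (hγ : Tendsto (fun x => v x 1) (𝓝[>] 0) (𝓝 γ)) : ∃ σ b u₀, OutProfile F u v γ σ b u₀ := by
  obtain ⟨σ, h1, h2, h3⟩ := h.exists_entropic isCone_Ioi
  obtain ⟨p, hp⟩ := h.exists_trace_right
  obtain ⟨u₀, hu₀⟩ := (h.bv 1 one_pos).exists_tendsto_atTop
  rw [inf_eq_right.2 (le_principal_iff.2 (Ioi_mem_atTop 0))] at hu₀
  have := neBot_ae_right
  have e1 : ∀ᶠ x in 𝓝[>] 0 ⊓ ae volume, (u x 1, v x 1) = F.pt (σ x) := by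
    filter_upwards [h2.filter_mono inf_le_right,
      mem_inf_of_left self_mem_nhdsWithin] with x hx hx0
    exact hx hx0
  have e2 : ∀ᶠ x in atTop ⊓ ae volume, (u x 1, v x 1) = F.pt (σ x) := by
    filter_upwards [h2.filter_mono inf_le_right,
      mem_inf_of_left (Ioi_mem_atTop (0:ℝ))] with x hx hx0
    exact hx hx0
  obtain ⟨b, hb, hbu, hbv, hσ⟩ := FluxCurve.exists_tendsto h1.mem
    (((hp 1 one_pos).mono_left inf_le_left).congr' (e1.mono fun x hx => congrArg Prod.fst hx))
    ((hγ.mono_left inf_le_left).congr' (e1.mono fun x hx => congrArg Prod.snd hx))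
  exact ⟨σ, b, u₀, h1, h3, h2, hb, hbv, by rwa [hbu], hσ,
    (hu₀.mono_left inf_le_left).congr' (e2.mono fun x hx => congrArg Prod.fst hx)⟩

namespace InProfile

theorem weak_identity (h : InProfile F u v γ σ b u₀) {φ : ℝ → ℝ → ℝ} (hφ : IsTest φ) :
    ∫ p in Iio (0:ℝ) ×ˢ Ioi (0:ℝ), (u p.1 p.2 * dt φ p.1 p.2 + v p.1 p.2 * dx φ p.1 p.2) =
      γ * (∫ t in Ioi (0:ℝ), φ 0 t) - u₀ * ∫ x in Iio (0:ℝ), φ x 0 := by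
  have hv : Tendsto (fun x => F.curve.v (σ x)) (𝓝[<] 0 ⊓ ae volume) (𝓝 γ) :=
    h.flux ▸ (F.curve.cont_v.tendsto b).comp h.tendsto_zero
  rw [← h.entropic.weak_identity h.tendsto_far hv hφ]
  refine integral_congr_ae ?_
  filter_upwards [h.ae_eq] with p hp
  rw [show u p.1 p.2 = _ from congrArg Prod.fst hp, show v p.1 p.2 = _ from congrArg Prod.snd hp]
  rfl

/-- Far away only the density is known. If it is `u*`, the parameter is confined merely to the
vertical part, which is the interval `[s₁, s₂]` of `FluxCurve.IsEntropic.isHull`; this is why `a`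
may be any state over `u₀`. -/
theorem isHull (h : InProfile F u v γ σ b u₀) (ha : a ∈ Icc 0 F.curve.len)
    (hau : F.curve.u a = u₀) :
    (∀ᵐ x, x < 0 → F.curve.IsHull a b x (σ x)) ∧ F.curve.InCond a b := by
  have hJ := F.jumpSize_pos
  have fiber : ∀ {s₁ s₂ : ℝ}, s₁ ≤ s₂ → 0 ≤ s₁ → s₂ ≤ F.curve.len →
      (s₁ = s₂ ∨ (F.curve.peak ≤ s₁ ∧ F.curve.u s₁ = F.curve.u s₂)) → a ∈ Icc s₁ s₂ →
      (∀ τ ∈ Icc 0 F.curve.len, τ < s₁ → F.curve.u τ < u₀) →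
      (∀ τ ∈ Icc 0 F.curve.len, s₂ < τ → u₀ < F.curve.u τ) →
      (∀ᵐ x, x < 0 → F.curve.IsHull a b x (σ x)) ∧ F.curve.InCond a b := by
    intro s₁ s₂ h12 h1 h2 hs has hl hr
    refine h.entropic.isHull_in h12 h1 h2 h.mem hs (fun τ hτ hlt => ?_) (fun τ hτ hlt => ?_)
      h.tendsto_zero has
    · filter_upwards [h.tendsto_far.eventually_const_lt (hl τ hτ hlt)] with x hx
      exact F.monotone_curveU.reflect_lt hx
    · filter_upwards [h.tendsto_far.eventually_lt_const (hr τ hτ hlt)] with x hx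
      exact F.monotone_curveU.reflect_lt hx
  have hlen : F.ustar + F.jumpSize ≤ F.curve.len := by
    rw [F.len_eq]; linarith [F.ustar_lt]
  by_cases hu : u₀ = F.ustar
  · have eu : ∀ s, F.ustar ≤ s → s ≤ F.ustar + F.jumpSize → F.curve.u s = u₀ := fun s h1 h2 =>
      (JumpFlux.curveU_mid h1 h2).trans hu.symm
    refine fiber (s₁ := F.ustar) (s₂ := F.ustar + F.jumpSize) (by linarith) F.ustar_pos.le hlen
      (Or.inr ⟨le_rfl, ?_⟩) ⟨?_, ?_⟩ (fun τ hτ hlt => ?_) (fun τ hτ hlt => ?_)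
    · rw [eu _ le_rfl (by linarith), eu _ (by linarith) le_rfl]
    · by_contra! hc
      rw [JumpFlux.curve_u_of_le hc.le] at hau
      linarith
    · by_contra! hc
      have : F.curve.u a = _ := JumpFlux.curveU_right hc.le
      linarith
    · rw [JumpFlux.curve_u_of_le hlt.le]; linarith
    · have : F.curve.u τ = _ := JumpFlux.curveU_right hlt.le
      linarith
  · have hne : ∀ {s τ : ℝ}, s < τ → F.curve.u s = F.curve.u τ → F.curve.u s = F.ustar := by
      intro s τ hlt e
      obtain ⟨h1, h2⟩ := F.eq_ustar_of_u_eq hlt e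
      exact JumpFlux.curveU_mid h1 (by linarith)
    refine fiber le_rfl ha.1 ha.2 (Or.inl rfl) ⟨le_rfl, le_rfl⟩ (fun τ hτ hlt => ?_)
      (fun τ hτ hlt => ?_)
    · refine lt_of_le_of_ne (hau ▸ F.curve.mono_u hτ ha hlt.le) fun e => hu ?_
      rw [← e]; exact hne hlt (e.trans hau.symm)
    · refine lt_of_le_of_ne (hau ▸ F.curve.mono_u ha hτ hlt.le) fun e => hu ?_
      rw [← hau]; exact hne hlt (hau.trans e)

end InProfile

namespace OutProfile

theorem weak_identity (h : OutProfile F u v γ σ b u₀) {φ : ℝ → ℝ → ℝ} (hφ : IsTest φ) :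
    ∫ p in Ioi (0:ℝ) ×ˢ Ioi (0:ℝ), (u p.1 p.2 * dt φ p.1 p.2 + v p.1 p.2 * dx φ p.1 p.2) =
      -γ * (∫ t in Ioi (0:ℝ), φ 0 t) - u₀ * ∫ x in Ioi (0:ℝ), φ x 0 := by
  have hv : Tendsto (fun x => F.curve.v (σ x)) (𝓝[>] 0 ⊓ ae volume) (𝓝 γ) :=
    h.flux ▸ (F.curve.cont_v.tendsto b).comp h.tendsto_zero
  rw [← h.entropic.weak_identity_out h.tendsto_far hv hφ]
  refine integral_congr_ae ?_
  filter_upwards [h.ae_eq] with p hp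
  rw [show u p.1 p.2 = _ from congrArg Prod.fst hp, show v p.1 p.2 = _ from congrArg Prod.snd hp]
  rfl

/-- Unlike on an incoming road, different states over `u*` ahead allow different traces. The
prescribed limit of the flux is what makes the parameter converge to `a`. -/
theorem isHull (h : OutProfile F u v γ σ b u₀) (ha : a ∈ Icc 0 F.curve.len)
    (hau : F.curve.u a = u₀)
    (hV : u₀ = F.ustar → Tendsto (fun x => v x 1) atTop (𝓝 (F.curve.v a))) :
    (∀ᵐ x, 0 < x → F.curve.IsHull b a x (σ x)) ∧ F.curve.OutCond a b := by
  refine h.entropic.isHull_out ha h.mem ?_ h.tendsto_zero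
  have := neBot_atTop_ae
  by_cases hu : u₀ = F.ustar
  · have e : ∀ᶠ x in atTop ⊓ ae volume, (u x 1, v x 1) = F.pt (σ x) := by
      filter_upwards [h.ae_eq_one.filter_mono inf_le_right,
        mem_inf_of_left (Ioi_mem_atTop (0:ℝ))] with x hx hx0
      exact hx hx0
    obtain ⟨s, hs, hsu, hsv, hσ⟩ := FluxCurve.exists_tendsto h.entropic.mem h.tendsto_far
      (((hV hu).mono_left inf_le_left).congr' (e.mono fun x hx => congrArg Prod.snd hx))
    rwa [F.curve.inj s hs a ha (hsu.trans hau.symm) hsv] at hσ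
  · have hne : ∀ {s τ : ℝ}, s < τ → F.curve.u s = F.curve.u τ → F.curve.u s = F.ustar := by
      intro s τ hlt e
      obtain ⟨h1, h2⟩ := F.eq_ustar_of_u_eq hlt e
      exact JumpFlux.curveU_mid h1 (by linarith)
    refine tendsto_order.2 ⟨fun τ hτ => ?_, fun τ hτ => ?_⟩
    · have : F.curve.u τ < u₀ := by
        refine lt_of_le_of_ne (hau ▸ F.monotone_curveU hτ.le) fun e => hu ?_
        rw [← e]; exact hne hτ (e.trans hau.symm)
      filter_upwards [h.tendsto_far.eventually_const_lt this] with x hx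
      exact F.monotone_curveU.reflect_lt hx
    · have : u₀ < F.curve.u τ := by
        refine lt_of_le_of_ne (hau ▸ F.monotone_curveU hτ.le) fun e => hu ?_
        rw [← hau]; exact hne hτ (hau.trans e)
      filter_upwards [h.tendsto_far.eventually_lt_const this] with x hx
      exact F.monotone_curveU.reflect_lt hx

end OutProfile

end

noncomputable section

/-! ### The junction -/

namespace JumpFlux

variable (F : JumpFlux)

/-- The parameter of the initial state on a road. -/
def base (u₀ : ℝ) (c : Bool) : ℝ := F.param (u₀, F.aheadFlux u₀ c)

variable {F} {u₀ a b c' ξ : ℝ} {c : Bool}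

theorem base_mem (h : u₀ ∈ Icc 0 F.umax) : F.base u₀ c ∈ Icc 0 F.curve.len :=
  (F.param_mem (aheadFlux_mem c h)).1

theorem pt_base (h : u₀ ∈ Icc 0 F.umax) : F.pt (F.base u₀ c) = (u₀, F.aheadFlux u₀ c) :=
  (F.param_mem (aheadFlux_mem c h)).2

theorem curve_u_base (h : u₀ ∈ Icc 0 F.umax) : F.curve.u (F.base u₀ c) = u₀ :=
  congrArg Prod.fst (pt_base h)

theorem curve_v_base (h : u₀ ∈ Icc 0 F.umax) : F.curve.v (F.base u₀ c) = F.aheadFlux u₀ c :=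
  congrArg Prod.snd (pt_base h)

theorem curve_v_nonneg {s : ℝ} (hs : s ∈ Icc 0 F.curve.len) : 0 ≤ F.curve.v s :=
  FluxCurve.v_nonneg F.curve_v_zero F.curve_v_len hs

theorem isHullState_iff_eq (ha : a ∈ Icc 0 F.curve.len) (hb : b ∈ Icc 0 F.curve.len)
    (hc : c' ∈ Icc 0 F.curve.len) (H : ∀ s, F.curve.IsHull a b ξ s ↔ s = c') (p : ℝ × ℝ) :
    F.IsHullState (F.pt a) (F.pt b) ξ p ↔ p = F.pt c' := by
  constructor
  · intro h
    obtain ⟨hm, e⟩ := F.param_mem h.1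
    rw [← e, F.isHullState_pt ha hb hm, H] at h
    rw [← e, h]
  · rintro rfl
    rw [F.isHullState_pt ha hb hc, H]

end JumpFlux

section Junction

variable {F : JumpFlux} {n m : ℕ} {β : Matrix (Fin n) (Fin m) ℝ} {uin₀ : Fin n → ℝ}
  {uout₀ : Fin m → ℝ} {congested : Fin m → Bool} {s s' : JunctionState n m}
  {γin γin' : Fin n → ℝ} {γout γout' : Fin m → ℝ}

theorem HasFluxTraces.unique (h : HasFluxTraces s γin γout) (h' : HasFluxTraces s γin' γout') :
    γin = γin' ∧ γout = γout' :=
  ⟨funext fun i => tendsto_nhds_unique (h.1 i 1 one_pos) (h'.1 i 1 one_pos),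
    funext fun j => tendsto_nhds_unique (h.2 j 1 one_pos) (h'.2 j 1 one_pos)⟩

theorem isTest_zero : IsTest fun _ _ => 0 := ⟨contDiff_const, HasCompactSupport.zero⟩

theorem dx_zero (x t : ℝ) : dx (fun _ _ => 0) x t = 0 := deriv_const _ _

theorem dt_zero (x t : ℝ) : dt (fun _ _ => 0) x t = 0 := deriv_const _ _

/-- The weak formulation on a single incoming road. -/
theorem IsWeakAtJunction.single_in (h : IsWeakAtJunction uin₀ uout₀ s) (i : Fin n)
    {θ : ℝ → ℝ → ℝ} (hθ : IsTest θ) (h0 : ∀ t, θ 0 t = 0 ∧ dx θ 0 t = 0) :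
    (∫ p in Iio (0 : ℝ) ×ˢ Ioi (0 : ℝ),
      (s.uin i p.1 p.2 * dt θ p.1 p.2 + s.vin i p.1 p.2 * dx θ p.1 p.2)) +
      ∫ x in Iio (0 : ℝ), uin₀ i * θ x 0 = 0 := by
  have := h (fun k => if k = i then θ else fun _ _ => 0) (fun _ _ _ => 0)
    (fun k => by split_ifs; exacts [hθ, isTest_zero]) (fun _ => isTest_zero)
    (fun k _ t _ => by
      split_ifs
      · rw [(h0 t).1, (h0 t).2, dx_zero]; exact ⟨rfl, rfl⟩
      · exact ⟨rfl, rfl⟩)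
  rw [Finset.sum_eq_single i] at this
  · simpa [dx_zero, dt_zero] using this
  · intro k _ hk
    simp [hk, dx_zero, dt_zero]
  · simp

/-- The weak formulation on a single outgoing road. -/
theorem IsWeakAtJunction.single_out (h : IsWeakAtJunction uin₀ uout₀ s) (j : Fin m)
    {θ : ℝ → ℝ → ℝ} (hθ : IsTest θ) (h0 : ∀ t, θ 0 t = 0 ∧ dx θ 0 t = 0) :
    (∫ p in Ioi (0 : ℝ) ×ˢ Ioi (0 : ℝ),
      (s.uout j p.1 p.2 * dt θ p.1 p.2 + s.vout j p.1 p.2 * dx θ p.1 p.2)) +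
      ∫ x in Ioi (0 : ℝ), uout₀ j * θ x 0 = 0 := by
  have := h (fun _ _ _ => 0) (fun k => if k = j then θ else fun _ _ => 0) (fun _ => isTest_zero)
    (fun k => by split_ifs; exacts [hθ, isTest_zero])
    (fun _ k t _ => by
      split_ifs
      · rw [(h0 t).1, (h0 t).2, dx_zero]; exact ⟨rfl, rfl⟩
      · exact ⟨rfl, rfl⟩)
  rw [Finset.sum_eq_single (s := (Finset.univ : Finset (Fin m))) j] at this
  · simpa [dx_zero, dt_zero] using this
  · intro k _ hk
    simp [hk, dx_zero, dt_zero]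
  · simp

namespace IsDistributedSolution

/-- Test functions whose value and space derivative vanish at the junction may be used on one road
alone; comparing with the balance on that road identifies the far density with the data. -/
theorem exists_in (h : IsDistributedSolution F β uin₀ uout₀ congested s)
    (hγ : HasFluxTraces s γin γout) (i : Fin n) :
    ∃ σ b, InProfile F (s.uin i) (s.vin i) (γin i) σ b (uin₀ i) := by
  obtain ⟨σ, b, u₀, hp⟩ := (h.road_in i).exists_inProfile (hγ.1 i 1 one_pos)
  obtain ⟨θ, h1, h2, h3⟩ := exists_test_left
  have := h.weak.single_in i h1 h2
  simp only [hp.weak_identity h1, (h2 _).1, integral_zero, mul_zero, zero_sub,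
    integral_const_mul] at this
  have e : u₀ = uin₀ i := mul_right_cancel₀ h3 (by linarith)
  exact ⟨σ, b, e ▸ hp⟩

theorem exists_out (h : IsDistributedSolution F β uin₀ uout₀ congested s)
    (hγ : HasFluxTraces s γin γout) (j : Fin m) :
    ∃ σ b, OutProfile F (s.uout j) (s.vout j) (γout j) σ b (uout₀ j) := by
  obtain ⟨σ, b, u₀, hp⟩ := (h.road_out j).exists_outProfile (hγ.2 j 1 one_pos)
  obtain ⟨θ, h1, h2, h3⟩ := exists_test_right
  have := h.weak.single_out j h1 h2
  simp only [hp.weak_identity h1, (h2 _).1, integral_zero, mul_zero, zero_sub,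
    integral_const_mul] at this
  have e : u₀ = uout₀ j := mul_right_cancel₀ h3 (by linarith)
  exact ⟨σ, b, e ▸ hp⟩

theorem isHull_out (h : IsDistributedSolution F β uin₀ uout₀ congested s)
    (huout₀ : ∀ j, uout₀ j ∈ Icc 0 F.umax) {j : Fin m} {σ : ℝ → ℝ} {γ b : ℝ}
    (hp : OutProfile F (s.uout j) (s.vout j) γ σ b (uout₀ j)) :
    (∀ᵐ x, 0 < x → F.curve.IsHull b (F.base (uout₀ j) (congested j)) x (σ x)) ∧
      F.curve.OutCond (F.base (uout₀ j) (congested j)) b := by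
  refine hp.isHull (JumpFlux.base_mem (huout₀ j)) (JumpFlux.curve_u_base (huout₀ j)) fun hu => ?_
  rw [JumpFlux.curve_v_base (huout₀ j)]
  exact h.ahead j hu 1 one_pos

theorem distribution_eq (h : IsDistributedSolution F β uin₀ uout₀ congested s)
    (hγ : HasFluxTraces s γin γout) (j : Fin m) :
    γout j = ∑ i, β i j * γin i := by
  obtain ⟨γ, γ', hγ', e⟩ := h.distribution
  obtain ⟨rfl, rfl⟩ := hγ.unique hγ'
  exact e j

end IsDistributedSolution

/-- The capacities of the incoming and outgoing roads. -/
def inCap (F : JumpFlux) (uin₀ : Fin n → ℝ) (i : Fin n) : ℝ :=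
  -- The value `false` is immaterial: over `u*` every state lies at or past the peak and has the
  -- same capacity.
  F.curve.cap (F.base (uin₀ i) false)

/-- Here `congested` matters: over `u*` the capacity is `f(u*-)` in the free flowing and `f(u*+)` in
the congested case. -/
def outCap (F : JumpFlux) (uout₀ : Fin m → ℝ) (congested : Fin m → Bool) (j : Fin m) : ℝ :=
  F.curve.reflect.cap (F.curve.len - F.base (uout₀ j) (congested j))

theorem IsDistributedSolution.mem_feasible
    (h : IsDistributedSolution F β uin₀ uout₀ congested s)
    (huin₀ : ∀ i, uin₀ i ∈ Icc 0 F.umax) (huout₀ : ∀ j, uout₀ j ∈ Icc 0 F.umax)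
    (hγ : HasFluxTraces s γin γout) :
    γin ∈ feasible β (inCap F uin₀) (outCap F uout₀ congested) := by
  constructor
  · intro i
    obtain ⟨σ, b, hp⟩ := h.exists_in hγ i
    rw [← hp.flux]
    exact ⟨JumpFlux.curve_v_nonneg hp.mem, (hp.isHull (JumpFlux.base_mem (huin₀ i))
      (JumpFlux.curve_u_base (huin₀ i))).2.v_le_cap hp.mem⟩
  · intro j
    obtain ⟨σ, b, hp⟩ := h.exists_out hγ j
    rw [← h.distribution_eq hγ, ← hp.flux]
    exact ⟨JumpFlux.curve_v_nonneg hp.mem, (h.isHull_out huout₀ hp).2.v_le_cap hp.mem⟩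

/-- Every feasible choice of fluxes is attained by a weak solution. -/
theorem exists_distributedSolution (hn : 1 ≤ n) (hm : 1 ≤ m) (hβ : ∀ i, ∑ j, β i j = 1)
    (huin₀ : ∀ i, uin₀ i ∈ Icc 0 F.umax) (huout₀ : ∀ j, uout₀ j ∈ Icc 0 F.umax)
    (hγ : γin ∈ feasible β (inCap F uin₀) (outCap F uout₀ congested)) :
    ∃ s, IsDistributedSolution F β uin₀ uout₀ congested s ∧
      HasFluxTraces s γin fun j => ∑ i, β i j * γin i := by
  have hin : ∀ i, ∃ σ : ℝ → ℝ, F.curve.IsEntropic (Iio 0) σ ∧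
      (Monotone (fun x => F.curve.u (σ x)) ∨ Antitone fun x => F.curve.u (σ x)) ∧
      Tendsto (fun x => F.curve.v (σ x)) (𝓝[<] 0) (𝓝 (γin i)) ∧
      Tendsto (fun x => F.curve.u (σ x)) atBot (𝓝 (uin₀ i)) := by
    intro i
    obtain ⟨b, hb, h1, h2⟩ := FluxCurve.exists_inCond F.curve_v_len
      (JumpFlux.base_mem (c := false) (huin₀ i)) (hγ.1 i)
    obtain ⟨σ, h3, h4, h5, h6, -⟩ := h1.exists_wave (JumpFlux.base_mem (huin₀ i)) hb
    rw [h2] at h5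
    rw [JumpFlux.curve_u_base (huin₀ i)] at h6
    exact ⟨σ, h3, h4, h5, h6⟩
  have hout : ∀ j, ∃ σ : ℝ → ℝ, F.curve.IsEntropic (Ioi 0) σ ∧
      (Monotone (fun x => F.curve.u (σ x)) ∨ Antitone fun x => F.curve.u (σ x)) ∧
      Tendsto (fun x => F.curve.v (σ x)) (𝓝[>] 0) (𝓝 (∑ i, β i j * γin i)) ∧
      Tendsto (fun x => F.curve.u (σ x)) atTop (𝓝 (uout₀ j)) ∧
      (uout₀ j = F.ustar → Tendsto (fun x => F.curve.v (σ x)) atTop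
        (𝓝 (F.aheadFlux (uout₀ j) (congested j)))) := by
    intro j
    have hbase := JumpFlux.base_mem (c := congested j) (huout₀ j)
    have hu := JumpFlux.curve_u_base (c := congested j) (huout₀ j)
    obtain ⟨b, hb, h1, h2⟩ := FluxCurve.exists_outCond F.curve_v_zero hbase (hγ.2 j)
    obtain ⟨σ, h3, h4, h5, h6, h7⟩ := h1.exists_wave hbase hb
    rw [h2] at h5
    rw [JumpFlux.curve_v_base (huout₀ j)] at h7
    refine ⟨σ, h3, h4, h5, hu ▸ h6, fun he => h7 ?_ fun τ hτ e => ?_⟩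
    -- The state ahead lies at or past the peak, while a new trace lies at or before it.
    · have : F.ustar ≤ F.base (uout₀ j) (congested j) := by
        by_contra! hc
        rw [JumpFlux.curve_u_of_le hc.le] at hu
        linarith
      rcases h1 with rfl | ⟨h8, -⟩
      · exact le_rfl
      · exact le_trans h8 this
    -- States of the arc with the density of the state ahead precede it on the vertical part, so
    -- their flux is at least as large.
    · rw [← JumpFlux.curve_v_base (huout₀ j)]
      rcases F.precedes_pt_of_le hτ.2 with h8 | h8
      · exact absurd e h8.ne
      · exact h8.2
  choose σ s1 s2 s3 s4 using hin
  choose ρ r1 r2 r3 r4 r5 using hout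
  set st : JunctionState n m :=
    { uin := fun i x t => F.curve.u (σ i (x / t))
      vin := fun i x t => F.curve.v (σ i (x / t))
      uout := fun j x t => F.curve.u (ρ j (x / t))
      vout := fun j x t => F.curve.v (ρ j (x / t)) } with hst
  have htr : HasFluxTraces st γin fun j => ∑ i, β i j * γin i :=
    ⟨fun i t ht => (s3 i).comp (tendsto_div_left ht),
      fun j t ht => (r3 j).comp (tendsto_div_right ht)⟩
  refine ⟨st, ⟨fun i => (s1 i).isRoadState isCone_Iio (s2 i),
    fun j => (r1 j).isRoadState isCone_Ioi (r2 j), fun φ ψ hφ hψ hφψ => ?_,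
    fun j hj t ht => ((r5 j hj).comp (tendsto_id.atTop_div_const ht)),
    γin, _, htr, fun j => rfl⟩, htr⟩
  set I : ℝ := ∫ t in Ioi (0:ℝ), φ ⟨0, hn⟩ 0 t with hI
  have hψI : ∀ j, ∫ t in Ioi (0:ℝ), ψ j 0 t = I := fun j =>
    setIntegral_congr_fun measurableSet_Ioi fun t ht => (hφψ _ j t (le_of_lt ht)).1.symm
  have hφI : ∀ i, ∫ t in Ioi (0:ℝ), φ i 0 t = I := fun i => by
    rw [← hψI ⟨0, hm⟩]
    exact setIntegral_congr_fun measurableSet_Ioi fun t ht => (hφψ i _ t (le_of_lt ht)).1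
  have hin : ∀ i, (∫ p in Iio (0 : ℝ) ×ˢ Ioi (0 : ℝ),
      (st.uin i p.1 p.2 * dt (φ i) p.1 p.2 + st.vin i p.1 p.2 * dx (φ i) p.1 p.2)) +
      ∫ x in Iio (0 : ℝ), uin₀ i * φ i x 0 = γin i * I := by
    intro i
    have : (∫ p in Iio (0 : ℝ) ×ˢ Ioi (0 : ℝ),
      (st.uin i p.1 p.2 * dt (φ i) p.1 p.2 + st.vin i p.1 p.2 * dx (φ i) p.1 p.2)) = _ :=
      (s1 i).weak_identity ((s4 i).mono_left inf_le_left) ((s3 i).mono_left inf_le_left) (hφ i)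
    rw [this, integral_const_mul, hφI, sub_add_cancel]
  have hout : ∀ j, (∫ p in Ioi (0 : ℝ) ×ˢ Ioi (0 : ℝ),
      (st.uout j p.1 p.2 * dt (ψ j) p.1 p.2 + st.vout j p.1 p.2 * dx (ψ j) p.1 p.2)) +
      ∫ x in Ioi (0 : ℝ), uout₀ j * ψ j x 0 = -(∑ i, β i j * γin i) * I := by
    intro j
    have : (∫ p in Ioi (0 : ℝ) ×ˢ Ioi (0 : ℝ),
      (st.uout j p.1 p.2 * dt (ψ j) p.1 p.2 + st.vout j p.1 p.2 * dx (ψ j) p.1 p.2)) = _ :=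
      (r1 j).weak_identity_out ((r4 j).mono_left inf_le_left) ((r3 j).mono_left inf_le_left) (hψ j)
    rw [this, integral_const_mul, hψI, sub_add_cancel]
  -- All test functions share the integral `I` over the junction; as the rows of `β` sum to one,
  -- total inflow and outflow cancel.
  rw [Finset.sum_congr rfl fun i _ => hin i, Finset.sum_congr rfl fun j _ => hout j,
    ← Finset.sum_mul, ← Finset.sum_mul, Finset.sum_neg_distrib, Finset.sum_comm]
  simp_rw [← Finset.sum_mul, hβ, one_mul]
  ring

/-- The fluxes of an admissible solution maximize the total flux. -/
theorem IsAdmissible.le_sum (h : IsAdmissible F β uin₀ uout₀ congested s) (hn : 1 ≤ n)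
    (hm : 1 ≤ m) (hβ : ∀ i, ∑ j, β i j = 1) (huin₀ : ∀ i, uin₀ i ∈ Icc 0 F.umax)
    (huout₀ : ∀ j, uout₀ j ∈ Icc 0 F.umax) (hγ : HasFluxTraces s γin γout) :
    ∀ δ ∈ feasible β (inCap F uin₀) (outCap F uout₀ congested), ∑ i, δ i ≤ ∑ i, γin i := by
  intro δ hδ
  obtain ⟨s', h1, h2⟩ := exists_distributedSolution hn hm hβ huin₀ huout₀ hδ
  exact h.2 s' h1 _ _ _ _ hγ h2

end Junction

/-- Nonnegative capacities make the polytope nonempty. A maximizer on it is realized by a solution,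
and every competitor has its fluxes in the same polytope. -/
theorem exists_admissible (F : JumpFlux) {n m : ℕ} (hn : 1 ≤ n) (hm : 1 ≤ m)
    {β : Matrix (Fin n) (Fin m) ℝ} (hβ : ∀ i, ∑ j, β i j = 1)
    {uin₀ : Fin n → ℝ} {uout₀ : Fin m → ℝ} (congested : Fin m → Bool)
    (huin₀ : ∀ i, uin₀ i ∈ Icc 0 F.umax) (huout₀ : ∀ j, uout₀ j ∈ Icc 0 F.umax) :
    ∃ s, IsAdmissible F β uin₀ uout₀ congested s := by
  have hpeak : ∀ {C : FluxCurve} {a : ℝ}, C.v 0 = 0 → C.v C.len = 0 → a ∈ Icc 0 C.len →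
      0 ≤ C.cap a := by
    intro C a h0 h1 ha
    rw [FluxCurve.cap]
    split_ifs
    · exact FluxCurve.v_nonneg h0 h1 ha
    · exact FluxCurve.v_nonneg h0 h1 C.peak_mem
  obtain ⟨γ, h1, h2⟩ := exists_max_feasible (β := β) (c := inCap F uin₀)
    (d := outCap F uout₀ congested)
    (fun i => hpeak F.curve_v_zero F.curve_v_len (JumpFlux.base_mem (huin₀ i)))
    (fun j => hpeak (by simpa [FluxCurve.reflect] using F.curve_v_len)
      (by simpa [FluxCurve.reflect] using F.curve_v_zero)
      (FluxCurve.mem_reflect (JumpFlux.base_mem (huout₀ j))))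
  obtain ⟨s, h3, h4⟩ := exists_distributedSolution hn hm hβ huin₀ huout₀ h1
  refine ⟨s, h3, fun s' h' γin γout γin' γout' hγ hγ' => ?_⟩
  rw [(hγ.unique h4).1]
  exact h2 _ (h'.mem_feasible huin₀ huout₀ hγ')

end

/-! ### Existence, uniqueness and structure of the admissible solution -/

theorem theorem3p1 (F : JumpFlux) (n m : ℕ) (hn : 1 ≤ n) (hnm : n ≤ m)
    (β : Matrix (Fin n) (Fin m) ℝ) (hβ : IsDistributionMatrix β)
    (uin₀ : Fin n → ℝ) (uout₀ : Fin m → ℝ) (congested : Fin m → Bool)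
    (huin₀ : ∀ i, uin₀ i ∈ Icc 0 F.umax) (huout₀ : ∀ j, uout₀ j ∈ Icc 0 F.umax) :
    (∃ s, IsAdmissible F β uin₀ uout₀ congested s) ∧
    (∀ s s', IsAdmissible F β uin₀ uout₀ congested s → IsAdmissible F β uin₀ uout₀ congested s' →
      (∀ i, ∀ᵐ p : ℝ × ℝ ∂(volume.restrict (Iio 0 ×ˢ Ioi 0)),
        s.uin i p.1 p.2 = s'.uin i p.1 p.2 ∧ s.vin i p.1 p.2 = s'.vin i p.1 p.2) ∧
      (∀ j, ∀ᵐ p : ℝ × ℝ ∂(volume.restrict (Ioi 0 ×ˢ Ioi 0)),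
        s.uout j p.1 p.2 = s'.uout j p.1 p.2 ∧ s.vout j p.1 p.2 = s'.vout j p.1 p.2)) ∧
    (∀ s, IsAdmissible F β uin₀ uout₀ congested s →
      ∃ (uin γin : Fin n → ℝ) (uout γout : Fin m → ℝ),
        HasFluxTraces s γin γout ∧
        (∀ i t, 0 < t → Tendsto (fun x => s.uin i x t) (𝓝[<] 0) (𝓝 (uin i))) ∧
        (∀ j t, 0 < t → Tendsto (fun x => s.uout j x t) (𝓝[>] 0) (𝓝 (uout j))) ∧
        (∀ i, uin i ∈ F.inSet (uin₀ i) ∧ γin i ∈ F.multi (uin i)) ∧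
        (∀ j, uout j ∈ F.outSet (uout₀ j) (congested j) ∧ γout j ∈ F.multi (uout j)) ∧
        (∀ i, ∀ v₀ ∈ F.multi (uin₀ i),
          (∀ᵐ p : ℝ × ℝ ∂(volume.restrict (Iio 0 ×ˢ Ioi 0)),
            F.IsHullState (uin₀ i, v₀) (uin i, γin i) (p.1 / p.2)
              (s.uin i p.1 p.2, s.vin i p.1 p.2)) ∧
          (∀ ξ, 0 < ξ → ∀ p,
            F.IsHullState (uin₀ i, v₀) (uin i, γin i) ξ p ↔ p = (uin i, γin i))) ∧
        (∀ j,
          (∀ᵐ p : ℝ × ℝ ∂(volume.restrict (Ioi 0 ×ˢ Ioi 0)),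
            F.IsHullState (uout j, γout j) (uout₀ j, F.aheadFlux (uout₀ j) (congested j))
              (p.1 / p.2) (s.uout j p.1 p.2, s.vout j p.1 p.2)) ∧
          (∀ ξ, ξ < 0 → ∀ p,
            F.IsHullState (uout j, γout j) (uout₀ j, F.aheadFlux (uout₀ j) (congested j)) ξ p ↔
              p = (uout j, γout j)))) := by
  have hm : 1 ≤ m := hn.trans hnm
  refine ⟨exists_admissible F hn hm hβ.sum_eq_one congested huin₀ huout₀, ?_, ?_⟩
  · intro s s' h h'
    obtain ⟨γin, γout, hγ, -⟩ := h.1.distribution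
    obtain ⟨γin', γout', hγ', -⟩ := h'.1.distribution
    -- Both flux vectors maximize the total flux over the same polytope.
    have e : γin = γin' := hβ.max_feasible_unique hn (h.1.mem_feasible huin₀ huout₀ hγ)
      (h'.1.mem_feasible huin₀ huout₀ hγ')
      (h.le_sum hn hm hβ.sum_eq_one huin₀ huout₀ hγ)
      (h'.le_sum hn hm hβ.sum_eq_one huin₀ huout₀ hγ')
    have e' : γout = γout' := funext fun j => by
      rw [h.1.distribution_eq hγ, h'.1.distribution_eq hγ', e]
    subst e e'
    constructor
    · intro i
      obtain ⟨σ, b, hp⟩ := h.1.exists_in hγ i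
      obtain ⟨σ', b', hp'⟩ := h'.1.exists_in hγ' i
      have hb := JumpFlux.base_mem (c := false) (huin₀ i)
      have hu := JumpFlux.curve_u_base (c := false) (huin₀ i)
      obtain ⟨h1, h2⟩ := hp.isHull hb hu
      obtain ⟨h1', h2'⟩ := hp'.isHull hb hu
      -- Equal fluxes force equal junction states, so both solutions follow the same wave.
      obtain rfl := h2.eq_of_v_eq h2' hp.mem hp'.mem (hp.flux.trans hp'.flux.symm)
      filter_upwards [hp.ae_eq, hp'.ae_eq,
        isCone_Iio.ae_prod (hp.entropic.eq_of_isHull hp'.entropic h1 h1')] with p e1 e2 e3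
      rw [e3, ← e2] at e1
      exact Prod.ext_iff.1 e1
    · intro j
      obtain ⟨σ, b, hp⟩ := h.1.exists_out hγ j
      obtain ⟨σ', b', hp'⟩ := h'.1.exists_out hγ' j
      obtain ⟨h1, h2⟩ := h.1.isHull_out huout₀ hp
      obtain ⟨h1', h2'⟩ := h'.1.isHull_out huout₀ hp'
      obtain rfl := h2.eq_of_v_eq h2' hp.mem hp'.mem (hp.flux.trans hp'.flux.symm)
      filter_upwards [hp.ae_eq, hp'.ae_eq,
        isCone_Ioi.ae_prod (hp.entropic.eq_of_isHull_out hp'.entropic h1 h1')] with p e1 e2 e3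
      rw [e3, ← e2] at e1
      exact Prod.ext_iff.1 e1
  · intro s h
    obtain ⟨γin, γout, hγ, -⟩ := h.1.distribution
    choose σ b hp using h.1.exists_in hγ
    choose ρ c hq using h.1.exists_out hγ
    have eb : ∀ i, F.pt (b i) = (F.curve.u (b i), γin i) := fun i => Prod.ext rfl (hp i).flux
    have ec : ∀ j, F.pt (c j) = (F.curve.u (c j), γout j) := fun j => Prod.ext rfl (hq j).flux
    refine ⟨fun i => F.curve.u (b i), γin, fun j => F.curve.u (c j), γout, hγ,
      fun i => (hp i).trace, fun j => (hq j).trace, fun i => ⟨?_, ?_⟩, fun j => ⟨?_, ?_⟩,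
      fun i v₀ hv₀ => ?_, fun j => ?_⟩
    · have hb := JumpFlux.base_mem (c := false) (huin₀ i)
      have hu := JumpFlux.curve_u_base (c := false) (huin₀ i)
      have := JumpFlux.mem_inSet hb (hp i).mem ((hp i).isHull hb hu).2
      rwa [hu] at this
    · have := (F.pt_mem (hp i).mem).2
      rwa [eb] at this
    · exact JumpFlux.mem_outSet (JumpFlux.base_mem (huout₀ j)) (hq j).mem
        (JumpFlux.pt_base (huout₀ j)) (h.1.isHull_out huout₀ (hq j)).2
    · have := (F.pt_mem (hq j).mem).2
      rwa [ec] at this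
    -- Any parameter over the initial density may serve as the left state, hence every `v₀`.
    · obtain ⟨ha, ea⟩ := F.param_mem (p := (uin₀ i, v₀)) ⟨huin₀ i, hv₀⟩
      obtain ⟨h1, h2⟩ := (hp i).isHull ha (congrArg Prod.fst ea)
      simp only [← eb]
      rw [← ea]
      refine ⟨?_, fun ξ hξ => JumpFlux.isHullState_iff_eq ha (hp i).mem (hp i).mem fun _ =>
        h2.isHull_iff ha (hp i).mem hξ⟩
      filter_upwards [(hp i).ae_eq, isCone_Iio.ae_prod h1] with p e1 e2
      rw [e1, F.isHullState_pt ha (hp i).mem ((hp i).entropic.mem _)]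
      exact e2
    · have ha := JumpFlux.base_mem (c := congested j) (huout₀ j)
      obtain ⟨h1, h2⟩ := h.1.isHull_out huout₀ (hq j)
      simp only [← ec, ← JumpFlux.pt_base (huout₀ j)]
      refine ⟨?_, fun ξ hξ => JumpFlux.isHullState_iff_eq (hq j).mem ha (hq j).mem fun _ =>
        h2.isHull_iff ha (hq j).mem hξ⟩
      filter_upwards [(hq j).ae_eq, isCone_Ioi.ae_prod h1,
        ae_restrict_mem (measurableSet_Ioi.prod measurableSet_Ioi)] with p e1 e2 e3
      rw [e1, F.isHullState_pt (hq j).mem ha ((hq j).entropic.mem _)]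
      exact e2
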